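/- Let $\gamma=(1+\sqrt5)/2$. For an algebraic number $\alpha\in\mathbf C$, let $H(\alpha)$ denote the largest absolute value of the coefficients of the irreducible polynomial of $\alpha$ over $\mathbf Z$ (that is, the polynomial in $\mathbf Z[T]$, unique up to sign, which is irreducible in $\mathbf Z[T]$ and vanishes at $\alpha$). Let $\xi$ be a real number which is neither rational nor quadratic over $\mathbf Q$, and suppose that there is a constant $c>0$ such that, for every real number $X\ge 1$, the inequalities $$0<x_0\le X,\qquad |x_0\xi-x_1|\le cX^{-1/\gamma},\qquad |x_0\xi^2-x_2|\le cX^{-1/\gamma}$$ have a solution $(x_0,x_1,x_2)\in\mathbf Z^3$. Then there exist constants $c_1,\dots,c_5>0$ (depending on $\xi$) with the following properties: (1) for every rational number $\alpha\in\mathbf Q$, we have $|\xi-\alpha|\ge c_1H(\alpha)^{-2}(1+\log H(\alpha))^{-c_2}$; (2) for every algebraic number $\alpha\in\mathbf C$ of degree at most two over $\mathbf Q$, we have $|\xi-\alpha|\ge c_3H(\alpha)^{-2\gamma^2}$; (3) there exist infinitely many real numbers $\alpha$, algebraic of degree exactly two over $\mathbf Q$, with $|\xi-\alpha|\le c_4H(\alpha)^{-2\gamma^2}$;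 (4) for every algebraic integer $\alpha\in\mathbf C$ of degree at most three over $\mathbf Q$, we have $|\xi-\alpha|\ge c_5H(\alpha)^{-(3/2)\gamma^2}$. -/

import Mathlib

open scoped Polynomial

/-- A primitive integer multiple of the minimal polynomial over `ℚ` of an algebraic number `α`,
i.e. the irreducible polynomial of `α` over `ℤ` (unique up to sign). -/
noncomputable def integerMinpoly (α : ℂ) : ℤ[X] :=
  (IsLocalization.integerNormalization (nonZeroDivisors ℤ) (minpoly ℚ α)).primPart

/-- The (naive) height `H(α)` of an algebraic number `α`: the largest absolute value of the
coefficients of its irreducible polynomial over `ℤ`. -/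
noncomputable def naiveHeight (α : ℂ) : ℝ :=
  (integerMinpoly α).supNorm

open Polynomial in
/-- Every irreducible polynomial of `ℤ[X]` that vanishes at `α` equals `± integerMinpoly α`. -/
theorem eq_or_eq_neg_integerMinpoly {α : ℂ} {P : ℤ[X]} (hP : Irreducible P)
    (h : aeval α P = 0) : P = integerMinpoly α ∨ P = -integerMinpoly α := by
  have hdeg : P.natDegree ≠ 0 := by
    intro h0
    rw [eq_C_of_natDegree_eq_zero h0] at h
    have h1 : P.coeff 0 = 0 := by simpa using h
    apply hP.ne_zero
    rw [eq_C_of_natDegree_eq_zero h0, h1, C_0]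
  have hprim : P.IsPrimitive := hP.isPrimitive hdeg
  have hirr : Irreducible (P.map (algebraMap ℤ ℚ)) :=
    hprim.irreducible_iff_irreducible_map_fraction_map.1 hP
  have hroot : aeval α (P.map (algebraMap ℤ ℚ)) = 0 := by
    rw [aeval_map_algebraMap, h]
  have hint : IsIntegral ℚ α := IsAlgebraic.isIntegral ⟨_, hirr.ne_zero, hroot⟩
  have hass : Associated (minpoly ℚ α) (P.map (algebraMap ℤ ℚ)) :=
    (minpoly.irreducible hint).associated_of_dvd hirr (minpoly.dvd ℚ α hroot)
  obtain ⟨b, hb, hN⟩ := IsLocalization.integerNormalization_spec (nonZeroDivisors ℤ) (minpoly ℚ α)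
  set N := IsLocalization.integerNormalization (nonZeroDivisors ℤ) (minpoly ℚ α) with hNdef
  have hb0 : b ≠ 0 := nonZeroDivisors.ne_zero hb
  have hN0 : N ≠ 0 := by
    rw [hNdef, Ne, IsFractionRing.integerNormalization_eq_zero_iff]
    exact minpoly.ne_zero hint
  have hc0 : N.content ≠ 0 := by rwa [Ne, content_eq_zero_iff]
  have e1 : C ((algebraMap ℤ ℚ) N.content) * (integerMinpoly α).map (algebraMap ℤ ℚ)
      = C ((algebraMap ℤ ℚ) b) * minpoly ℚ α := by
    rw [← map_C, ← Polynomial.map_mul]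
    change (C N.content * N.primPart).map _ = _
    rw [← eq_C_content_mul_primPart, hN, Algebra.smul_def, Polynomial.algebraMap_apply]
  have u1 : IsUnit (C ((algebraMap ℤ ℚ) N.content) : ℚ[X]) := by
    rw [isUnit_C, isUnit_iff_ne_zero]; simpa using hc0
  have u2 : IsUnit (C ((algebraMap ℤ ℚ) b) : ℚ[X]) := by
    rw [isUnit_C, isUnit_iff_ne_zero]; simpa using hb0
  have a1 : Associated ((integerMinpoly α).map (algebraMap ℤ ℚ)) (minpoly ℚ α) :=
    ((associated_isUnit_mul_left_iff u1).2 (Associated.refl _)).symm.trans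
      (e1 ▸ (associated_isUnit_mul_left_iff u2).2 (Associated.refl _))
  have a2 := a1.trans hass
  have a3 : Associated P (integerMinpoly α) :=
    associated_of_dvd_dvd (hprim.dvd_of_fraction_map_dvd_fraction_map a2.symm.dvd)
      ((isPrimitive_primPart N).dvd_of_fraction_map_dvd_fraction_map a2.dvd)
  obtain ⟨u, hu⟩ := a3.symm
  obtain ⟨r, hr, hru⟩ := Polynomial.isUnit_iff.1 u.isUnit
  rcases Int.isUnit_iff.1 hr with rfl | rfl
  · left; rw [← hu, ← hru]; simp
  · right; rw [← hu, ← hru]; simp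

open Polynomial in
/-- The height of `α` is that of any irreducible polynomial of `ℤ[X]` that vanishes at `α`. -/
theorem naiveHeight_eq_supNorm {α : ℂ} {P : ℤ[X]} (hP : Irreducible P)
    (h : aeval α P = 0) : naiveHeight α = P.supNorm := by
  rcases eq_or_eq_neg_integerMinpoly hP h with rfl | rfl
  · rfl
  · simp [naiveHeight, supNorm_eq_iSup]

/-- A real number is quadratic if it is algebraic of degree exactly two over `ℚ`. -/
def IsQuadratic (α : ℝ) : Prop :=
  (minpoly ℚ α).natDegree = 2

/-- The real numbers `ξ`, neither rational nor quadratic, for which there is a constant `c > 0`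
such that for each real `X ≥ 1` the inequalities `0 < x₀ ≤ X`, `|x₀ ξ - x₁| ≤ c X ^ (-1/γ)`,
`|x₀ ξ² - x₂| ≤ c X ^ (-1/γ)` have a solution in integers, `γ` being the golden ratio. -/
def IsExtremal (ξ : ℝ) : Prop :=
  Irrational ξ ∧ ¬ IsQuadratic ξ ∧
    ∃ c : ℝ, 0 < c ∧ ∀ X : ℝ, 1 ≤ X → ∃ x₀ x₁ x₂ : ℤ,
      0 < x₀ ∧ (x₀ : ℝ) ≤ X ∧
      |(x₀ : ℝ) * ξ - x₁| ≤ c * X ^ (-1 / Real.goldenRatio) ∧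
      |(x₀ : ℝ) * ξ ^ 2 - x₂| ≤ c * X ^ (-1 / Real.goldenRatio)

/-!
Write `γ` for the golden ratio, `L(x) = max (|x₀ ξ - x₁|, |x₀ ξ² - x₂|)` for an integer point `x`,
and view `x` also as the symmetric matrix with rows `(x₀, x₁)` and `(x₁, x₂)`.

The hypothesis bounds `L` at the minimal points `xᵢ`, the integer points that are closest to the
line spanned by `(1, ξ, ξ²)` for their size. Such a point, once large, has nonzero determinant
(`IsMinimalSeq.symmDet_ne_zero`), so `L(xᵢ)` is at least of the order of the inverse of its first
coordinate. Whenever three consecutive minimal points are independent, which happens infinitely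
often as `1, ξ, ξ²` are independent over `ℚ`, the middle one, of first coordinate `Y`, has `L` of
the exact order `1 / Y`. Between two such moments the minimal points stay in one plane, and the
covolume of its lattice of integer points, computed at both ends, shows that the next such `Y` is
of the exact order `Y ^ γ` (`IsMinimalSeq.goldenRoot_le_of_forall`). The result is a sequence
`yₖ` of nondegenerate points with first coordinates `Yₖ`, `Yₖ₊₁ ≍ Yₖ ^ γ`, `L(yₖ) ≍ 1 / Yₖ`, of
which any three consecutive ones are independent (`IsExtremal.exists_isExtremalSeq`). Everything
else follows from this sequence.

* For a nonzero polynomial `P = a T² + b T + c` over `ℤ` the integer `c Y + b y₁ + a y₂` is close to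
  `Y P(ξ)`, and it is nonzero at one of three consecutive terms. This bounds `|P(ξ)|` from below
  and gives the estimate for numbers of degree at most two (`exists_le_abs_quadratic`).
* The polynomial that vanishes at `yₖ` and `yₖ₊₁` has coefficients of order at most `Yₖ₊₁ / Yₖ`,
  a derivative at `ξ` of that order because `yₖ` is nondegenerate, and a value at `ξ` of order at
  most `1 / (Yₖ Yₖ₊₁)`. Its root near `ξ` is one of the required quadratic numbers
  (`exists_quadratic_root`).
* If `n` is the integer closest to `Yₖ₊₂ ξ³`, then the point formed by the last two coordinates of
  `yₖ₊₂` and `n` is close to `ξ yₖ₊₂`. At it the linear form vanishing at `yₖ` and `yₖ₊₁` takes an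
  integer value close to `ξ` times the bounded nonzero integer `det (yₖ, yₖ₊₁, yₖ₊₂)`. As `ξ` is
  irrational, this bounds the distance from `Yₖ₊₂ ξ³` to the integers from below, and with it the
  values at `ξ` of monic cubics (`exists_le_abs_cube_sub`, `exists_le_abs_cubic`).
* Let `v = (q, p)` be an integer vector and `ℓ(v) = q ξ - p`. The product of the matrices of two
  consecutive terms with `Yₖ₊₁ / Yₖ = R` divides the length of `v` by `R` and multiplies `ℓ(v)` by
  at most `R`, up to constants, as long as `ℓ(v)` is small (`exists_descent`). The ratio `R` can be
  chosen between the power `1 / γ` of the length and the length itself, up to constants. A step then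
  increases `|q ℓ(v)|` by at most a bounded factor and multiplies `log |q|` by a factor less than
  one. About `log log |q|` steps suffice, which accounts for the power of the logarithm
  (`exists_le_mul_abs_linForm`).
-/

section

open Real Matrix
open scoped goldenRatio

/-! ### The power map with exponent `1 / γ` -/

/-- The map `X ↦ X ^ (1 / γ)`. As `1 / γ + 1 / γ ^ 2 = 1`, it satisfies
`X = goldenRoot X * goldenRoot (goldenRoot X)`, which is the only property of the golden ratio
that the growth estimates use. -/
noncomputable def goldenRoot (X : ℝ) : ℝ := X ^ (φ⁻¹)

theorem goldenRoot_pos {X : ℝ} (hX : 0 < X) : 0 < goldenRoot X := rpow_pos_of_pos hX _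

theorem goldenRoot_mul {a b : ℝ} (ha : 0 ≤ a) (hb : 0 ≤ b) :
    goldenRoot (a * b) = goldenRoot a * goldenRoot b := mul_rpow ha hb

theorem goldenRoot_mono {a b : ℝ} (ha : 0 ≤ a) (h : a ≤ b) : goldenRoot a ≤ goldenRoot b :=
  rpow_le_rpow ha h (inv_nonneg.2 goldenRatio_pos.le)

theorem goldenRoot_le_iff {a b : ℝ} (ha : 0 ≤ a) (hb : 0 ≤ b) :
    goldenRoot a ≤ goldenRoot b ↔ a ≤ b :=
  rpow_le_rpow_iff ha hb (inv_pos.2 goldenRatio_pos)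

theorem goldenRoot_rpow {a : ℝ} (ha : 0 ≤ a) : goldenRoot (a ^ φ) = a :=
  rpow_rpow_inv ha goldenRatio_ne_zero

theorem one_le_goldenRoot {X : ℝ} (hX : 1 ≤ X) : 1 ≤ goldenRoot X :=
  one_le_rpow hX (inv_nonneg.2 goldenRatio_pos.le)

theorem goldenRoot_le_self {X : ℝ} (hX : 1 ≤ X) : goldenRoot X ≤ X :=
  rpow_le_self_of_one_le hX (inv_le_one_of_one_le₀ one_lt_goldenRatio.le)

theorem goldenRatio_inv_add_sq : φ⁻¹ + φ⁻¹ * φ⁻¹ = 1 := by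
  rw [inv_goldenRatio]
  linear_combination goldenConj_sq

theorem goldenRoot_mul_goldenRoot_goldenRoot {X : ℝ} (hX : 0 < X) :
    goldenRoot X * goldenRoot (goldenRoot X) = X := by
  unfold goldenRoot
  rw [← rpow_mul hX.le, ← rpow_add hX, goldenRatio_inv_add_sq, rpow_one]

theorem le_of_goldenRoot_le {a b C : ℝ} (ha : 0 ≤ a) (hb : 0 ≤ b) (hC : 0 ≤ C)
    (h : goldenRoot a ≤ C * goldenRoot b) : a ≤ C ^ φ * b := by
  rw [← goldenRoot_rpow hC, ← goldenRoot_mul (by positivity) hb] at h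
  exact (goldenRoot_le_iff ha (by positivity)).1 h

theorem goldenRoot_le_of_le {a b C : ℝ} (ha : 0 ≤ a) (hb : 0 ≤ b) (hC : 0 ≤ C)
    (h : a ≤ C * b) : goldenRoot a ≤ goldenRoot C * goldenRoot b := by
  rw [← goldenRoot_mul hC hb]
  exact goldenRoot_mono ha h

/-- A bound `X ≤ C * X ^ (2 / γ ^ 2)` bounds `X`, because `2 / γ ^ 2 < 1`. -/
theorem le_of_le_mul_goldenRoot_sq {X C : ℝ} (hX : 0 < X) (hC : 0 ≤ C)
    (h : X ≤ C * goldenRoot (goldenRoot X) ^ 2) : X ≤ ((C ^ φ) ^ φ) ^ φ := by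
  have hg := goldenRoot_pos hX
  have hgg := goldenRoot_pos hg
  have h1 : goldenRoot X ≤ C * goldenRoot (goldenRoot X) := by
    nth_rewrite 1 [← goldenRoot_mul_goldenRoot_goldenRoot hX] at h
    rw [sq, ← mul_assoc] at h
    exact le_of_mul_le_mul_right h hgg
  have h2 := le_of_goldenRoot_le hX.le hg.le hC h1
  have h3 : goldenRoot (goldenRoot X) ≤ C ^ φ * 1 := by
    nth_rewrite 1 [← goldenRoot_mul_goldenRoot_goldenRoot hX] at h2
    rw [mul_comm] at h2
    rw [mul_one]
    exact le_of_mul_le_mul_right h2 hg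
  have h1' : goldenRoot (1 : ℝ) = 1 := by simp [goldenRoot]
  have h4 := le_of_goldenRoot_le hg.le zero_le_one (C := C ^ φ) (by positivity)
    (by rwa [h1'])
  have h5 := le_of_goldenRoot_le hX.le zero_le_one (C := (C ^ φ) ^ φ) (by positivity)
    (by rw [h1']; exact h4)
  simpa using h5

/-! ### Integer points and their distance to the line spanned by `(1, ξ, ξ²)` -/

theorem cross_zero {R : Type*} [CommRing R] (x y : Fin 3 → R) :
    (x ⨯₃ y) 0 = x 1 * y 2 - x 2 * y 1 := by simp [cross_apply]

theorem cross_one {R : Type*} [CommRing R] (x y : Fin 3 → R) :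
    (x ⨯₃ y) 1 = x 2 * y 0 - x 0 * y 2 := by simp [cross_apply]

theorem cross_two {R : Type*} [CommRing R] (x y : Fin 3 → R) :
    (x ⨯₃ y) 2 = x 0 * y 1 - x 1 * y 0 := by simp [cross_apply]

/-- The distance, in the maximum norm, from `(x₁, x₂)` to `(x₀ ξ, x₀ ξ²)`. -/
noncomputable def lineDist (ξ : ℝ) (x : Fin 3 → ℤ) : ℝ :=
  max |(x 0 : ℝ) * ξ - x 1| |(x 0 : ℝ) * ξ ^ 2 - x 2|

/-- The determinant of the symmetric matrix with rows `(x₀, x₁)` and `(x₁, x₂)`. -/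
def symmDet (x : Fin 3 → ℤ) : ℤ := x 0 * x 2 - x 1 ^ 2

theorem abs_one_le_lineDist (ξ : ℝ) (x : Fin 3 → ℤ) :
    |(x 0 : ℝ) * ξ - x 1| ≤ lineDist ξ x := le_max_left _ _

theorem abs_two_le_lineDist (ξ : ℝ) (x : Fin 3 → ℤ) :
    |(x 0 : ℝ) * ξ ^ 2 - x 2| ≤ lineDist ξ x := le_max_right _ _

theorem lineDist_nonneg (ξ : ℝ) (x : Fin 3 → ℤ) : 0 ≤ lineDist ξ x :=
  (abs_nonneg _).trans (abs_one_le_lineDist ξ x)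

/-- The linear form with coefficients `m` at an integer point is close to a multiple of the value
at `ξ` of the polynomial with coefficients `m`. -/
theorem abs_dotProduct_sub_le (ξ : ℝ) (m x : Fin 3 → ℤ) :
    |((m ⬝ᵥ x : ℤ) : ℝ) - x 0 * (m 0 + m 1 * ξ + m 2 * ξ ^ 2)| ≤
      (|(m 1 : ℝ)| + |(m 2 : ℝ)|) * lineDist ξ x := by
  have e : ((m ⬝ᵥ x : ℤ) : ℝ) - x 0 * (m 0 + m 1 * ξ + m 2 * ξ ^ 2)
      = -(m 1 * (x 0 * ξ - x 1)) - m 2 * (x 0 * ξ ^ 2 - x 2) := by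
    rw [vec3_dotProduct]; push_cast; ring
  rw [e]
  refine (abs_sub _ _).trans ?_
  rw [abs_neg, abs_mul, abs_mul, add_mul]
  gcongr
  · exact abs_one_le_lineDist ξ x
  · exact abs_two_le_lineDist ξ x

/-- If `u`, `v` are independent, `n` and `m ≠ 0` are both orthogonal to `u` and `v`, and `w` is
orthogonal to `m`, then `w` is orthogonal to `n`. -/
theorem dotProduct_eq_zero_of_orthogonal {u v m n w : Fin 3 → ℤ} (huv : u ⨯₃ v ≠ 0)
    (hnu : n ⬝ᵥ u = 0) (hnv : n ⬝ᵥ v = 0) (hmu : m ⬝ᵥ u = 0) (hmv : m ⬝ᵥ v = 0)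
    (hm : m ≠ 0) (hmw : m ⬝ᵥ w = 0) : n ⬝ᵥ w = 0 := by
  -- both `n` and `m` are parallel to `u ⨯₃ v`, hence to each other
  have key : ∀ (p : Fin 3 → ℤ), p ⬝ᵥ u = 0 → p ⬝ᵥ v = 0 → ∀ i j,
      p i * (u ⨯₃ v) j = p j * (u ⨯₃ v) i := by
    intro p hu hv
    have hz : p ⨯₃ (u ⨯₃ v) = 0 := by
      rw [vec3_dotProduct] at hu hv
      ext i
      fin_cases i
      · simp only [Fin.zero_eta, cross_zero, cross_one, cross_two, Pi.zero_apply]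
        linear_combination u 0 * hv - v 0 * hu
      · simp only [Fin.mk_one, cross_zero, cross_one, cross_two, Pi.zero_apply]
        linear_combination u 1 * hv - v 1 * hu
      · simp only [Fin.reduceFinMk, cross_zero, cross_one, cross_two, Pi.zero_apply]
        linear_combination u 2 * hv - v 2 * hu
    have h0 := congrFun hz 0
    have h1 := congrFun hz 1
    have h2 := congrFun hz 2
    rw [cross_zero, Pi.zero_apply] at h0
    rw [cross_one, Pi.zero_apply] at h1
    rw [cross_two, Pi.zero_apply] at h2
    intro i j
    fin_cases i <;> fin_cases j <;>
      simp only [Fin.zero_eta, Fin.mk_one, Fin.reduceFinMk] <;> linarith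
  obtain ⟨j, hj⟩ := Function.ne_iff.1 huv
  obtain ⟨i, hi⟩ := Function.ne_iff.1 hm
  rw [Pi.zero_apply] at hi hj
  have hmj : m j ≠ 0 := by
    intro h
    have := key m hmu hmv i j
    rw [h, zero_mul] at this
    exact (mul_ne_zero hi hj) this
  have hpar : ∀ k, m j * n k = n j * m k := by
    intro k
    have h3 := key m hmu hmv k j
    apply mul_right_cancel₀ hj
    linear_combination n k * (key m hmu hmv j j) + m j * (key n hnu hnv k j) - n j * h3
  apply (mul_eq_zero.1 (?_ : m j * (n ⬝ᵥ w) = 0)).resolve_left hmj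
  rw [vec3_dotProduct] at hmw ⊢
  linear_combination w 0 * hpar 0 + w 1 * hpar 1 + w 2 * hpar 2 + n j * hmw

/-- Cramer's rule. -/
theorem eq_zero_of_dotProduct_eq_zero {u v w m : Fin 3 → ℤ} (h : u ⬝ᵥ (v ⨯₃ w) ≠ 0)
    (hu : m ⬝ᵥ u = 0) (hv : m ⬝ᵥ v = 0) (hw : m ⬝ᵥ w = 0) : m = 0 := by
  rw [vec3_dotProduct] at hu hv hw
  rw [vec3_dotProduct, cross_zero, cross_one, cross_two] at h
  ext i
  apply (mul_eq_zero.1 (?_ : _ * m i = 0)).resolve_left h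
  fin_cases i
  · simp only [Fin.zero_eta]
    linear_combination (v 1 * w 2 - v 2 * w 1) * hu + (w 1 * u 2 - w 2 * u 1) * hv
      + (u 1 * v 2 - u 2 * v 1) * hw
  · simp only [Fin.mk_one]
    linear_combination (v 2 * w 0 - v 0 * w 2) * hu + (w 2 * u 0 - w 0 * u 2) * hv
      + (u 2 * v 0 - u 0 * v 2) * hw
  · simp only [Fin.reduceFinMk]
    linear_combination (v 0 * w 1 - v 1 * w 0) * hu + (w 0 * u 1 - w 1 * u 0) * hv
      + (u 0 * v 1 - u 1 * v 0) * hw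

theorem abs_triple_le (ξ : ℝ) (x y z : Fin 3 → ℤ) :
    |((x ⬝ᵥ (y ⨯₃ z) : ℤ) : ℝ)| ≤
      2 * (|(x 0 : ℝ)| * (lineDist ξ y * lineDist ξ z) + |(y 0 : ℝ)| * (lineDist ξ x * lineDist ξ z)
        + |(z 0 : ℝ)| * (lineDist ξ x * lineDist ξ y)) := by
  have e : ((x ⬝ᵥ (y ⨯₃ z) : ℤ) : ℝ) =
      x 0 * ((y 0 * ξ - y 1) * (z 0 * ξ ^ 2 - z 2) - (y 0 * ξ ^ 2 - y 2) * (z 0 * ξ - z 1))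
      - y 0 * ((x 0 * ξ - x 1) * (z 0 * ξ ^ 2 - z 2) - (x 0 * ξ ^ 2 - x 2) * (z 0 * ξ - z 1))
      + z 0 * ((x 0 * ξ - x 1) * (y 0 * ξ ^ 2 - y 2) - (x 0 * ξ ^ 2 - x 2) * (y 0 * ξ - y 1)) := by
    rw [vec3_dotProduct, cross_zero, cross_one, cross_two]; push_cast; ring
  have aux : ∀ (a b : Fin 3 → ℤ), |((a 0 * ξ - a 1) * (b 0 * ξ ^ 2 - b 2)
      - (a 0 * ξ ^ 2 - a 2) * (b 0 * ξ - b 1) : ℝ)| ≤ 2 * (lineDist ξ a * lineDist ξ b) := by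
    intro a b
    refine (abs_sub _ _).trans ?_
    rw [abs_mul, abs_mul, two_mul]
    have := lineDist_nonneg ξ a
    exact add_le_add
      (mul_le_mul (abs_one_le_lineDist ξ a) (abs_two_le_lineDist ξ b) (abs_nonneg _) this)
      (mul_le_mul (abs_two_le_lineDist ξ a) (abs_one_le_lineDist ξ b) (abs_nonneg _) this)
  rw [e]
  refine (abs_add_le _ _).trans ?_
  refine (add_le_add_left (abs_sub _ _) _).trans ?_
  rw [abs_mul, abs_mul, abs_mul]
  have h1 := mul_le_mul_of_nonneg_left (aux y z) (abs_nonneg (x 0 : ℝ))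
  have h2 := mul_le_mul_of_nonneg_left (aux x z) (abs_nonneg (y 0 : ℝ))
  have h3 := mul_le_mul_of_nonneg_left (aux x y) (abs_nonneg (z 0 : ℝ))
  linarith

/-! ### Minimal points -/

/-- The least possible value of `lineDist ξ` at integer points with first coordinate `n`. -/
noncomputable def simulDist (ξ : ℝ) (n : ℕ) : ℝ :=
  lineDist ξ ![(n : ℤ), round ((n : ℝ) * ξ), round ((n : ℝ) * ξ ^ 2)]

theorem simulDist_le_lineDist (ξ : ℝ) (x : Fin 3 → ℤ) :
    simulDist ξ (x 0).natAbs ≤ lineDist ξ x := by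
  have key : ∀ y : Fin 3 → ℤ, 0 ≤ y 0 → simulDist ξ (y 0).natAbs ≤ lineDist ξ y := by
    intro y hy
    have h : (((y 0).natAbs : ℤ) : ℝ) = y 0 := by rw [Int.natAbs_of_nonneg hy]
    have h' : (((y 0).natAbs : ℕ) : ℝ) = y 0 := by rw [← h, Int.cast_natCast]
    simp only [simulDist, lineDist, cons_val_zero, cons_val_one, cons_val, h, h']
    exact max_le_max (round_le _ _) (round_le _ _)
  rcases le_total 0 (x 0) with h | h
  · exact key x h
  · have := key (-x) (by simpa using h)
    have e : lineDist ξ (-x) = lineDist ξ x := by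
      simp only [lineDist, Pi.neg_apply, Int.cast_neg]
      congr 1
      · rw [← abs_neg]; congr 1; ring
      · rw [← abs_neg]; congr 1; ring
    rwa [e, Pi.neg_apply, Int.natAbs_neg] at this

theorem simulDist_pos {ξ : ℝ} (hξ : Irrational ξ) {n : ℕ} (hn : 0 < n) : 0 < simulDist ξ n := by
  refine lt_of_lt_of_le ?_ (abs_one_le_lineDist _ _)
  simp only [cons_val_zero, cons_val_one, Int.cast_natCast]
  rw [abs_pos, sub_ne_zero]
  exact (hξ.natCast_mul hn.ne').ne_int _

theorem simulDist_le_one (ξ : ℝ) (n : ℕ) : simulDist ξ n ≤ 1 := by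
  simp only [simulDist, lineDist, cons_val_zero, cons_val_one, cons_val, Int.cast_natCast]
  exact max_le ((abs_sub_round _).trans (by norm_num)) ((abs_sub_round _).trans (by norm_num))

/-- A sequence of integer points with increasing first coordinate, in which every point is closest
to the line spanned by `(1, ξ, ξ²)` among the integer points with smaller first coordinate than
the next point, and for which this distance decays at the rate required of extremal numbers. -/
structure IsMinimalSeq (ξ : ℝ) (x : ℕ → Fin 3 → ℤ) (c : ℝ) : Prop where
  one_le_zero : ∀ i, 1 ≤ x i 0
  strictMono : StrictMono fun i => x i 0
  strictAnti : StrictAnti fun i => lineDist ξ (x i)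
  le_one : ∀ i, lineDist ξ (x i) ≤ 1
  minimal : ∀ i z, z 0 ≠ 0 → |z 0| < x (i + 1) 0 → lineDist ξ (x i) ≤ lineDist ξ z
  pos : 0 < c
  decay : ∀ i, lineDist ξ (x i) * goldenRoot (x (i + 1) 0) ≤ c

theorem IsMinimalSeq.shift {ξ c : ℝ} {x : ℕ → Fin 3 → ℤ} (h : IsMinimalSeq ξ x c) (N : ℕ) :
    IsMinimalSeq ξ (fun i => x (i + N)) c where
  one_le_zero i := h.one_le_zero _
  strictMono i j hij := h.strictMono (by omega : i + N < j + N)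
  strictAnti i j hij := h.strictAnti (by omega : i + N < j + N)
  le_one i := h.le_one _
  minimal i z hz hz' := h.minimal (i + N) z hz (by rwa [show i + N + 1 = i + 1 + N by omega])
  pos := h.pos
  decay i := by
    have := h.decay (i + N)
    rwa [show i + N + 1 = i + 1 + N by omega] at this

theorem IsExtremal.exists_isMinimalSeq {ξ : ℝ} (hξ : IsExtremal ξ) :
    ∃ x c, IsMinimalSeq ξ x c := by
  obtain ⟨hirr, -, c, hc, H⟩ := hξ
  have Hd : ∀ X : ℝ, 1 ≤ X → ∃ n : ℕ, 0 < n ∧ (n : ℝ) ≤ X ∧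
      simulDist ξ n ≤ c * X ^ (-1 / φ) := by
    intro X hX
    obtain ⟨x₀, x₁, x₂, h0, hle, h1, h2⟩ := H X hX
    refine ⟨x₀.natAbs, by omega, ?_, ?_⟩
    · rwa [Nat.cast_natAbs, abs_of_pos h0]
    · exact (simulDist_le_lineDist ξ ![x₀, x₁, x₂]).trans (max_le h1 h2)
  have Hsmall : ∀ ε : ℝ, 0 < ε → ∃ n : ℕ, 0 < n ∧ simulDist ξ n < ε := by
    intro ε hε
    have ht : Filter.Tendsto (fun X : ℝ => c * X ^ (-1 / φ)) Filter.atTop (nhds (c * 0)) := by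
      have := tendsto_rpow_neg_atTop (inv_pos.2 goldenRatio_pos)
      simp only [neg_div, one_div]
      exact this.const_mul c
    rw [mul_zero] at ht
    obtain ⟨X, hX, hX1⟩ := ((ht.eventually (gt_mem_nhds hε)).and
      (Filter.eventually_ge_atTop 1)).exists
    obtain ⟨n, hn, -, h⟩ := Hd X hX1
    exact ⟨n, hn, h.trans_lt hX⟩
  -- the records of `simulDist`
  let p : ℕ → Prop := fun n => 0 < n ∧ ∀ m, 0 < m → m < n → simulDist ξ n < simulDist ξ m
  have hrec : ∀ ε : ℝ, 0 < ε → ∃ n, p n ∧ simulDist ξ n < ε ∧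
      ∀ m, 0 < m → simulDist ξ m < ε → n ≤ m := by
    intro ε hε
    classical
    have hex := Hsmall ε hε
    refine ⟨Nat.find hex, ⟨(Nat.find_spec hex).1, fun m hm hlt => ?_⟩, (Nat.find_spec hex).2,
      fun m hm hlt => Nat.find_min' hex ⟨hm, hlt⟩⟩
    have := Nat.find_min hex hlt
    push Not at this
    exact (Nat.find_spec hex).2.trans_le (this hm)
  have hinf : {n | p n}.Infinite := by
    apply Set.infinite_of_forall_exists_gt
    intro N
    have hmin : ∃ ε : ℝ, 0 < ε ∧ ∀ m, 0 < m → m ≤ N → ε ≤ simulDist ξ m := by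
      induction N with
      | zero => exact ⟨1, one_pos, fun m h1 h2 => by omega⟩
      | succ N ih =>
        obtain ⟨ε, hε, h⟩ := ih
        refine ⟨min ε (simulDist ξ (N + 1)), lt_min hε (simulDist_pos hirr N.succ_pos), ?_⟩
        intro m hm hmN
        rcases Nat.lt_or_ge N m with h' | h'
        · rw [show m = N + 1 by omega]; exact min_le_right _ _
        · exact (min_le_left _ _).trans (h m hm h')
    obtain ⟨ε, hε, h⟩ := hmin
    obtain ⟨n, hn, hlt, -⟩ := hrec ε hε
    refine ⟨n, hn, ?_⟩
    by_contra hle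
    exact absurd hlt (not_lt.2 (h n hn.1 (not_lt.1 hle)))
  let q : ℕ → ℕ := Nat.nth p
  have hq : ∀ i, p (q i) := Nat.nth_mem_of_infinite hinf
  have hqm : StrictMono q := Nat.nth_strictMono hinf
  have hmin : ∀ i m, 0 < m → m < q (i + 1) → simulDist ξ (q i) ≤ simulDist ξ m := by
    intro i m hm hlt
    by_contra hcon
    push Not at hcon
    obtain ⟨n, hn, h1, h2⟩ := hrec _ (simulDist_pos hirr (hq i).1)
    have h3 : n ≤ q i := Nat.le_nth_of_lt_nth_succ ((h2 m hm hcon).trans_lt hlt) hn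
    rcases h3.lt_or_eq with h4 | h4
    · exact absurd ((hq i).2 n hn.1 h4) (not_lt.2 h1.le)
    · rw [h4] at h1; exact lt_irrefl _ h1
  refine ⟨fun i => ![(q i : ℤ), round ((q i : ℝ) * ξ), round ((q i : ℝ) * ξ ^ 2)], 2 * c,
    ⟨fun i => ?_, fun i j hij => ?_, fun i j hij => ?_, fun i => simulDist_le_one ξ _,
    fun i z hz hz' => ?_, by positivity, fun i => ?_⟩⟩
  · have := (hq i).1
    simp only [cons_val_zero]
    omega
  · simpa using hqm hij
  · exact (hq j).2 _ (hq i).1 (hqm hij)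
  · refine (hmin i (z 0).natAbs (by omega) ?_).trans (simulDist_le_lineDist ξ z)
    simp only [cons_val_zero, Int.abs_eq_natAbs] at hz'
    exact_mod_cast hz'
  · change simulDist ξ (q i) * goldenRoot ((q (i + 1) : ℤ) : ℝ) ≤ 2 * c
    -- apply the hypothesis with `X` one less than the next first coordinate
    have h2 : 2 ≤ q (i + 1) := by
      have := (hq i).1
      have := hqm (lt_add_one i)
      omega
    have h2' : (2 : ℝ) ≤ q (i + 1) := by exact_mod_cast h2
    obtain ⟨n, hn, hle, hd⟩ := Hd ((q (i + 1) : ℝ) - 1) (by linarith)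
    have hn' : n < q (i + 1) := by
      have : (n : ℝ) < q (i + 1) := by linarith
      exact_mod_cast this
    have h3 := (hmin i n hn hn').trans hd
    set X : ℝ := (q (i + 1) : ℝ) - 1 with hX
    have hX0 : 0 < X := by linarith
    have h4 : goldenRoot ((q (i + 1) : ℤ) : ℝ) ≤ 2 * goldenRoot X := by
      have e : (((q (i + 1) : ℤ)) : ℝ) ≤ 2 * X := by rw [Int.cast_natCast]; linarith
      refine (goldenRoot_le_of_le (by positivity) hX0.le zero_le_two e).trans ?_
      have := goldenRoot_pos hX0
      gcongr
      exact goldenRoot_le_self one_le_two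
    have h5 : X ^ (-1 / φ) * goldenRoot X = 1 := by
      unfold goldenRoot
      rw [← rpow_add hX0, neg_div, one_div, neg_add_cancel, rpow_zero]
    calc simulDist ξ (q i) * goldenRoot ((q (i + 1) : ℤ) : ℝ)
        ≤ (c * X ^ (-1 / φ)) * (2 * goldenRoot X) :=
          mul_le_mul h3 h4 (goldenRoot_pos (by rw [Int.cast_natCast]; linarith)).le (by positivity)
      _ = 2 * c := by linear_combination 2 * c * h5

namespace IsMinimalSeq

variable {ξ c : ℝ} {x : ℕ → Fin 3 → ℤ}

theorem one_le (h : IsMinimalSeq ξ x c) (i : ℕ) : (1 : ℝ) ≤ x i 0 := by exact_mod_cast h.one_le_zero i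

theorem lt_of_lt (h : IsMinimalSeq ξ x c) {i j : ℕ} (hij : i < j) : (x i 0 : ℝ) < x j 0 := by
  exact_mod_cast h.strictMono hij

end IsMinimalSeq

theorem abs_symmDet_le {ξ : ℝ} {x : Fin 3 → ℤ} (hx : 1 ≤ x 0) (hL : lineDist ξ x ≤ 1) :
    |(symmDet x : ℝ)| ≤ (2 + 2 * |ξ|) * (x 0 * lineDist ξ x) := by
  have hx' : (1 : ℝ) ≤ x 0 := by exact_mod_cast hx
  have e : (symmDet x : ℝ) = -(x 0 * (x 0 * ξ ^ 2 - x 2)) + (2 * ξ) * (x 0 * (x 0 * ξ - x 1))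
      - (x 0 * ξ - x 1) * (x 0 * ξ - x 1) := by
    rw [symmDet]; push_cast; ring
  have h1 := abs_one_le_lineDist ξ x
  have h2 := abs_two_le_lineDist ξ x
  have h0 := lineDist_nonneg ξ x
  rw [e]
  refine (abs_sub _ _).trans ((add_le_add_left (abs_add_le _ _) _).trans ?_)
  rw [abs_neg, abs_mul, abs_mul (2 * ξ), abs_mul, abs_mul, abs_mul, abs_two,
    abs_of_pos (by linarith : (0 : ℝ) < x 0)]
  have h3 : |(x 0 : ℝ) * ξ - x 1| * |(x 0 : ℝ) * ξ - x 1| ≤ x 0 * lineDist ξ x :=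
    mul_le_mul (h1.trans (hL.trans hx')) h1 (abs_nonneg _) (by linarith)
  have h4 : (x 0 : ℝ) * |(x 0 : ℝ) * ξ ^ 2 - x 2| ≤ x 0 * lineDist ξ x := by gcongr
  have h5 : 2 * |ξ| * ((x 0 : ℝ) * |(x 0 : ℝ) * ξ - x 1|) ≤ 2 * |ξ| * (x 0 * lineDist ξ x) := by
    gcongr
  linarith

theorem abs_cross_two_le {ξ : ℝ} {x y : Fin 3 → ℤ} :
    |(((x ⨯₃ y) 2 : ℤ) : ℝ)| ≤ |(x 0 : ℝ)| * lineDist ξ y + |(y 0 : ℝ)| * lineDist ξ x := by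
  have e : (((x ⨯₃ y) 2 : ℤ) : ℝ) = y 0 * (x 0 * ξ - x 1) - x 0 * (y 0 * ξ - y 1) := by
    rw [cross_two]; push_cast; ring
  rw [e]
  refine (abs_sub _ _).trans ?_
  rw [abs_mul, abs_mul, add_comm]
  gcongr <;> exact abs_one_le_lineDist _ _

theorem abs_cross_one_le {ξ : ℝ} {x y : Fin 3 → ℤ} :
    |(((x ⨯₃ y) 1 : ℤ) : ℝ)| ≤ |(x 0 : ℝ)| * lineDist ξ y + |(y 0 : ℝ)| * lineDist ξ x := by
  have e : (((x ⨯₃ y) 1 : ℤ) : ℝ) = x 0 * (y 0 * ξ ^ 2 - y 2) - y 0 * (x 0 * ξ ^ 2 - x 2) := by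
    rw [cross_one]; push_cast; ring
  rw [e]
  refine (abs_sub _ _).trans ?_
  rw [abs_mul, abs_mul]
  gcongr <;> exact abs_two_le_lineDist _ _

/-- The larger of the last two coordinates of a cross product is at least the difference of the
two terms that bound it from above. -/
theorem exists_le_abs_cross (ξ : ℝ) (x y : Fin 3 → ℤ) : ∃ s : Fin 3, (s = 1 ∨ s = 2) ∧
    |(y 0 : ℝ)| * lineDist ξ x - |(x 0 : ℝ)| * lineDist ξ y ≤ |(((x ⨯₃ y) s : ℤ) : ℝ)| := by
  rcases max_choice |(x 0 : ℝ) * ξ - x 1| |(x 0 : ℝ) * ξ ^ 2 - x 2| with h | h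
  · refine ⟨2, Or.inr rfl, ?_⟩
    have e : (((x ⨯₃ y) 2 : ℤ) : ℝ) = y 0 * (x 0 * ξ - x 1) - x 0 * (y 0 * ξ - y 1) := by
      rw [cross_two]; push_cast; ring
    rw [e]
    refine le_trans ?_ (abs_sub_abs_le_abs_sub _ _)
    rw [abs_mul, abs_mul, lineDist, h]
    gcongr
    exact abs_one_le_lineDist _ _
  · refine ⟨1, Or.inl rfl, ?_⟩
    have e : (((x ⨯₃ y) 1 : ℤ) : ℝ) = -(y 0 * (x 0 * ξ ^ 2 - x 2) - x 0 * (y 0 * ξ ^ 2 - y 2)) := by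
      rw [cross_one]; push_cast; ring
    rw [e, abs_neg]
    refine le_trans ?_ (abs_sub_abs_le_abs_sub _ _)
    rw [abs_mul, abs_mul, lineDist, h]
    gcongr
    exact abs_two_le_lineDist _ _

/-- Of two integer points on a line through the origin, the one with the larger first coordinate
is further away from the line spanned by `(1, ξ, ξ²)`. -/
theorem lineDist_le_of_parallel {ξ : ℝ} {x y : Fin 3 → ℤ} (hx : 0 < x 0) (hxy : x 0 ≤ y 0)
    (h1 : x 0 * y 1 = x 1 * y 0) (h2 : x 0 * y 2 = x 2 * y 0) : lineDist ξ x ≤ lineDist ξ y := by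
  have hx' : (0 : ℝ) < x 0 := by exact_mod_cast hx
  have hxy' : (x 0 : ℝ) ≤ y 0 := by exact_mod_cast hxy
  have h1' : (x 0 : ℝ) * y 1 = x 1 * y 0 := by exact_mod_cast h1
  have h2' : (x 0 : ℝ) * y 2 = x 2 * y 0 := by exact_mod_cast h2
  have key : ∀ a b : ℝ, (x 0 : ℝ) * b = y 0 * a → |a| ≤ |b| := by
    intro a b hab
    have := congrArg abs hab
    rw [abs_mul, abs_mul, abs_of_pos hx', abs_of_pos (hx'.trans_le hxy')] at this
    refine le_of_mul_le_mul_left ?_ hx'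
    rw [this]
    gcongr
  exact max_le_max (key _ _ (by linear_combination -h1')) (key _ _ (by linear_combination -h2'))

namespace IsMinimalSeq

variable {ξ c : ℝ} {x : ℕ → Fin 3 → ℤ}

theorem cross_ne_zero (h : IsMinimalSeq ξ x c) {i j : ℕ} (hij : i < j) : x i ⨯₃ x j ≠ 0 := by
  intro h0
  have h1 := congrFun h0 1
  have h2 := congrFun h0 2
  rw [cross_one, Pi.zero_apply] at h1
  rw [cross_two, Pi.zero_apply] at h2
  refine absurd (h.strictAnti hij) (not_lt.2 (lineDist_le_of_parallel ?_ (h.strictMono hij).le ?_ ?_))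
  · have := h.one_le_zero i; omega
  · linarith
  · linarith

theorem abs_zero (h : IsMinimalSeq ξ x c) (i : ℕ) : |(x i 0 : ℝ)| = x i 0 :=
  abs_of_nonneg (zero_le_one.trans (h.one_le i))

theorem tendsto (h : IsMinimalSeq ξ x c) (B : ℝ) : ∃ N, ∀ i, N ≤ i → B ≤ x i 0 := by
  have h1 : ∀ i : ℕ, (i : ℤ) ≤ x i 0 := by
    intro i
    induction i with
    | zero => exact le_trans (by simp) (h.one_le_zero 0)
    | succ i ih =>
      have := h.strictMono (lt_add_one i)
      simp only at this
      push_cast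
      omega
  refine ⟨⌈B⌉₊, fun i hi => (Nat.le_ceil B).trans ?_⟩
  have h2 : (i : ℝ) ≤ x i 0 := by exact_mod_cast h1 i
  exact le_trans (by exact_mod_cast hi) h2

theorem mul_lineDist_le (h : IsMinimalSeq ξ x c) (i : ℕ) :
    (x (i + 1) 0 : ℝ) * lineDist ξ (x i) ≤ c * goldenRoot (goldenRoot (x (i + 1) 0)) := by
  have hp : (0 : ℝ) < x (i + 1) 0 := zero_lt_one.trans_le (h.one_le _)
  nth_rewrite 1 [← goldenRoot_mul_goldenRoot_goldenRoot hp]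
  have := mul_le_mul_of_nonneg_right (h.decay i) (goldenRoot_pos (goldenRoot_pos hp)).le
  linarith

/-- A minimal point `x` with large first coordinate has `symmDet x ≠ 0`. Otherwise its matrix is
a multiple of `v vᵀ` for an integer vector `v` of size about `√x₀`; the preceding point maps
the vector orthogonal to `v` to an integer vector that is too short to be nonzero, so that this
point would be proportional to `x`. -/
theorem symmDet_ne_zero (h : IsMinimalSeq ξ x c) :
    ∃ B : ℝ, ∀ i, B < x (i + 1) 0 → symmDet (x (i + 1)) ≠ 0 := by
  refine ⟨(((((2 + 2 * |ξ|) * c) ^ 2) ^ φ) ^ φ) ^ φ, fun i hi h0 => not_le.2 hi ?_⟩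
  clear hi
  have hp : (0 : ℝ) < x (i + 1) 0 := zero_lt_one.trans_le (h.one_le _)
  refine le_of_le_mul_goldenRoot_sq hp (by positivity) ?_
  have hX1 := h.one_le_zero (i + 1)
  have hY1 := h.one_le_zero i
  have hlt := h.strictMono (lt_add_one i)
  have hltL := h.strictAnti (lt_add_one i)
  have hLy := h.le_one i
  have hm := h.mul_lineDist_le i
  simp only at hlt hltL
  generalize x i = y at *
  generalize x (i + 1) = x at *
  rw [symmDet, sub_eq_zero] at h0
  set g : ℤ := (((x 0).gcd (x 1) : ℕ) : ℤ) with hg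
  have hgX : x 0 ∣ g ^ 2 := by
    rw [hg, ← Nat.cast_pow, ← Int.pow_gcd_pow]
    exact Int.dvd_coe_gcd (Dvd.intro_left _ (sq _).symm) (h0 ▸ Dvd.intro _ rfl)
  have hg0 : 0 ≤ g := by rw [hg]; positivity
  have hgx : g ∣ x 0 := Int.gcd_dvd_left _ _
  have hgr : g ∣ x 1 := Int.gcd_dvd_right _ _
  have hgX' : x 0 ≤ g ^ 2 := by
    refine Int.le_of_dvd (pow_pos (lt_of_le_of_ne hg0 ?_) 2) hgX
    intro h'
    rw [← h'] at hgx
    have := zero_dvd_iff.1 hgx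
    omega
  have hYX : (y 0 : ℝ) ≤ x 0 := by exact_mod_cast hlt.le
  have hY0 : (0 : ℝ) ≤ y 0 := by exact_mod_cast (by omega : (0 : ℤ) ≤ y 0)
  have a1 := abs_one_le_lineDist ξ x
  have b1 := abs_one_le_lineDist ξ y
  have b2 := abs_two_le_lineDist ξ y
  have hL0 := lineDist_nonneg ξ y
  -- any nonzero multiple of `g` that is at most a constant times `x₀ * lineDist ξ y` will do
  have key : ∀ z : ℤ, g ∣ z → z ≠ 0 → |(z : ℝ)| ≤ (2 + 2 * |ξ|) * (x 0 * lineDist ξ y) →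
      (x 0 : ℝ) ≤ ((2 + 2 * |ξ|) * c) ^ 2 * goldenRoot (goldenRoot (x 0)) ^ 2 := by
    intro z hz hz0 hb
    have h1 : g ≤ |z| := Int.le_of_dvd (abs_pos.2 hz0) ((dvd_abs _ _).2 hz)
    have h2 : (g : ℝ) ≤ |(z : ℝ)| := by exact_mod_cast h1
    have h3 : (g : ℝ) ≤ (2 + 2 * |ξ|) * (c * goldenRoot (goldenRoot (x 0))) :=
      h2.trans (hb.trans (by gcongr))
    have h4 : (x 0 : ℝ) ≤ (g : ℝ) ^ 2 := by exact_mod_cast hgX'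
    have h5 : (0 : ℝ) ≤ g := by exact_mod_cast hg0
    calc (x 0 : ℝ) ≤ (g : ℝ) ^ 2 := h4
      _ ≤ ((2 + 2 * |ξ|) * (c * goldenRoot (goldenRoot (x 0)))) ^ 2 := by gcongr
      _ = _ := by ring
  by_contra hcon
  have hz1 : y 0 * x 1 - y 1 * x 0 = 0 := by
    by_contra hz
    refine hcon (key _ (dvd_sub (Dvd.dvd.mul_left hgr _) (Dvd.dvd.mul_left hgx _)) hz ?_)
    have e : ((y 0 * x 1 - y 1 * x 0 : ℤ) : ℝ) = x 0 * (y 0 * ξ - y 1) - y 0 * (x 0 * ξ - x 1) := by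
      push_cast; ring
    rw [e]
    refine (abs_sub _ _).trans ?_
    rw [abs_mul, abs_mul, abs_of_pos hp, abs_of_nonneg hY0]
    have t1 : (x 0 : ℝ) * |(y 0 : ℝ) * ξ - y 1| ≤ x 0 * lineDist ξ y := by gcongr
    have t2 : (y 0 : ℝ) * |(x 0 : ℝ) * ξ - x 1| ≤ x 0 * lineDist ξ y :=
      mul_le_mul hYX (a1.trans hltL.le) (abs_nonneg _) hp.le
    have t3 : 0 ≤ |ξ| * (x 0 * lineDist ξ y) := by positivity
    linarith
  have hz2 : y 1 * x 1 - y 2 * x 0 = 0 := by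
    by_contra hz
    refine hcon (key _ (dvd_sub (Dvd.dvd.mul_left hgr _) (Dvd.dvd.mul_left hgx _)) hz ?_)
    have e : ((y 1 * x 1 - y 2 * x 0 : ℤ) : ℝ) =
        (-(ξ * (y 0 * (x 0 * ξ - x 1))) - ξ * (x 0 * (y 0 * ξ - y 1)))
        + ((y 0 * ξ - y 1) * (x 0 * ξ - x 1) + x 0 * (y 0 * ξ ^ 2 - y 2)) := by
      push_cast; ring
    rw [e]
    refine (abs_add_le _ _).trans ((add_le_add (abs_sub _ _) (abs_add_le _ _)).trans ?_)
    rw [abs_neg, abs_mul, abs_mul, abs_mul, abs_mul, abs_mul, abs_mul, abs_of_pos hp,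
      abs_of_nonneg hY0]
    have hX1' : (1 : ℝ) ≤ x 0 := by exact_mod_cast hX1
    have t1 : |ξ| * ((x 0 : ℝ) * |(y 0 : ℝ) * ξ - y 1|) ≤ |ξ| * (x 0 * lineDist ξ y) := by gcongr
    have t2 : |ξ| * ((y 0 : ℝ) * |(x 0 : ℝ) * ξ - x 1|) ≤ |ξ| * (x 0 * lineDist ξ y) :=
      mul_le_mul_of_nonneg_left (mul_le_mul hYX (a1.trans hltL.le) (abs_nonneg _) hp.le)
        (abs_nonneg _)
    have t3 : (x 0 : ℝ) * |(y 0 : ℝ) * ξ ^ 2 - y 2| ≤ x 0 * lineDist ξ y := by gcongr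
    have t4 : |(y 0 : ℝ) * ξ - y 1| * |(x 0 : ℝ) * ξ - x 1| ≤ x 0 * lineDist ξ y :=
      mul_le_mul ((b1.trans hLy).trans hX1') (a1.trans hltL.le) (abs_nonneg _) hp.le
    linarith
  -- now `y` is proportional to `x`
  refine absurd hltL (not_lt.2 (lineDist_le_of_parallel (by omega) hlt.le ?_ ?_))
  · linarith
  · have hx0 : x 0 ≠ 0 := by omega
    apply mul_left_cancel₀ hx0
    linear_combination y 0 * h0 + x 1 * hz1 + x 0 * hz2

end IsMinimalSeq

namespace IsMinimalSeq

variable {ξ c : ℝ} {x : ℕ → Fin 3 → ℤ}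

/-- If three consecutive minimal points are dependent, then the last two generate the lattice of
integer points in their plane, so that the cross product of the first two is an integer multiple
of that of the last two. -/
theorem exists_cross_eq_smul (h : IsMinimalSeq ξ x c) {n : ℕ}
    (hdep : x n ⬝ᵥ (x (n + 1) ⨯₃ x (n + 2)) = 0) :
    ∃ b : ℤ, b ≠ 0 ∧ x n ⨯₃ x (n + 1) = b • (x (n + 1) ⨯₃ x (n + 2)) := by
  have hm := h.cross_ne_zero (by omega : n + 1 < n + 2)
  have hwu := h.cross_ne_zero (by omega : n < n + 1)
  have hmin := h.minimal (n + 1)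
  have hU := h.one_le (n + 1)
  have hUV := h.lt_of_lt (by omega : n + 1 < n + 2)
  have hL := h.strictAnti (by omega : n + 1 < n + 2)
  have hL1 := h.le_one (n + 1)
  simp only [add_assoc, one_add_one_eq_two] at hmin hL
  generalize x n = w at *
  generalize x (n + 1) = u at *
  generalize x (n + 2) = v at *
  have hLv := lineDist_nonneg ξ v
  set m : Fin 3 → ℤ := u ⨯₃ v with hmdef
  have hN : (0 : ℝ) < ((m ⬝ᵥ m : ℤ) : ℝ) := by
    rw [Int.cast_pos, vec3_dotProduct]
    obtain ⟨i, hi⟩ := Function.ne_iff.1 hm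
    have h0 := mul_self_nonneg (m 0)
    have h1 := mul_self_nonneg (m 1)
    have h2 := mul_self_nonneg (m 2)
    have hi' : 0 < m i * m i := mul_self_pos.2 hi
    fin_cases i <;> simp only [Fin.zero_eta, Fin.mk_one, Fin.reduceFinMk] at hi' <;> linarith
  -- the coordinates of `w` with respect to `u` and `v`
  set s : ℝ := (((w ⨯₃ v) ⬝ᵥ m : ℤ) : ℝ) / ((m ⬝ᵥ m : ℤ) : ℝ) with hs
  set t : ℝ := (((u ⨯₃ w) ⬝ᵥ m : ℤ) : ℝ) / ((m ⬝ᵥ m : ℤ) : ℝ) with ht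
  have hw : ∀ i, (w i : ℝ) = s * u i + t * v i := by
    intro i
    have e : (m ⬝ᵥ m) * w i = ((w ⨯₃ v) ⬝ᵥ m) * u i + ((u ⨯₃ w) ⬝ᵥ m) * v i := by
      rw [vec3_dotProduct] at hdep
      simp only [vec3_dotProduct, hmdef, cross_zero, cross_one, cross_two] at hdep ⊢
      fin_cases i <;> simp only [Fin.zero_eta, Fin.mk_one, Fin.reduceFinMk]
      · linear_combination (u 1 * v 2 - u 2 * v 1) * hdep
      · linear_combination (u 2 * v 0 - u 0 * v 2) * hdep
      · linear_combination (u 0 * v 1 - u 1 * v 0) * hdep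
    have e' : ((m ⬝ᵥ m : ℤ) : ℝ) * w i
        = (((w ⨯₃ v) ⬝ᵥ m : ℤ) : ℝ) * u i + (((u ⨯₃ w) ⬝ᵥ m : ℤ) : ℝ) * v i := by
      exact_mod_cast e
    rw [hs, ht]
    field_simp
    linarith
  set a := round s
  set b := round t
  have ha : |s - a| ≤ 1 / 2 := abs_sub_round s
  have hb : |t - b| ≤ 1 / 2 := abs_sub_round t
  set z : Fin 3 → ℤ := fun i => w i - a * u i - b * v i with hz
  have hzr : ∀ i, (z i : ℝ) = (s - a) * u i + (t - b) * v i := by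
    intro i
    simp only [hz]
    push_cast
    rw [hw i]
    ring
  have comb : ∀ p q P Q : ℝ, |p| ≤ P → |q| ≤ Q →
      |(s - a) * p + (t - b) * q| ≤ (P + Q) / 2 := by
    intro p q P Q hp hq
    refine (abs_add_le _ _).trans ?_
    rw [abs_mul, abs_mul]
    have h1 := mul_le_mul ha hp (abs_nonneg _) (by norm_num)
    have h2 := mul_le_mul hb hq (abs_nonneg _) (by norm_num)
    linarith
  have hLz : lineDist ξ z ≤ (lineDist ξ u + lineDist ξ v) / 2 := by
    refine max_le ?_ ?_
    · have e : (z 0 : ℝ) * ξ - z 1 =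
          (s - a) * (u 0 * ξ - u 1) + (t - b) * (v 0 * ξ - v 1) := by
        rw [hzr 0, hzr 1]; ring
      rw [e]
      exact comb _ _ _ _ (abs_one_le_lineDist ξ u) (abs_one_le_lineDist ξ v)
    · have e : (z 0 : ℝ) * ξ ^ 2 - z 2 =
          (s - a) * (u 0 * ξ ^ 2 - u 2) + (t - b) * (v 0 * ξ ^ 2 - v 2) := by
        rw [hzr 0, hzr 2]; ring
      rw [e]
      exact comb _ _ _ _ (abs_two_le_lineDist ξ u) (abs_two_le_lineDist ξ v)
  have hz0 : z 0 = 0 := by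
    by_contra hne
    refine absurd (hmin z hne ?_) (not_le.2 (by linarith))
    have h1 : |(z 0 : ℝ)| ≤ ((u 0 : ℝ) + v 0) / 2 := by
      rw [hzr 0]
      exact comb _ _ _ _ (abs_of_nonneg (by linarith)).le (abs_of_nonneg (by linarith)).le
    have h2 : |(z 0 : ℝ)| < v 0 := by linarith
    exact_mod_cast h2
  have small : ∀ k : ℤ, |(k : ℝ)| ≤ lineDist ξ z → k = 0 := by
    intro k hk
    have : |(k : ℝ)| < 1 := by linarith
    exact Int.abs_lt_one_iff.1 (by exact_mod_cast this)
  have hz1 : z 1 = 0 := small _ (by simpa [hz0] using abs_one_le_lineDist ξ z)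
  have hz2 : z 2 = 0 := small _ (by simpa [hz0] using abs_two_le_lineDist ξ z)
  simp only [hz] at hz0 hz1 hz2
  have hcr : w ⨯₃ u = (-b) • m := by
    ext i
    rw [Pi.smul_apply, smul_eq_mul, hmdef]
    fin_cases i <;> simp only [Fin.zero_eta, Fin.mk_one, Fin.reduceFinMk, cross_zero, cross_one,
      cross_two]
    · linear_combination u 2 * hz1 - u 1 * hz2
    · linear_combination u 0 * hz2 - u 2 * hz0
    · linear_combination u 1 * hz0 - u 0 * hz1
  refine ⟨-b, ?_, hcr⟩
  intro h0
  rw [h0, zero_smul] at hcr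
  exact hwu hcr

/-- As long as consecutive minimal points stay in one plane, the cross products of neighbours
divide that of the first two. -/
theorem exists_cross_eq_smul_of_forall (h : IsMinimalSeq ξ x c) {i j : ℕ} (hij : i ≤ j)
    (hdep : ∀ n, i ≤ n → n < j → x n ⬝ᵥ (x (n + 1) ⨯₃ x (n + 2)) = 0) :
    ∃ b : ℤ, b ≠ 0 ∧ x i ⨯₃ x (i + 1) = b • (x j ⨯₃ x (j + 1)) := by
  induction j, hij using Nat.le_induction with
  | base => exact ⟨1, one_ne_zero, (one_smul _ _).symm⟩
  | succ j hij ih =>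
    obtain ⟨b, hb, e⟩ := ih fun n h1 h2 => hdep n h1 (by omega)
    obtain ⟨b', hb', e'⟩ := h.exists_cross_eq_smul (hdep j hij (by omega))
    exact ⟨b * b', mul_ne_zero hb hb', by rw [e, e', smul_smul]⟩

end IsMinimalSeq

theorem isQuadratic_of_root {α : ℝ} (hirr : Irrational α) {m : Fin 3 → ℤ} (hm : m ≠ 0)
    (h : (m 0 : ℝ) + m 1 * α + m 2 * α ^ 2 = 0) : IsQuadratic α := by
  by_cases h2 : m 2 = 0
  · have h1 : m 1 = 0 := by
      by_contra h1
      apply hirr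
      refine ⟨-(m 0 : ℚ) / m 1, ?_⟩
      have : (m 1 : ℝ) ≠ 0 := by exact_mod_cast h1
      rw [h2] at h
      push_cast
      field_simp
      push_cast at h
      linarith
    have h0 : m 0 = 0 := by
      rw [h1, h2] at h
      simpa using h
    exact absurd (by ext i; fin_cases i <;> assumption) hm
  · open Polynomial in
    let p : ℚ[X] := C (m 2 : ℚ) * X ^ 2 + C (m 1 : ℚ) * X + C (m 0 : ℚ)
    have hdeg : p.natDegree = 2 := Polynomial.natDegree_quadratic (by exact_mod_cast h2)
    have hp0 : p ≠ 0 := by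
      intro h0
      rw [h0] at hdeg
      simp at hdeg
    have hroot : Polynomial.aeval α p = 0 := by
      simp only [p, map_add, map_mul, map_pow, Polynomial.aeval_X, map_intCast]
      linarith
    have hint : IsIntegral ℚ α := IsAlgebraic.isIntegral ⟨p, hp0, hroot⟩
    have hle : (minpoly ℚ α).natDegree ≤ 2 :=
      hdeg ▸ Polynomial.natDegree_le_of_dvd (minpoly.dvd ℚ α hroot) hp0
    have hpos := minpoly.natDegree_pos hint
    have hne1 : (minpoly ℚ α).natDegree ≠ 1 := by
      intro h1
      rw [minpoly.natDegree_eq_one_iff] at h1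
      obtain ⟨r, hr⟩ := h1
      exact hirr ⟨r, by simpa using hr⟩
    exact show (minpoly ℚ α).natDegree = 2 by omega

/-- An extremal number is not a root of a nonzero integer polynomial of degree at most two. -/
theorem IsExtremal.eq_zero_of_root {ξ : ℝ} (hξ : IsExtremal ξ) {m : Fin 3 → ℤ}
    (h : (m 0 : ℝ) + m 1 * ξ + m 2 * ξ ^ 2 = 0) : m = 0 := by
  by_contra hm
  exact hξ.2.1 (isQuadratic_of_root hξ.1 hm h)

/-- Three consecutive minimal points are infinitely often independent, as `1, ξ, ξ²` are linearly
independent over `ℚ`. -/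
theorem IsMinimalSeq.infinite_triple_ne_zero {ξ c : ℝ} {x : ℕ → Fin 3 → ℤ} (hξ : IsExtremal ξ)
    (h : IsMinimalSeq ξ x c) : {n | x n ⬝ᵥ (x (n + 1) ⨯₃ x (n + 2)) ≠ 0}.Infinite := by
  apply Set.infinite_of_forall_exists_gt
  intro N
  by_contra hcon
  simp only [Set.mem_ofPred_eq, not_exists, not_and, not_lt] at hcon
  set m := x (N + 1) ⨯₃ x (N + 2) with hm
  have hdep : ∀ n, N + 1 ≤ n → x n ⬝ᵥ (x (n + 1) ⨯₃ x (n + 2)) = 0 := by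
    intro n hn
    by_contra hne
    have := hcon n hne
    omega
  have horth : ∀ n, N + 1 ≤ n → m ⬝ᵥ x n = 0 := by
    intro n hn
    obtain ⟨b, -, e⟩ := h.exists_cross_eq_smul_of_forall hn fun k hk _ => hdep k hk
    rw [hm, e, smul_dotProduct, dotProduct_comm, dot_self_cross, smul_zero]
  refine h.cross_ne_zero (by omega : N + 1 < N + 2) (hξ.eq_zero_of_root ?_)
  rw [← hm, ← abs_eq_zero]
  apply le_antisymm _ (abs_nonneg _)
  apply le_of_forall_pos_le_add
  intro ε hε
  set K : ℝ := |(m 1 : ℝ)| + |(m 2 : ℝ)| with hK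
  have hK0 : 0 ≤ K := by positivity
  obtain ⟨M, hM⟩ := h.tendsto (K / ε)
  set n := max M (N + 1)
  have h1 := abs_dotProduct_sub_le ξ m (x n)
  have h2 := hM n (le_max_left _ _)
  rw [horth n (le_max_right _ _), Int.cast_zero, zero_sub, abs_neg, abs_mul, h.abs_zero] at h1
  have h3 : (x n 0 : ℝ) * |(m 0 : ℝ) + m 1 * ξ + m 2 * ξ ^ 2| ≤ K :=
    h1.trans (mul_le_of_le_one_right hK0 (h.le_one n))
  have h4 : K ≤ x n 0 * ε := (div_le_iff₀ hε).1 h2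
  rw [zero_add]
  exact le_of_mul_le_mul_left (h3.trans h4) (zero_lt_one.trans_le (h.one_le n))

/-! ### Extremal sequences -/

/-- A sequence of integer points close to the line spanned by `(1, ξ, ξ²)`, in which the first
coordinate `Y` is comparable with the power `1 / γ` of the next one, the distance to the line is
of order `1 / Y`, and no point, viewed as a symmetric matrix, and no three consecutive points are
degenerate. -/
structure IsExtremalSeq (ξ : ℝ) (y : ℕ → Fin 3 → ℤ) (A : ℝ) : Prop where
  one_le_const : 1 ≤ A
  one_le_zero : ∀ k, 1 ≤ y k 0
  strictMono : StrictMono fun k => y k 0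
  le_goldenRoot : ∀ k, (y k 0 : ℝ) ≤ A * goldenRoot (y (k + 1) 0)
  goldenRoot_le : ∀ k, goldenRoot (y (k + 1) 0) ≤ A * y k 0
  mul_lineDist_le : ∀ k, (y k 0 : ℝ) * lineDist ξ (y k) ≤ A
  symmDet_ne_zero : ∀ k, symmDet (y k) ≠ 0
  triple_ne_zero : ∀ k, y k ⬝ᵥ (y (k + 1) ⨯₃ y (k + 2)) ≠ 0

namespace IsMinimalSeq

variable {ξ c : ℝ} {x : ℕ → Fin 3 → ℤ}

theorem one_le_mul_lineDist (h : IsMinimalSeq ξ x c) {n : ℕ} (hd : symmDet (x n) ≠ 0) :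
    1 ≤ (2 + 2 * |ξ|) * (x n 0 * lineDist ξ (x n)) := by
  refine le_trans ?_ (abs_symmDet_le (h.one_le_zero n) (h.le_one n))
  have : 1 ≤ |symmDet (x n)| := Int.one_le_abs hd
  exact_mod_cast this

theorem goldenRoot_le (h : IsMinimalSeq ξ x c) {n : ℕ} (hd : symmDet (x n) ≠ 0) :
    goldenRoot (x (n + 1) 0) ≤ (2 + 2 * |ξ|) * c * x n 0 := by
  have h1 := h.one_le_mul_lineDist hd
  have h2 := h.decay n
  have h3 := goldenRoot_pos (zero_lt_one.trans_le (h.one_le (n + 1)))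
  have h4 := h.one_le n
  calc goldenRoot (x (n + 1) 0) ≤
        goldenRoot (x (n + 1) 0) * ((2 + 2 * |ξ|) * (x n 0 * lineDist ξ (x n))) :=
        le_mul_of_one_le_right h3.le h1
    _ = (2 + 2 * |ξ|) * (lineDist ξ (x n) * goldenRoot (x (n + 1) 0)) * x n 0 := by ring
    _ ≤ _ := by gcongr

theorem one_le_triple (h : IsMinimalSeq ξ x c) {n : ℕ}
    (hn : x n ⬝ᵥ (x (n + 1) ⨯₃ x (n + 2)) ≠ 0) :
    1 ≤ 6 * (x (n + 2) 0 * (lineDist ξ (x n) * lineDist ξ (x (n + 1)))) := by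
  have h0 : 1 ≤ |x n ⬝ᵥ (x (n + 1) ⨯₃ x (n + 2))| := Int.one_le_abs hn
  have h1 := abs_triple_le ξ (x n) (x (n + 1)) (x (n + 2))
  have h2 : (1 : ℝ) ≤ |((x n ⬝ᵥ (x (n + 1) ⨯₃ x (n + 2)) : ℤ) : ℝ)| := by exact_mod_cast h0
  rw [h.abs_zero, h.abs_zero, h.abs_zero] at h1
  have a1 := (h.lt_of_lt (by omega : n < n + 2)).le
  have a2 := (h.lt_of_lt (by omega : n + 1 < n + 2)).le
  have b1 : lineDist ξ (x (n + 1)) ≤ lineDist ξ (x n) := (h.strictAnti (by omega : n < n + 1)).le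
  have b2 : lineDist ξ (x (n + 2)) ≤ lineDist ξ (x (n + 1)) :=
    (h.strictAnti (by omega : n + 1 < n + 2)).le
  have p0 := lineDist_nonneg ξ (x n)
  have p1 := lineDist_nonneg ξ (x (n + 1))
  have p2 := lineDist_nonneg ξ (x (n + 2))
  have q2 := zero_le_one.trans (h.one_le (n + 2))
  have t1 : (x n 0 : ℝ) * (lineDist ξ (x (n + 1)) * lineDist ξ (x (n + 2))) ≤
      x (n + 2) 0 * (lineDist ξ (x n) * lineDist ξ (x (n + 1))) :=
    mul_le_mul a1 (mul_le_mul b1 b2 p2 p0) (by positivity) q2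
  have t2 : (x (n + 1) 0 : ℝ) * (lineDist ξ (x n) * lineDist ξ (x (n + 2))) ≤
      x (n + 2) 0 * (lineDist ξ (x n) * lineDist ξ (x (n + 1))) :=
    mul_le_mul a2 (mul_le_mul le_rfl b2 p2 p0) (by positivity) q2
  linarith

theorem le_goldenRoot (h : IsMinimalSeq ξ x c) {n : ℕ}
    (hn : x n ⬝ᵥ (x (n + 1) ⨯₃ x (n + 2)) ≠ 0) :
    (x (n + 1) 0 : ℝ) ≤ (6 * c ^ 2) ^ φ * goldenRoot (x (n + 2) 0) := by
  have hc := h.pos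
  have p1 := zero_lt_one.trans_le (h.one_le (n + 1))
  have p2 := zero_lt_one.trans_le (h.one_le (n + 2))
  have g1 := goldenRoot_pos p1
  have g2 := goldenRoot_pos p2
  refine le_of_goldenRoot_le p1.le g2.le (by positivity) ?_
  refine le_of_mul_le_mul_right ?_ g2
  have d1 := h.decay n
  have d2 := h.decay (n + 1)
  have hg := goldenRoot_mul_goldenRoot_goldenRoot p2
  have h0 := lineDist_nonneg ξ (x (n + 1))
  calc goldenRoot (x (n + 1) 0) * goldenRoot (x (n + 2) 0)
      ≤ goldenRoot (x (n + 1) 0) * goldenRoot (x (n + 2) 0) *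
        (6 * (x (n + 2) 0 * (lineDist ξ (x n) * lineDist ξ (x (n + 1))))) :=
        le_mul_of_one_le_right (by positivity) (h.one_le_triple hn)
    _ = 6 * x (n + 2) 0 * ((lineDist ξ (x n) * goldenRoot (x (n + 1) 0)) *
        (lineDist ξ (x (n + 1)) * goldenRoot (x (n + 2) 0))) := by ring
    _ ≤ 6 * x (n + 2) 0 * (c * c) := by
        gcongr
    _ = _ := by linear_combination (-6 * c ^ 2) * hg

theorem mul_lineDist_le_of_triple (h : IsMinimalSeq ξ x c) {n : ℕ}
    (hn : x n ⬝ᵥ (x (n + 1) ⨯₃ x (n + 2)) ≠ 0) :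
    (x (n + 1) 0 : ℝ) * lineDist ξ (x (n + 1)) ≤ (6 * c ^ 2) ^ φ * c := by
  have hc := h.pos
  have h0 := lineDist_nonneg ξ (x (n + 1))
  calc (x (n + 1) 0 : ℝ) * lineDist ξ (x (n + 1))
      ≤ (6 * c ^ 2) ^ φ * goldenRoot (x (n + 2) 0) * lineDist ξ (x (n + 1)) := by
        gcongr; exact h.le_goldenRoot hn
    _ = (6 * c ^ 2) ^ φ * (lineDist ξ (x (n + 1)) * goldenRoot (x (n + 2) 0)) := by ring
    _ ≤ _ := by gcongr; exact h.decay (n + 1)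

theorem one_le_goldenRoot_mul_lineDist (h : IsMinimalSeq ξ x c) {n : ℕ}
    (hn : x n ⬝ᵥ (x (n + 1) ⨯₃ x (n + 2)) ≠ 0) (hd : symmDet (x (n + 1)) ≠ 0) :
    1 ≤ 6 * c * goldenRoot ((2 + 2 * |ξ|) * c) * (goldenRoot (x (n + 1) 0) * lineDist ξ (x n)) := by
  have hc := h.pos
  have p1 := zero_lt_one.trans_le (h.one_le (n + 1))
  have p2 := zero_lt_one.trans_le (h.one_le (n + 2))
  have g2 := goldenRoot_pos p2
  have h0 := lineDist_nonneg ξ (x n)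
  have hg := goldenRoot_le_of_le g2.le p1.le (by positivity) (h.goldenRoot_le hd)
  calc 1 ≤ 6 * (x (n + 2) 0 * (lineDist ξ (x n) * lineDist ξ (x (n + 1)))) := h.one_le_triple hn
    _ = 6 * (lineDist ξ (x (n + 1)) * goldenRoot (x (n + 2) 0)) *
        (goldenRoot (goldenRoot (x (n + 2) 0)) * lineDist ξ (x n)) := by
        nth_rewrite 1 [← goldenRoot_mul_goldenRoot_goldenRoot p2]; ring
    _ ≤ 6 * c * ((goldenRoot ((2 + 2 * |ξ|) * c) * goldenRoot (x (n + 1) 0)) * lineDist ξ (x n)) := by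
        have := goldenRoot_pos g2
        gcongr
        exact h.decay (n + 1)
    _ = _ := by ring

/-- Between two consecutive independent triples the minimal points span one plane. The
covolume of its integer points, computed from both ends, bounds the growth. -/
theorem goldenRoot_le_of_forall (h : IsMinimalSeq ξ x c) {i j : ℕ} (hij : i < j)
    (hj : x j ⬝ᵥ (x (j + 1) ⨯₃ x (j + 2)) ≠ 0)
    (hdep : ∀ n, i + 1 ≤ n → n < j → x n ⬝ᵥ (x (n + 1) ⨯₃ x (n + 2)) = 0)
    (hd : ∀ n, symmDet (x n) ≠ 0) :
    goldenRoot (x (j + 1) 0) ≤ (6 * c * goldenRoot ((2 + 2 * |ξ|) * c) *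
      (2 * c + (6 * c ^ 2) ^ φ * c)) ^ φ * ((2 + 2 * |ξ|) * c) * x (i + 1) 0 := by
  have hc := h.pos
  set K₁ := (6 * c ^ 2) ^ φ
  set K₄ := 6 * c * goldenRoot ((2 + 2 * |ξ|) * c) with hK₄
  have hK₁ : 0 ≤ K₁ := by positivity
  have hK₄0 : 0 ≤ K₄ := mul_nonneg (by positivity) (goldenRoot_pos (by positivity)).le
  have pj := zero_lt_one.trans_le (h.one_le (j + 1))
  have pi := zero_lt_one.trans_le (h.one_le (i + 2))
  have gj := goldenRoot_pos pj
  have gi := goldenRoot_pos pi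
  have ggj := goldenRoot_pos gj
  have ggi := one_le_goldenRoot (one_le_goldenRoot (h.one_le (i + 2)))
  obtain ⟨b, hb, e⟩ := h.exists_cross_eq_smul_of_forall (by omega : i + 1 ≤ j) hdep
  obtain ⟨s, hs, hlow⟩ := exists_le_abs_cross ξ (x j) (x (j + 1))
  have hmono : |(((x j ⨯₃ x (j + 1)) s : ℤ) : ℝ)| ≤
      |(((x (i + 1) ⨯₃ x (i + 2)) s : ℤ) : ℝ)| := by
    have e' : (x (i + 1) ⨯₃ x (i + 2)) s = b * (x j ⨯₃ x (j + 1)) s := congrFun e s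
    have hb1 : (1 : ℝ) ≤ |(b : ℝ)| := by exact_mod_cast Int.one_le_abs hb
    rw [e', Int.cast_mul, abs_mul]
    exact le_mul_of_one_le_left (abs_nonneg _) hb1
  have hup : |(((x (i + 1) ⨯₃ x (i + 2)) s : ℤ) : ℝ)| ≤
      x (i + 1) 0 * lineDist ξ (x (i + 2)) + x (i + 2) 0 * lineDist ξ (x (i + 1)) := by
    have h1 := abs_cross_one_le (ξ := ξ) (x := x (i + 1)) (y := x (i + 2))
    have h2 := abs_cross_two_le (ξ := ξ) (x := x (i + 1)) (y := x (i + 2))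
    rw [h.abs_zero, h.abs_zero] at h1 h2
    rcases hs with rfl | rfl <;> assumption
  rw [h.abs_zero, h.abs_zero] at hlow
  have hup2 : (x (i + 1) 0 : ℝ) * lineDist ξ (x (i + 2)) ≤ x (i + 2) 0 * lineDist ξ (x (i + 1)) :=
    mul_le_mul (h.lt_of_lt (by omega)).le (h.strictAnti (by omega : i + 1 < i + 2)).le
      (lineDist_nonneg _ _) pi.le
  have hup3 := h.mul_lineDist_le (i + 1)
  have hj1 : (x j 0 : ℝ) * lineDist ξ (x (j + 1)) ≤ K₁ * c :=
    (mul_le_mul_of_nonneg_right (h.lt_of_lt (by omega : j < j + 1)).le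
      (lineDist_nonneg _ _)).trans (h.mul_lineDist_le_of_triple hj)
  have hmain : (x (j + 1) 0 : ℝ) * lineDist ξ (x j) ≤
      (2 * c + K₁ * c) * goldenRoot (goldenRoot (x (i + 2) 0)) := by
    have : K₁ * c ≤ K₁ * c * goldenRoot (goldenRoot (x (i + 2) 0)) :=
      le_mul_of_one_le_right (by positivity) ggi
    rw [show i + 1 + 1 = i + 2 from rfl] at hup3
    linarith
  have hgg : goldenRoot (goldenRoot (x (j + 1) 0)) ≤
      (K₄ * (2 * c + K₁ * c)) * goldenRoot (goldenRoot (x (i + 2) 0)) := by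
    calc goldenRoot (goldenRoot (x (j + 1) 0))
        ≤ goldenRoot (goldenRoot (x (j + 1) 0)) *
          (K₄ * (goldenRoot (x (j + 1) 0) * lineDist ξ (x j))) :=
          le_mul_of_one_le_right ggj.le (h.one_le_goldenRoot_mul_lineDist hj (hd _))
      _ = K₄ * (x (j + 1) 0 * lineDist ξ (x j)) := by
          nth_rewrite 3 [← goldenRoot_mul_goldenRoot_goldenRoot pj]; ring
      _ ≤ K₄ * ((2 * c + K₁ * c) * goldenRoot (goldenRoot (x (i + 2) 0))) := by gcongr
      _ = _ := by ring
  have hg := le_of_goldenRoot_le gj.le gi.le (by positivity) hgg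
  exact hg.trans ((mul_le_mul_of_nonneg_left (h.goldenRoot_le (hd (i + 1)))
    (by positivity)).trans_eq (by ring))

end IsMinimalSeq

theorem IsExtremal.exists_isExtremalSeq {ξ : ℝ} (hξ : IsExtremal ξ) :
    ∃ y A, IsExtremalSeq ξ y A := by
  obtain ⟨x', c, h'⟩ := hξ.exists_isMinimalSeq
  -- drop the points with vanishing determinant
  obtain ⟨x, h, hd⟩ : ∃ x, IsMinimalSeq ξ x c ∧ ∀ n, symmDet (x n) ≠ 0 := by
    obtain ⟨B, hB⟩ := h'.symmDet_ne_zero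
    obtain ⟨N, hN⟩ := h'.tendsto (B + 1)
    refine ⟨_, h'.shift (N + 1), fun n => hB (n + N) ?_⟩
    have := hN (n + N + 1) (by omega)
    linarith
  clear h' x'
  have hc := h.pos
  let p : ℕ → Prop := fun n => x n ⬝ᵥ (x (n + 1) ⨯₃ x (n + 2)) ≠ 0
  have hinf : {n | p n}.Infinite := h.infinite_triple_ne_zero hξ
  let q : ℕ → ℕ := Nat.nth p
  have hq : ∀ k, p (q k) := Nat.nth_mem_of_infinite hinf
  have hqm : StrictMono q := Nat.nth_strictMono hinf
  have hbetween : ∀ k n, q k + 1 ≤ n → n < q (k + 1) →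
      x n ⬝ᵥ (x (n + 1) ⨯₃ x (n + 2)) = 0 := by
    intro k n h1 h2
    by_contra hne
    have : n ≤ q k := Nat.le_nth_of_lt_nth_succ h2 hne
    omega
  set K₁ := (6 * c ^ 2) ^ φ
  set K₅ := (6 * c * goldenRoot ((2 + 2 * |ξ|) * c) * (2 * c + K₁ * c)) ^ φ *
    ((2 + 2 * |ξ|) * c) with hK₅
  set A := max 1 (max K₁ (max (K₁ * c) K₅))
  have hA1 : K₁ ≤ A := (le_max_left _ _).trans (le_max_right _ _)
  have hA2 : K₁ * c ≤ A :=
    (le_max_left _ _).trans ((le_max_right _ _).trans (le_max_right _ _))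
  have hA3 : K₅ ≤ A := (le_max_right _ _).trans ((le_max_right _ _).trans (le_max_right _ _))
  have hA0 : 0 ≤ A := zero_le_one.trans (le_max_left _ _)
  have hY0 : ∀ n, (0 : ℝ) ≤ x n 0 := fun n => zero_le_one.trans (h.one_le n)
  refine ⟨fun k => x (q k + 1), A, le_max_left _ _, fun k => h.one_le_zero _, ?_, ?_, ?_, ?_,
    fun k => hd _, ?_⟩
  · intro i j hij
    exact h.strictMono (by have := hqm hij; omega : q i + 1 < q j + 1)
  · intro k
    have hk := hqm (lt_add_one k)
    calc (x (q k + 1) 0 : ℝ) ≤ K₁ * goldenRoot (x (q k + 2) 0) := h.le_goldenRoot (hq k)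
      _ ≤ A * goldenRoot (x (q (k + 1) + 1) 0) := by
        have h1 : (x (q k + 2) 0 : ℝ) ≤ x (q (k + 1) + 1) 0 := by
          exact_mod_cast h.strictMono.monotone (by omega : q k + 2 ≤ q (k + 1) + 1)
        exact mul_le_mul hA1 (goldenRoot_mono (hY0 _) h1)
          (goldenRoot_pos (zero_lt_one.trans_le (h.one_le _))).le hA0
  · intro k
    refine (h.goldenRoot_le_of_forall (hqm (lt_add_one k)) (hq _) (hbetween k) hd).trans ?_
    exact mul_le_mul_of_nonneg_right hA3 (hY0 _)
  · intro k
    exact (h.mul_lineDist_le_of_triple (hq k)).trans hA2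
  · intro k h0
    have h1 := hqm (lt_add_one k)
    have h2 := hqm (lt_add_one (k + 1))
    rw [show k + 1 + 1 = k + 2 from rfl] at h2
    obtain ⟨b, -, e⟩ := h.exists_cross_eq_smul_of_forall (by omega : q k + 1 ≤ q (k + 1))
      (hbetween k)
    obtain ⟨b', -, e'⟩ := h.exists_cross_eq_smul_of_forall (by omega : q (k + 1) + 1 ≤ q (k + 2))
      (hbetween (k + 1))
    -- the normal vectors of the two planes that meet in the line through the middle point
    set m := x (q k + 1) ⨯₃ x (q k + 1 + 1) with hm
    set m' := x (q (k + 1) + 1) ⨯₃ x (q (k + 1) + 1 + 1) with hm'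
    set w := x (q k + 1) ⨯₃ x (q (k + 1) + 1) with hw
    have hw0 : w ≠ 0 := h.cross_ne_zero (by omega)
    have hm0 : m ≠ 0 := h.cross_ne_zero (by omega)
    have m1 : m ⬝ᵥ x (q k + 1) = 0 := by rw [dotProduct_comm, hm, dot_self_cross]
    have m2 : m ⬝ᵥ x (q (k + 1) + 1) = 0 := by
      rw [dotProduct_comm, e, dotProduct_smul, dot_cross_self, smul_zero]
    have m3 : m ⬝ᵥ x (q (k + 1)) = 0 := by
      rw [dotProduct_comm, e, dotProduct_smul, dot_self_cross, smul_zero]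
    have m1' : m' ⬝ᵥ x (q (k + 1) + 1) = 0 := by rw [dotProduct_comm, hm', dot_self_cross]
    have m2' : m' ⬝ᵥ x (q (k + 2) + 1) = 0 := by
      rw [dotProduct_comm, e', dotProduct_smul, dot_cross_self, smul_zero]
    have w1 : w ⬝ᵥ x (q k + 1) = 0 := by rw [dotProduct_comm, hw, dot_self_cross]
    have w2 : w ⬝ᵥ x (q (k + 1) + 1) = 0 := by rw [dotProduct_comm, hw, dot_cross_self]
    have w3 : w ⬝ᵥ x (q (k + 2) + 1) = 0 := by
      rw [dotProduct_comm, hw, ← triple_product_permutation, ← triple_product_permutation]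
      exact h0
    have m4 := dotProduct_eq_zero_of_orthogonal hw0 m1 m2 w1 w2 hw0 w3
    have m3' := dotProduct_eq_zero_of_orthogonal
      (h.cross_ne_zero (by omega : q (k + 1) + 1 < q (k + 2) + 1)) m1' m2' m2 m4 hm0 m3
    refine hq (k + 1) ?_
    rw [dotProduct_comm]
    exact m3'

namespace IsExtremalSeq

variable {ξ A : ℝ} {y : ℕ → Fin 3 → ℤ}

theorem const_pos (h : IsExtremalSeq ξ y A) : 0 < A := zero_lt_one.trans_le h.one_le_const

theorem one_le (h : IsExtremalSeq ξ y A) (k : ℕ) : (1 : ℝ) ≤ y k 0 := by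
  exact_mod_cast h.one_le_zero k

theorem pos (h : IsExtremalSeq ξ y A) (k : ℕ) : (0 : ℝ) < y k 0 :=
  zero_lt_one.trans_le (h.one_le k)

theorem lt_succ (h : IsExtremalSeq ξ y A) (k : ℕ) : (y k 0 : ℝ) < y (k + 1) 0 := by
  exact_mod_cast h.strictMono (lt_add_one k)

theorem abs_zero (h : IsExtremalSeq ξ y A) (k : ℕ) : |(y k 0 : ℝ)| = y k 0 :=
  abs_of_pos (h.pos k)

theorem lineDist_le (h : IsExtremalSeq ξ y A) (k : ℕ) : lineDist ξ (y k) ≤ A / y k 0 := by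
  rw [le_div_iff₀' (h.pos k)]
  exact h.mul_lineDist_le k

theorem lineDist_le_const (h : IsExtremalSeq ξ y A) (k : ℕ) : lineDist ξ (y k) ≤ A :=
  (h.lineDist_le k).trans (div_le_self h.const_pos.le (h.one_le k))

theorem tendsto (h : IsExtremalSeq ξ y A) (B : ℝ) : ∃ N, ∀ i, N ≤ i → B ≤ y i 0 := by
  have h1 : ∀ i : ℕ, (i : ℤ) ≤ y i 0 := by
    intro i
    induction i with
    | zero => exact le_trans (by simp) (h.one_le_zero 0)
    | succ i ih =>
      have := h.strictMono (lt_add_one i)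
      simp only at this
      push_cast
      omega
  refine ⟨⌈B⌉₊, fun i hi => (Nat.le_ceil B).trans ?_⟩
  have h2 : (i : ℝ) ≤ y i 0 := by exact_mod_cast h1 i
  exact le_trans (by exact_mod_cast hi) h2

theorem succ_succ_le (h : IsExtremalSeq ξ y A) (k : ℕ) :
    (y (k + 2) 0 : ℝ) ≤ A ^ 3 * (y (k + 1) 0 * y k 0) := by
  have hA := h.const_pos
  have p0 := h.pos k
  have p1 := h.pos (k + 1)
  have p2 := h.pos (k + 2)
  have g2 := goldenRoot_pos p2
  have h1 : goldenRoot (y (k + 2) 0) ≤ A * y (k + 1) 0 := h.goldenRoot_le (k + 1)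
  have h2 : goldenRoot (goldenRoot (y (k + 2) 0)) ≤ A * (A * y k 0) :=
    (goldenRoot_le_of_le g2.le p1.le hA.le h1).trans (mul_le_mul
      (goldenRoot_le_self h.one_le_const) (h.goldenRoot_le k) (goldenRoot_pos p1).le hA.le)
  calc (y (k + 2) 0 : ℝ) = goldenRoot (y (k + 2) 0) * goldenRoot (goldenRoot (y (k + 2) 0)) :=
        (goldenRoot_mul_goldenRoot_goldenRoot p2).symm
    _ ≤ (A * y (k + 1) 0) * (A * (A * y k 0)) :=
        mul_le_mul h1 h2 (goldenRoot_pos g2).le (by positivity)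
    _ = _ := by ring

theorem mul_le_succ_succ (h : IsExtremalSeq ξ y A) (k : ℕ) :
    (y (k + 1) 0 * y k 0 : ℝ) ≤ A ^ 3 * y (k + 2) 0 := by
  have hA := h.const_pos
  have p0 := h.pos k
  have p1 := h.pos (k + 1)
  have p2 := h.pos (k + 2)
  have g2 := goldenRoot_pos p2
  have gg2 := goldenRoot_pos g2
  have h1 : (y (k + 1) 0 : ℝ) ≤ A * goldenRoot (y (k + 2) 0) := h.le_goldenRoot (k + 1)
  have h2 : (y k 0 : ℝ) ≤ A * (A * goldenRoot (goldenRoot (y (k + 2) 0))) := by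
    refine (h.le_goldenRoot k).trans (mul_le_mul_of_nonneg_left ?_ hA.le)
    exact (goldenRoot_le_of_le p1.le g2.le hA.le h1).trans
      (mul_le_mul_of_nonneg_right (goldenRoot_le_self h.one_le_const) gg2.le)
  calc (y (k + 1) 0 * y k 0 : ℝ) ≤ (A * goldenRoot (y (k + 2) 0)) *
        (A * (A * goldenRoot (goldenRoot (y (k + 2) 0)))) := mul_le_mul h1 h2 p0.le (by positivity)
    _ = _ := by
        nth_rewrite 3 [← goldenRoot_mul_goldenRoot_goldenRoot p2]; ring

theorem succ_le_rpow (h : IsExtremalSeq ξ y A) (k : ℕ) :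
    (y (k + 1) 0 : ℝ) ≤ (A * y k 0) ^ φ := by
  have := le_of_goldenRoot_le (h.pos (k + 1)).le zero_le_one (C := A * y k 0)
    (mul_nonneg h.const_pos.le (h.pos k).le) (by simpa [goldenRoot] using h.goldenRoot_le k)
  simpa using this

/-- For every `Z ≥ 1` there is a term of the sequence that exceeds `Z`, but not by much. -/
theorem exists_ge (h : IsExtremalSeq ξ y A) : ∃ C : ℝ, 1 ≤ C ∧ ∀ Z : ℝ, 1 ≤ Z → ∃ k,
    Z ≤ y k 0 ∧ (y k 0 : ℝ) ≤ C * Z ^ φ ∧ (y (k + 1) 0 : ℝ) ≤ C * Z ^ (φ ^ 2) ∧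
      (y (k + 2) 0 : ℝ) ≤ C * Z ^ (φ ^ 3) := by
  have hA := h.const_pos
  have hA1 := h.one_le_const
  have hφ := goldenRatio_pos
  set C₀ : ℝ := max (y 0 0) (A ^ φ) with hC₀
  have hC₀0 : 0 < C₀ := (h.pos 0).trans_le (le_max_left _ _)
  set C₁ : ℝ := (A * C₀) ^ φ
  set C₂ : ℝ := (A * C₁) ^ φ
  have hC₁0 : 0 < C₁ := by positivity
  have hC₂0 : 0 < C₂ := by positivity
  refine ⟨max C₀ (max C₁ C₂), ?_, fun Z hZ => ?_⟩
  · exact (h.one_le 0).trans ((le_max_left _ _).trans (le_max_left _ _))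
  have hZ0 : 0 < Z := zero_lt_one.trans_le hZ
  have hex : ∃ k, Z ≤ y k 0 := by
    obtain ⟨N, hN⟩ := h.tendsto Z
    exact ⟨N, hN N le_rfl⟩
  have hcov : ∃ k, Z ≤ y k 0 ∧ (y k 0 : ℝ) ≤ C₀ * Z ^ φ := by
    classical
    refine ⟨Nat.find hex, Nat.find_spec hex, ?_⟩
    rcases hk : Nat.find hex with _ | k
    · exact (le_max_left _ _).trans (le_mul_of_one_le_right hC₀0.le (one_le_rpow hZ hφ.le))
    · have hlt : (y k 0 : ℝ) < Z := by
        have := Nat.find_min hex (m := k) (by omega)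
        exact not_le.1 this
      calc (y (k + 1) 0 : ℝ) ≤ (A * y k 0) ^ φ := h.succ_le_rpow k
        _ ≤ (A * Z) ^ φ := rpow_le_rpow (mul_nonneg hA.le (h.pos k).le) (by gcongr) hφ.le
        _ = A ^ φ * Z ^ φ := mul_rpow hA.le hZ0.le
        _ ≤ C₀ * Z ^ φ := by gcongr; exact le_max_right _ _
  obtain ⟨k, hk, h0⟩ := hcov
  have step : ∀ (j : ℕ) (C e : ℝ), 0 < C → (y j 0 : ℝ) ≤ C * Z ^ e →
      (y (j + 1) 0 : ℝ) ≤ (A * C) ^ φ * Z ^ (e * φ) := by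
    intro j C e hC hj
    calc (y (j + 1) 0 : ℝ) ≤ (A * y j 0) ^ φ := h.succ_le_rpow j
      _ ≤ (A * (C * Z ^ e)) ^ φ :=
        rpow_le_rpow (mul_nonneg hA.le (h.pos j).le) (by gcongr) hφ.le
      _ = (A * C) ^ φ * Z ^ (e * φ) := by
        rw [← mul_assoc, mul_rpow (by positivity) (by positivity), ← rpow_mul hZ0.le]
  have h1 := step k _ _ hC₀0 h0
  have h2 := step (k + 1) _ _ hC₁0 h1
  rw [show φ * φ = φ ^ 2 by ring] at h1 h2
  rw [show φ ^ 2 * φ = φ ^ 3 by ring] at h2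
  refine ⟨k, hk, h0.trans ?_, h1.trans ?_, h2.trans ?_⟩
  · gcongr; exact le_max_left _ _
  · gcongr; exact (le_max_left _ _).trans (le_max_right _ _)
  · gcongr; exact (le_max_right _ _).trans (le_max_right _ _)

/-! ### Values at `ξ` of integer polynomials of degree at most two -/

/-- A nonzero integer polynomial of degree at most two does not vanish at all of three consecutive
points of the sequence, which bounds its value at `ξ` from below. -/
theorem exists_le_abs_quadratic (h : IsExtremalSeq ξ y A) : ∃ c : ℝ, 0 < c ∧
    ∀ m : Fin 3 → ℤ, m ≠ 0 → ∀ H : ℝ, 1 ≤ H → (∀ i, |(m i : ℝ)| ≤ H) →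
      c * H ^ (-φ ^ 3) ≤ |(m 0 : ℝ) + m 1 * ξ + m 2 * ξ ^ 2| := by
  obtain ⟨C, hC, hcov⟩ := h.exists_ge
  have hA := h.const_pos
  have hC0 : 0 < C := zero_lt_one.trans_le hC
  refine ⟨(2 * (C * (4 * A) ^ (φ ^ 3)))⁻¹, by positivity, fun m hm H hH hmH => ?_⟩
  have hH0 : 0 < H := zero_lt_one.trans_le hH
  obtain ⟨k, hk, -, -, h2⟩ := hcov (4 * A * H)
    (by nlinarith [h.one_le_const])
  set P : ℝ := (m 0 : ℝ) + m 1 * ξ + m 2 * ξ ^ 2 with hP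
  have hle : ∀ j, k ≤ j → j ≤ k + 2 → m ⬝ᵥ y j ≠ 0 → 1 / 2 ≤ y (k + 2) 0 * |P| := by
    intro j hj hj' hne
    have h1 : (1 : ℝ) ≤ |((m ⬝ᵥ y j : ℤ) : ℝ)| := by exact_mod_cast Int.one_le_abs hne
    have h3 := abs_dotProduct_sub_le ξ m (y j)
    have hkj : (y k 0 : ℝ) ≤ y j 0 := by exact_mod_cast h.strictMono.monotone hj
    have hjk : (y j 0 : ℝ) ≤ y (k + 2) 0 := by exact_mod_cast h.strictMono.monotone hj'
    have h4 : lineDist ξ (y j) ≤ 1 / (4 * H) := by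
      refine (h.lineDist_le j).trans ?_
      rw [div_le_div_iff₀ (h.pos j) (by positivity)]
      linarith
    have h5 : (|(m 1 : ℝ)| + |(m 2 : ℝ)|) * lineDist ξ (y j) ≤ 1 / 2 := by
      calc (|(m 1 : ℝ)| + |(m 2 : ℝ)|) * lineDist ξ (y j) ≤ (H + H) * (1 / (4 * H)) :=
            mul_le_mul (add_le_add (hmH 1) (hmH 2)) h4 (lineDist_nonneg _ _) (by positivity)
        _ = 1 / 2 := by field_simp; norm_num
    rw [← hP] at h3
    have h6 := abs_sub_abs_le_abs_sub ((m ⬝ᵥ y j : ℤ) : ℝ) (y j 0 * P)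
    rw [abs_mul, h.abs_zero] at h6
    have h7 : (y j 0 : ℝ) * |P| ≤ y (k + 2) 0 * |P| := by gcongr
    linarith
  have hmain : 1 / 2 ≤ y (k + 2) 0 * |P| := by
    by_contra hcon
    refine hm (eq_zero_of_dotProduct_eq_zero (h.triple_ne_zero k) ?_ ?_ ?_)
    · by_contra h0; exact hcon (hle k (by omega) (by omega) h0)
    · by_contra h0; exact hcon (hle (k + 1) (by omega) (by omega) h0)
    · by_contra h0; exact hcon (hle (k + 2) (by omega) (by omega) h0)
  rw [mul_rpow (by positivity) hH0.le] at h2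
  have h8 : 1 / 2 ≤ C * ((4 * A) ^ (φ ^ 3) * H ^ (φ ^ 3)) * |P| :=
    hmain.trans (by gcongr)
  have h9 : 0 < H ^ (φ ^ 3) := by positivity
  have h10 : 0 < (4 * A) ^ (φ ^ 3) := by positivity
  rw [rpow_neg hH0.le, ← mul_inv, inv_le_iff_one_le_mul₀ (by positivity)]
  linarith

/-! ### Values at `ξ` of monic integer cubics -/

theorem div_mul_lineDist_le (h : IsExtremalSeq ξ y A) (k : ℕ) :
    (y (k + 1) 0 : ℝ) / y k 0 * lineDist ξ (y (k + 2)) ≤ A ^ 4 / (y k 0 : ℝ) ^ 2 := by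
  have hA := h.const_pos
  have p0 := h.pos k
  have p1 := h.pos (k + 1)
  have p2 := h.pos (k + 2)
  calc (y (k + 1) 0 : ℝ) / y k 0 * lineDist ξ (y (k + 2))
      ≤ (y (k + 1) 0 : ℝ) / y k 0 * (A / y (k + 2) 0) := by gcongr; exact h.lineDist_le _
    _ = A * (y (k + 1) 0 * y k 0) / ((y k 0 : ℝ) ^ 2 * y (k + 2) 0) := by field_simp
    _ ≤ A * (A ^ 3 * y (k + 2) 0) / ((y k 0 : ℝ) ^ 2 * y (k + 2) 0) := by
        exact div_le_div_of_nonneg_right (mul_le_mul_of_nonneg_left (h.mul_le_succ_succ k) hA.le)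
          (by positivity)
    _ = _ := by field_simp

theorem abs_triple_le_const (h : IsExtremalSeq ξ y A) (k : ℕ) :
    |((y k ⬝ᵥ (y (k + 1) ⨯₃ y (k + 2)) : ℤ) : ℝ)| ≤ 6 * A ^ 5 := by
  have hA := h.const_pos
  have hA1 := h.one_le_const
  have p0 := h.pos k
  have p1 := h.pos (k + 1)
  have p2 := h.pos (k + 2)
  have h1 := abs_triple_le ξ (y k) (y (k + 1)) (y (k + 2))
  rw [h.abs_zero, h.abs_zero, h.abs_zero] at h1
  have L0 := lineDist_nonneg ξ (y k)
  have L1 := lineDist_nonneg ξ (y (k + 1))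
  have L2 := lineDist_nonneg ξ (y (k + 2))
  have hA2 : A ^ 2 ≤ A ^ 5 := pow_le_pow_right₀ hA1 (by norm_num)
  have t1 : (y k 0 : ℝ) * (lineDist ξ (y (k + 1)) * lineDist ξ (y (k + 2))) ≤ A ^ 2 := by
    have : (y k 0 : ℝ) * lineDist ξ (y (k + 1)) ≤ A :=
      (mul_le_mul_of_nonneg_right (h.lt_succ k).le L1).trans (h.mul_lineDist_le (k + 1))
    calc _ = ((y k 0 : ℝ) * lineDist ξ (y (k + 1))) * lineDist ξ (y (k + 2)) := by ring
      _ ≤ A * A := mul_le_mul this (h.lineDist_le_const _) L2 hA.le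
      _ = _ := by ring
  have t2 : (y (k + 1) 0 : ℝ) * (lineDist ξ (y k) * lineDist ξ (y (k + 2))) ≤ A ^ 2 := by
    have : (y (k + 1) 0 : ℝ) * lineDist ξ (y (k + 2)) ≤ A :=
      (mul_le_mul_of_nonneg_right (h.lt_succ (k + 1)).le L2).trans (h.mul_lineDist_le (k + 2))
    calc _ = ((y (k + 1) 0 : ℝ) * lineDist ξ (y (k + 2))) * lineDist ξ (y k) := by ring
      _ ≤ A * A := mul_le_mul this (h.lineDist_le_const _) L0 hA.le
      _ = _ := by ring
  have t3 : (y (k + 2) 0 : ℝ) * (lineDist ξ (y k) * lineDist ξ (y (k + 1))) ≤ A ^ 5 := by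
    calc (y (k + 2) 0 : ℝ) * (lineDist ξ (y k) * lineDist ξ (y (k + 1)))
        ≤ (A ^ 3 * (y (k + 1) 0 * y k 0)) * (lineDist ξ (y k) * lineDist ξ (y (k + 1))) := by
          gcongr; exact h.succ_succ_le k
      _ = A ^ 3 * ((y k 0 * lineDist ξ (y k)) * (y (k + 1) 0 * lineDist ξ (y (k + 1)))) := by ring
      _ ≤ A ^ 3 * (A * A) := by gcongr <;> exact h.mul_lineDist_le _
      _ = _ := by ring
  linarith

theorem abs_cross_le (h : IsExtremalSeq ξ y A) (k : ℕ) {s : Fin 3} (hs : s = 1 ∨ s = 2) :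
    |(((y k ⨯₃ y (k + 1)) s : ℤ) : ℝ)| ≤ 2 * A * (y (k + 1) 0 / y k 0) := by
  have hA := h.const_pos
  have p0 := h.pos k
  have h1 := abs_cross_one_le (ξ := ξ) (x := y k) (y := y (k + 1))
  have h2 := abs_cross_two_le (ξ := ξ) (x := y k) (y := y (k + 1))
  rw [h.abs_zero, h.abs_zero] at h1 h2
  have t1 : (y k 0 : ℝ) * lineDist ξ (y (k + 1)) ≤ A :=
    (mul_le_mul_of_nonneg_right (h.lt_succ k).le (lineDist_nonneg _ _)).trans
      (h.mul_lineDist_le (k + 1))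
  have t2 : A ≤ A * (y (k + 1) 0 / y k 0) :=
    le_mul_of_one_le_right hA.le ((one_le_div p0).2 (h.lt_succ k).le)
  have t3 : (y (k + 1) 0 : ℝ) * lineDist ξ (y k) ≤ A * (y (k + 1) 0 / y k 0) := by
    calc (y (k + 1) 0 : ℝ) * lineDist ξ (y k) ≤ y (k + 1) 0 * (A / y k 0) :=
          mul_le_mul_of_nonneg_left (h.lineDist_le k) (h.pos _).le
      _ = _ := by ring
  rcases hs with rfl | rfl <;> linarith

/-- The multiples of an irrational `ξ` by bounded nonzero integers stay away from the integers. -/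
theorem exists_le_abs_sub (h : IsExtremalSeq ξ y A) (D : ℝ) : ∃ ε : ℝ, 0 < ε ∧
    ∀ n d : ℤ, d ≠ 0 → |(d : ℝ)| ≤ D → ε ≤ |(n : ℝ) - ξ * d| := by
  obtain ⟨c, hc, hlow⟩ := h.exists_le_abs_quadratic
  set H : ℝ := |D| * (|ξ| + 1) + 1 with hH
  have hH1 : 1 ≤ H := by
    have : 0 ≤ |D| * (|ξ| + 1) := by positivity
    linarith
  refine ⟨min 1 (c * H ^ (-φ ^ 3)), lt_min one_pos (by positivity), fun n d hd hdD => ?_⟩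
  rcases le_or_gt 1 |(n : ℝ) - ξ * d| with h1 | h1
  · exact (min_le_left _ _).trans h1
  refine (min_le_right _ _).trans ?_
  have hdD' : |(d : ℝ)| ≤ |D| := hdD.trans (le_abs_self _)
  have e0 : |ξ| * |(d : ℝ)| ≤ |D| * |ξ| := by rw [mul_comm]; gcongr
  have hn : |(n : ℝ)| ≤ H := by
    have h2 := abs_sub_abs_le_abs_sub (n : ℝ) (ξ * d)
    rw [abs_mul] at h2
    have := abs_nonneg D
    linarith
  have hd' : |(d : ℝ)| ≤ H := by
    have : 0 ≤ |D| * |ξ| := by positivity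
    linarith
  have h3 := hlow ![n, -d, 0] (fun h0 => hd (by simpa using congrFun h0 1)) H hH1 (by
    intro i
    fin_cases i
    · simpa using hn
    · simpa using hd'
    · simpa using zero_le_one.trans hH1)
  refine h3.trans_eq ?_
  congr 1
  simp
  ring

/-- The first coordinates of the sequence, multiplied by `ξ³`, stay away from the integers. If
`n` is an integer close to `y₀ ξ³`, where `y` is the term of index `k + 2`, then
`(y₁, y₂, n)` is close to `ξ (y₀, y₁, y₂)`, so the value at this point of the linear form that
vanishes at the two preceding terms is an integer close to `ξ` times a bounded nonzero integer. -/
theorem exists_le_abs_cube_sub (h : IsExtremalSeq ξ y A) : ∃ c B : ℝ, 0 < c ∧ ∀ k, B ≤ y k 0 →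
    ∀ n : ℤ, c ≤ y (k + 1) 0 / y k 0 * |y (k + 2) 0 * ξ ^ 3 - n| := by
  obtain ⟨ε, hε, hlow⟩ := h.exists_le_abs_sub (6 * A ^ 5)
  have hA := h.const_pos
  have hA1 := h.one_le_const
  set S : ℝ := 1 + 2 * |ξ| + ξ ^ 2 with hS
  have hS0 : 0 ≤ S := by positivity
  set E : ℝ := 4 * A * S * A ^ 4 + A * (6 * A ^ 5) + 4 * A * A ^ 4 * A with hE
  have hE0 : 0 < E := by positivity
  refine ⟨ε / (8 * A), 2 * E / ε, by positivity, fun k hk n => ?_⟩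
  have p0 := h.pos k
  have p1 := h.pos (k + 1)
  set R : ℝ := y (k + 1) 0 / y k 0 with hR
  have hR0 : 0 < R := div_pos p1 p0
  set η : ℝ := |y (k + 2) 0 * ξ ^ 3 - n| with hη
  have hL0 := lineDist_nonneg ξ (y (k + 2))
  have hLA := h.lineDist_le_const (k + 2)
  have hLk : lineDist ξ (y (k + 2)) ≤ A / y k 0 := by
    refine (h.lineDist_le (k + 2)).trans ?_
    have := (h.lt_succ k).trans (h.lt_succ (k + 1))
    gcongr
  have hRL : R * lineDist ξ (y (k + 2)) ≤ A ^ 4 / y k 0 := by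
    refine (h.div_mul_lineDist_le k).trans ?_
    have := h.one_le k
    gcongr
    nlinarith
  have a1 := abs_one_le_lineDist ξ (y (k + 2))
  have a2 := abs_two_le_lineDist ξ (y (k + 2))
  have hd := h.abs_triple_le_const k
  have hd0 := h.triple_ne_zero k
  have hm1 := h.abs_cross_le k (Or.inl rfl)
  have hm2 := h.abs_cross_le k (Or.inr rfl)
  rw [triple_product_permutation, triple_product_permutation, dotProduct_comm] at hd hd0
  rw [← hR] at hm1 hm2
  generalize y k ⨯₃ y (k + 1) = m at *
  set z : Fin 3 → ℤ := ![y (k + 2) 1, y (k + 2) 2, n] with hz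
  set P : ℝ := m 0 + m 1 * ξ + m 2 * ξ ^ 2 with hP
  set d : ℤ := m ⬝ᵥ y (k + 2) with hdd
  have hLz : lineDist ξ z ≤ η + (1 + |ξ| + ξ ^ 2) * lineDist ξ (y (k + 2)) := by
    have q1 : |ξ| * |(y (k + 2) 0 : ℝ) * ξ - y (k + 2) 1| ≤ |ξ| * lineDist ξ (y (k + 2)) := by
      gcongr
    have q2 : ξ ^ 2 * |(y (k + 2) 0 : ℝ) * ξ - y (k + 2) 1| ≤ ξ ^ 2 * lineDist ξ (y (k + 2)) := by
      gcongr
    have q3 : 0 ≤ |ξ| * lineDist ξ (y (k + 2)) := by positivity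
    have q4 : 0 ≤ ξ ^ 2 * lineDist ξ (y (k + 2)) := by positivity
    have q5 : 0 ≤ η := abs_nonneg _
    refine max_le ?_ ?_
    · have e : (z 0 : ℝ) * ξ - z 1 = (y (k + 2) 0 * ξ ^ 2 - y (k + 2) 2)
          - ξ * (y (k + 2) 0 * ξ - y (k + 2) 1) := by
        simp only [hz, cons_val_zero, cons_val_one]; ring
      rw [e]
      refine (abs_sub _ _).trans ?_
      rw [abs_mul]
      linarith
    · have e : (z 0 : ℝ) * ξ ^ 2 - z 2 = (y (k + 2) 0 * ξ ^ 3 - n)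
          - ξ ^ 2 * (y (k + 2) 0 * ξ - y (k + 2) 1) := by
        simp only [hz, cons_val_zero, cons_val]; ring
      rw [e]
      refine (abs_sub _ _).trans ?_
      rw [abs_mul, abs_of_nonneg (sq_nonneg ξ), ← hη]
      linarith
  have hm : |(m 1 : ℝ)| + |(m 2 : ℝ)| ≤ 4 * A * R := by linarith
  have b1 : |(d : ℝ) - y (k + 2) 0 * P| ≤ 4 * A * R * lineDist ξ (y (k + 2)) :=
    (abs_dotProduct_sub_le ξ m (y (k + 2))).trans (by gcongr)
  have b2 : |((m ⬝ᵥ z : ℤ) : ℝ) - z 0 * P| ≤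
      4 * A * R * (η + (1 + |ξ| + ξ ^ 2) * lineDist ξ (y (k + 2))) :=
    (abs_dotProduct_sub_le ξ m z).trans
      (mul_le_mul hm hLz (lineDist_nonneg _ _) (by positivity))
  have b3 : |P| ≤ 6 * A ^ 5 + 4 * A * R * lineDist ξ (y (k + 2)) := by
    have q1 := abs_sub_abs_le_abs_sub ((y (k + 2) 0 : ℝ) * P) d
    rw [abs_sub_comm, abs_mul, h.abs_zero] at q1
    have q2 : |P| ≤ y (k + 2) 0 * |P| := le_mul_of_one_le_left (abs_nonneg _) (h.one_le _)
    linarith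
  have b4 := hlow (m ⬝ᵥ z) d hd0 hd
  have e : ((m ⬝ᵥ z : ℤ) : ℝ) - ξ * d = (((m ⬝ᵥ z : ℤ) : ℝ) - z 0 * P)
      + (-((y (k + 2) 0 * ξ - y (k + 2) 1) * P) - ξ * (d - y (k + 2) 0 * P)) := by
    simp only [hz, cons_val_zero]; ring
  have b5 : |((m ⬝ᵥ z : ℤ) : ℝ) - ξ * d| ≤ 4 * A * (R * η) + E / y k 0 := by
    rw [e]
    refine (abs_add_le _ _).trans ((add_le_add_right (abs_sub _ _) _).trans ?_)
    rw [abs_neg, abs_mul, abs_mul]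
    have q1 : |(y (k + 2) 0 : ℝ) * ξ - y (k + 2) 1| * |P| ≤
        lineDist ξ (y (k + 2)) * (6 * A ^ 5 + 4 * A * R * lineDist ξ (y (k + 2))) :=
      mul_le_mul a1 b3 (abs_nonneg _) hL0
    have q2 : |ξ| * |(d : ℝ) - y (k + 2) 0 * P| ≤
        |ξ| * (4 * A * R * lineDist ξ (y (k + 2))) := by gcongr
    have q3 : 4 * A * S * (R * lineDist ξ (y (k + 2))) ≤ 4 * A * S * (A ^ 4 / y k 0) := by gcongr
    have q4 : lineDist ξ (y (k + 2)) * (6 * A ^ 5) ≤ A / y k 0 * (6 * A ^ 5) := by gcongr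
    have q5 : 4 * A * (R * lineDist ξ (y (k + 2))) * lineDist ξ (y (k + 2)) ≤
        4 * A * (A ^ 4 / y k 0) * A := by gcongr
    have e2 : E / y k 0 = 4 * A * S * (A ^ 4 / y k 0) + A / y k 0 * (6 * A ^ 5)
        + 4 * A * (A ^ 4 / y k 0) * A := by rw [hE]; ring
    rw [e2]
    rw [hS] at q3 ⊢
    linarith
  have b6 : E / y k 0 ≤ ε / 2 := by
    rw [div_le_iff₀ hε] at hk
    rw [div_le_div_iff₀ p0 two_pos]
    linarith
  rw [div_le_iff₀ (by positivity)]
  linarith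

/-- Lower bound for the value at `ξ` of a monic integer cubic, from its value at a point
`(y₀, y₁, y₂)` of the sequence together with an integer close to `y₀ ξ³`. -/
theorem exists_le_abs_cubic (h : IsExtremalSeq ξ y A) : ∃ c : ℝ, 0 < c ∧
    ∀ m : Fin 3 → ℤ, ∀ H : ℝ, 1 ≤ H → (∀ i, |(m i : ℝ)| ≤ H) →
      c * H ^ (-φ ^ 2) ≤ |(m 0 : ℝ) + m 1 * ξ + m 2 * ξ ^ 2 + ξ ^ 3| := by
  obtain ⟨C, hC, hcov⟩ := h.exists_ge
  obtain ⟨c, B, hc, hlow⟩ := h.exists_le_abs_cube_sub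
  have hA := h.const_pos
  have hC0 : 0 < C := zero_lt_one.trans_le hC
  set B' : ℝ := max 1 (max B √(4 * A ^ 4 / c)) with hB'
  have hB'0 : 0 < B' := zero_lt_one.trans_le (le_max_left _ _)
  refine ⟨c / (2 * A ^ 3 * C ^ 2 * (B' ^ (φ ^ 2)) ^ 2), by positivity, fun m H hH hmH => ?_⟩
  have hH0 : 0 < H := zero_lt_one.trans_le hH
  have hsH : 1 ≤ √H := Real.one_le_sqrt.2 hH
  have hBH : B' ≤ B' * √H := le_mul_of_one_le_right hB'0.le hsH
  obtain ⟨k, hk, -, h1, -⟩ := hcov (B' * √H) ((le_max_left _ _).trans hBH)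
  have p0 := h.pos k
  have p1 := h.pos (k + 1)
  have p2 := h.pos (k + 2)
  have hkB : B ≤ y k 0 :=
    ((le_max_left _ _).trans (le_max_right _ _)).trans (hBH.trans hk)
  have hkH : 4 * A ^ 4 / c * H ≤ (y k 0 : ℝ) ^ 2 := by
    have : √(4 * A ^ 4 / c) * √H ≤ y k 0 := by
      refine le_trans ?_ hk
      gcongr
      exact (le_max_right _ _).trans (le_max_right _ _)
    calc 4 * A ^ 4 / c * H = (√(4 * A ^ 4 / c) * √H) ^ 2 := by
          rw [mul_pow, Real.sq_sqrt (by positivity), Real.sq_sqrt hH0.le]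
      _ ≤ _ := by gcongr
  set P : ℝ := (m 0 : ℝ) + m 1 * ξ + m 2 * ξ ^ 2 + ξ ^ 3 with hP
  have h2 := hlow k hkB (-(m ⬝ᵥ y (k + 2)))
  set R : ℝ := y (k + 1) 0 / y k 0 with hR
  have hR0 : 0 < R := div_pos p1 p0
  have h3 := abs_dotProduct_sub_le ξ m (y (k + 2))
  have h4 : |(y (k + 2) 0 : ℝ) * ξ ^ 3 - ((-(m ⬝ᵥ y (k + 2)) : ℤ) : ℝ)| ≤
      y (k + 2) 0 * |P| + 2 * H * lineDist ξ (y (k + 2)) := by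
    have e : (y (k + 2) 0 : ℝ) * ξ ^ 3 - ((-(m ⬝ᵥ y (k + 2)) : ℤ) : ℝ) = y (k + 2) 0 * P +
        (((m ⬝ᵥ y (k + 2) : ℤ) : ℝ) - y (k + 2) 0 * (m 0 + m 1 * ξ + m 2 * ξ ^ 2)) := by
      rw [hP]; push_cast; ring
    rw [e]
    refine (abs_add_le _ _).trans ?_
    rw [abs_mul, h.abs_zero]
    refine add_le_add_right (h3.trans (mul_le_mul_of_nonneg_right ?_ (lineDist_nonneg _ _))) _
    have := hmH 1
    have := hmH 2
    linarith
  have h5 : R * (2 * H * lineDist ξ (y (k + 2))) ≤ c / 2 := by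
    calc R * (2 * H * lineDist ξ (y (k + 2))) = 2 * H * (R * lineDist ξ (y (k + 2))) := by ring
      _ ≤ 2 * H * (A ^ 4 / (y k 0 : ℝ) ^ 2) := by gcongr; exact h.div_mul_lineDist_le k
      _ ≤ c / 2 := by
        rw [div_mul_eq_mul_div, div_le_iff₀ hc] at hkH
        rw [← mul_div_assoc, div_le_div_iff₀ (by positivity) two_pos]
        linarith
  have h6 : R * y (k + 2) 0 ≤ A ^ 3 * (C ^ 2 * (B' ^ (φ ^ 2)) ^ 2 * H ^ (φ ^ 2)) := by
    have e : (B' * √H) ^ (φ ^ 2) = B' ^ (φ ^ 2) * √H ^ (φ ^ 2) :=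
      mul_rpow hB'0.le (Real.sqrt_nonneg _)
    have e2 : (√H ^ (φ ^ 2)) ^ 2 = H ^ (φ ^ 2) := by
      rw [← rpow_natCast, ← rpow_mul (Real.sqrt_nonneg _), mul_comm, rpow_mul (Real.sqrt_nonneg _),
        rpow_natCast, Real.sq_sqrt hH0.le]
    calc R * y (k + 2) 0 ≤ R * (A ^ 3 * (y (k + 1) 0 * y k 0)) := by
          gcongr; exact h.succ_succ_le k
      _ = A ^ 3 * (y (k + 1) 0 : ℝ) ^ 2 := by rw [hR]; field_simp
      _ ≤ A ^ 3 * (C * (B' * √H) ^ (φ ^ 2)) ^ 2 := by gcongr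
      _ = _ := by rw [e, ← e2]; ring
  have h7 : c / 2 ≤ R * y (k + 2) 0 * |P| := by
    have := h2.trans (mul_le_mul_of_nonneg_left h4 hR0.le)
    linarith
  have h8 : c / 2 ≤ A ^ 3 * (C ^ 2 * (B' ^ (φ ^ 2)) ^ 2 * H ^ (φ ^ 2)) * |P| :=
    h7.trans (by gcongr)
  rw [rpow_neg hH0.le, ← div_eq_mul_inv, div_div, div_le_iff₀ (by positivity)]
  linarith

end IsExtremalSeq

/-! ### Heights -/

open Polynomial in
theorem exists_irreducible_eq_naiveHeight {α : ℂ} (hα : IsAlgebraic ℚ α) :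
    ∃ P : ℤ[X], Irreducible P ∧ aeval α P = 0 ∧ naiveHeight α = P.supNorm ∧
      P.natDegree = (minpoly ℚ α).natDegree := by
  obtain ⟨Q, hQ0, hQ⟩ := (IsFractionRing.isAlgebraic_iff ℤ ℚ ℂ).2 hα
  obtain ⟨f, hf, hfQ⟩ := UniqueFactorizationMonoid.exists_prime_factors Q hQ0
  obtain ⟨P, hP, hP0⟩ : ∃ P ∈ f, aeval α P = 0 := by
    obtain ⟨u, hu⟩ := hfQ
    have h1 : aeval α f.prod = 0 := by
      have h2 : aeval α f.prod * aeval α (u : ℤ[X]) = 0 := by rw [← map_mul, hu, hQ]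
      exact (mul_eq_zero.1 h2).resolve_right (u.isUnit.map (aeval α)).ne_zero
    rw [map_multiset_prod, Multiset.prod_eq_zero_iff, Multiset.mem_map] at h1
    exact h1
  have hirr := (hf P hP).irreducible
  refine ⟨P, hirr, hP0, naiveHeight_eq_supNorm hirr hP0, ?_⟩
  have hdeg : P.natDegree ≠ 0 := by
    intro h0
    rw [eq_C_of_natDegree_eq_zero h0] at hP0
    have h1 : P.coeff 0 = 0 := by simpa using hP0
    apply hirr.ne_zero
    rw [eq_C_of_natDegree_eq_zero h0, h1, C_0]
  have hirr' : Irreducible (P.map (algebraMap ℤ ℚ)) :=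
    (hirr.isPrimitive hdeg).irreducible_iff_irreducible_map_fraction_map.1 hirr
  have hroot : aeval α (P.map (algebraMap ℤ ℚ)) = 0 := by rw [aeval_map_algebraMap, hP0]
  have hass := (minpoly.irreducible hα.isIntegral).associated_of_dvd hirr' (minpoly.dvd ℚ α hroot)
  rw [natDegree_eq_of_degree_eq (degree_eq_degree_of_associated hass),
    natDegree_map_eq_of_injective (algebraMap ℤ ℚ).injective_int]

theorem one_le_supNorm {P : Polynomial ℤ} (hP : P ≠ 0) : 1 ≤ P.supNorm := by
  have h1 : P.coeff P.natDegree ≠ 0 := Polynomial.leadingCoeff_ne_zero.2 hP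
  refine le_trans ?_ (P.le_supNorm P.natDegree)
  rw [Int.norm_eq_abs]
  exact_mod_cast Int.one_le_abs h1

theorem abs_coeff_le_supNorm (P : Polynomial ℤ) (i : ℕ) : |(P.coeff i : ℝ)| ≤ P.supNorm := by
  rw [← Int.norm_eq_abs]
  exact P.le_supNorm i

open Polynomial in
theorem aeval_eq_of_natDegree_le_three {R : Type*} [CommRing R] {P : ℤ[X]}
    (hP : P.natDegree ≤ 3) (z : R) :
    aeval z P = P.coeff 0 + P.coeff 1 * z + P.coeff 2 * z ^ 2 + P.coeff 3 * z ^ 3 := by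
  rw [aeval_eq_sum_range' (by omega : P.natDegree < 4)]
  simp only [Finset.sum_range_succ, Finset.sum_range_zero, zsmul_eq_mul]
  ring

/-- The value at `ξ` of a polynomial is small when `ξ` is close to one of its roots. -/
theorem abs_le_mul_norm_sub {ξ : ℝ} {α : ℂ} (hα : ‖(ξ : ℂ) - α‖ ≤ 1) {P : Polynomial ℤ}
    (hP : P.natDegree ≤ 3) (h0 : Polynomial.aeval α P = 0) :
    |(P.coeff 0 : ℝ) + P.coeff 1 * ξ + P.coeff 2 * ξ ^ 2 + P.coeff 3 * ξ ^ 3| ≤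
      (1 + 2 * (|ξ| + 1) + 3 * (|ξ| + 1) ^ 2) * P.supNorm * ‖(ξ : ℂ) - α‖ := by
  rw [aeval_eq_of_natDegree_le_three hP] at h0
  set M : ℝ := |ξ| + 1 with hM
  have hM0 : 0 ≤ M := by positivity
  have hξM : ‖(ξ : ℂ)‖ ≤ M := by rw [Complex.norm_real, Real.norm_eq_abs]; linarith
  have hαM : ‖α‖ ≤ M := by
    have h1 := norm_sub_norm_le α ξ
    rw [norm_sub_rev, Complex.norm_real, Real.norm_eq_abs] at h1
    linarith
  have hc : ∀ i, ‖((P.coeff i : ℤ) : ℂ)‖ ≤ P.supNorm := by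
    intro i
    rw [Complex.norm_intCast]
    exact abs_coeff_le_supNorm P i
  have hH : 0 ≤ P.supNorm := P.supNorm_nonneg
  have e : (((P.coeff 0 : ℝ) + P.coeff 1 * ξ + P.coeff 2 * ξ ^ 2 + P.coeff 3 * ξ ^ 3 : ℝ) : ℂ) =
      (P.coeff 1 + P.coeff 2 * (ξ + α) + P.coeff 3 * (ξ ^ 2 + ξ * α + α ^ 2)) * (ξ - α) := by
    push_cast
    linear_combination h0
  have h1 : ‖(ξ : ℂ) + α‖ ≤ 2 * M := (norm_add_le _ _).trans (by linarith)
  have h2 : ‖(ξ : ℂ) ^ 2 + ξ * α + α ^ 2‖ ≤ 3 * M ^ 2 := by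
    refine (norm_add₃_le).trans ?_
    rw [norm_mul, norm_pow, norm_pow]
    have t1 : ‖(ξ : ℂ)‖ ^ 2 ≤ M ^ 2 := by gcongr
    have t2 : ‖α‖ ^ 2 ≤ M ^ 2 := by gcongr
    have t3 : ‖(ξ : ℂ)‖ * ‖α‖ ≤ M * M := by gcongr
    linarith
  rw [← Real.norm_eq_abs, ← Complex.norm_real, e, norm_mul]
  gcongr
  refine (norm_add₃_le).trans ?_
  rw [norm_mul, norm_mul]
  have t2 : ‖((P.coeff 2 : ℤ) : ℂ)‖ * ‖(ξ : ℂ) + α‖ ≤ P.supNorm * (2 * M) :=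
    mul_le_mul (hc 2) h1 (norm_nonneg _) hH
  have t3 : ‖((P.coeff 3 : ℤ) : ℂ)‖ * ‖(ξ : ℂ) ^ 2 + ξ * α + α ^ 2‖ ≤ P.supNorm * (3 * M ^ 2) :=
    mul_le_mul (hc 3) h2 (norm_nonneg _) hH
  have t1 := hc 1
  linarith

/-- From a lower bound for the value of a polynomial at `ξ` to one for the distance from `ξ` to a
root of the polynomial. -/
theorem min_mul_rpow_le_norm_sub {ξ : ℝ} {α : ℂ} {P : Polynomial ℤ} {c e f : ℝ} (hc : 0 < c)
    (hef : f ≤ e - 1) (hf : f ≤ 0) (hP0 : P ≠ 0) (hP : P.natDegree ≤ 3)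
    (h0 : Polynomial.aeval α P = 0)
    (h : c * P.supNorm ^ e ≤
      |(P.coeff 0 : ℝ) + P.coeff 1 * ξ + P.coeff 2 * ξ ^ 2 + P.coeff 3 * ξ ^ 3|) :
    min 1 (c / (1 + 2 * (|ξ| + 1) + 3 * (|ξ| + 1) ^ 2)) * P.supNorm ^ f ≤ ‖(ξ : ℂ) - α‖ := by
  have hH := one_le_supNorm hP0
  have hH0 : 0 < P.supNorm := zero_lt_one.trans_le hH
  set K : ℝ := 1 + 2 * (|ξ| + 1) + 3 * (|ξ| + 1) ^ 2 with hK
  have hK0 : 0 < K := by positivity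
  rcases le_total ‖(ξ : ℂ) - α‖ 1 with h1 | h1
  · have h2 := h.trans (abs_le_mul_norm_sub h1 hP h0)
    rw [← hK] at h2
    calc min 1 (c / K) * P.supNorm ^ f ≤ c / K * P.supNorm ^ (e - 1) :=
          mul_le_mul (min_le_right _ _) (rpow_le_rpow_of_exponent_le hH hef) (by positivity)
            (by positivity)
      _ ≤ ‖(ξ : ℂ) - α‖ := by
        rw [rpow_sub_one hH0.ne', div_mul_div_comm, div_le_iff₀ (by positivity)]
        linarith
  · calc min 1 (c / K) * P.supNorm ^ f ≤ 1 * 1 :=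
          mul_le_mul (min_le_left _ _) (rpow_le_one_of_one_le_of_nonpos hH hf) (by positivity)
            zero_le_one
      _ ≤ _ := by rwa [one_mul]

theorem goldenRatio_pow_three : φ ^ 3 = 2 * φ ^ 2 - 1 := by
  linear_combination (φ - 1) * goldenRatio_sq

/-! ### Algebraic numbers of degree at most two and algebraic integers of degree at most three -/

theorem IsExtremalSeq.exists_le_norm_sub_of_natDegree_le_two {ξ A : ℝ} {y : ℕ → Fin 3 → ℤ}
    (h : IsExtremalSeq ξ y A) : ∃ c : ℝ, 0 < c ∧ ∀ α : ℂ, IsAlgebraic ℚ α →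
      (minpoly ℚ α).natDegree ≤ 2 → c * naiveHeight α ^ (-2 * φ ^ 2) ≤ ‖(ξ : ℂ) - α‖ := by
  obtain ⟨c, hc, hlow⟩ := h.exists_le_abs_quadratic
  refine ⟨min 1 (c / (1 + 2 * (|ξ| + 1) + 3 * (|ξ| + 1) ^ 2)), lt_min one_pos (by positivity),
    fun α hα hdeg => ?_⟩
  obtain ⟨P, hirr, hroot, hH, hd⟩ := exists_irreducible_eq_naiveHeight hα
  rw [← hd] at hdeg
  have h3 : P.coeff 3 = 0 := Polynomial.coeff_eq_zero_of_natDegree_lt (by omega)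
  rw [hH]
  refine min_mul_rpow_le_norm_sub (e := -φ ^ 3) hc ?_ ?_ hirr.ne_zero (by omega) hroot ?_
  · rw [goldenRatio_pow_three]; linarith
  · have := sq_nonneg φ; linarith
  · have := hlow (fun i => P.coeff i) ?_ _ (one_le_supNorm hirr.ne_zero) fun i =>
      abs_coeff_le_supNorm P i
    · simpa [h3] using this
    · intro h0
      apply hirr.ne_zero
      ext i
      rw [Polynomial.coeff_zero]
      rcases Nat.lt_or_ge i 3 with hi | hi
      · exact congrFun h0 ⟨i, hi⟩
      · exact Polynomial.coeff_eq_zero_of_natDegree_lt (by omega)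

open Polynomial in
/-- An algebraic integer is a root of the monic cubic obtained from its minimal polynomial by
multiplication with a power of `X`, which does not change the height. -/
theorem exists_monic_cubic {α : ℂ} (hα : IsIntegral ℤ α) (hdeg : (minpoly ℚ α).natDegree ≤ 3) :
    ∃ P : ℤ[X], P.natDegree = 3 ∧ P.coeff 3 = 1 ∧ aeval α P = 0 ∧
      P.supNorm = naiveHeight α := by
  have hirr := minpoly.irreducible hα
  rw [minpoly.isIntegrallyClosed_eq_field_fractions' ℚ hα,
    (minpoly.monic hα).natDegree_map] at hdeg
  set M := minpoly ℤ α with hM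
  have hmon : M.Monic := minpoly.monic hα
  have hdeg' : (M * X ^ (3 - M.natDegree)).natDegree = 3 := by
    rw [hmon.natDegree_mul (monic_X_pow _), natDegree_X_pow]; omega
  refine ⟨M * X ^ (3 - M.natDegree), hdeg', ?_, ?_, ?_⟩
  · have := (hmon.mul (monic_X_pow (3 - M.natDegree))).coeff_natDegree
    rwa [hdeg'] at this
  · rw [map_mul, hM, minpoly.aeval, zero_mul]
  · rw [naiveHeight_eq_supNorm hirr (minpoly.aeval ℤ α)]
    apply le_antisymm
    · obtain ⟨i, hi⟩ := (M * X ^ (3 - M.natDegree)).exists_eq_supNorm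
      rw [hi, coeff_mul_X_pow']
      split_ifs
      · exact M.le_supNorm _
      · simpa using M.supNorm_nonneg
    · obtain ⟨i, hi⟩ := M.exists_eq_supNorm
      rw [hi, ← coeff_mul_X_pow M (3 - M.natDegree) i]
      exact le_supNorm _ _

theorem IsExtremalSeq.exists_le_norm_sub_of_isIntegral {ξ A : ℝ} {y : ℕ → Fin 3 → ℤ}
    (h : IsExtremalSeq ξ y A) : ∃ c : ℝ, 0 < c ∧ ∀ α : ℂ, IsIntegral ℤ α →
      (minpoly ℚ α).natDegree ≤ 3 →
        c * naiveHeight α ^ (-(3 / 2) * φ ^ 2) ≤ ‖(ξ : ℂ) - α‖ := by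
  obtain ⟨c, hc, hlow⟩ := h.exists_le_abs_cubic
  refine ⟨min 1 (c / (1 + 2 * (|ξ| + 1) + 3 * (|ξ| + 1) ^ 2)), lt_min one_pos (by positivity),
    fun α hα hdeg => ?_⟩
  obtain ⟨P, hd, h3, hroot, hH⟩ := exists_monic_cubic hα hdeg
  have hP0 : P ≠ 0 := by
    rintro rfl
    simp at hd
  rw [← hH]
  have hφ := one_lt_goldenRatio
  refine min_mul_rpow_le_norm_sub (e := -φ ^ 2) hc ?_ ?_ hP0 hd.le hroot ?_
  · have := goldenRatio_sq; linarith
  · have := sq_nonneg φ; linarith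
  · have := hlow (fun i => P.coeff i) _ (one_le_supNorm hP0) fun i => abs_coeff_le_supNorm P i
    simpa [h3] using this

/-! ### Rational approximation -/

/-- The value at `(q, p)` of the linear form `q ξ - p`. -/
def linForm (ξ : ℝ) (v : ℤ × ℤ) : ℝ := v.1 * ξ - v.2

/-- The product of the symmetric matrix with rows `(x₀, x₁)` and `(x₁, x₂)` with the vector
`(p, -q)`, for `v = (q, p)`. -/
def symmAct (x : Fin 3 → ℤ) (v : ℤ × ℤ) : ℤ × ℤ :=
  (x 0 * v.2 - x 1 * v.1, x 1 * v.2 - x 2 * v.1)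

/-- The derivative of the quadratic form `symmDet` at `(1, ξ, ξ²)` in the direction `x`. -/
def symmDeriv (ξ : ℝ) (x : Fin 3 → ℤ) : ℝ :=
  2 * ξ * (x 0 * ξ - x 1) - (x 0 * ξ ^ 2 - x 2)

theorem symmAct_symmAct (x : Fin 3 → ℤ) (v : ℤ × ℤ) :
    symmAct x (symmAct x v) = (-(symmDet x * v.1), -(symmDet x * v.2)) := by
  ext <;> simp only [symmAct, symmDet] <;> ring

theorem symmAct_ne_zero {x : Fin 3 → ℤ} (hx : symmDet x ≠ 0) {v : ℤ × ℤ} (hv : v ≠ 0) :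
    symmAct x v ≠ 0 := by
  intro h
  have h1 := symmAct_symmAct x v
  rw [h] at h1
  apply hv
  have e1 := congrArg Prod.fst h1
  have e2 := congrArg Prod.snd h1
  simp only [symmAct, Prod.fst_zero, Prod.snd_zero, mul_zero, sub_zero, zero_eq_neg,
    mul_eq_zero, hx, false_or] at e1 e2
  exact Prod.ext e1 e2

theorem symmAct_fst (ξ : ℝ) (x : Fin 3 → ℤ) (v : ℤ × ℤ) :
    ((symmAct x v).1 : ℝ) = -(x 0 * linForm ξ v) + (x 0 * ξ - x 1) * v.1 := by
  simp only [symmAct, linForm]; push_cast; ring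

theorem linForm_symmAct (ξ : ℝ) (x : Fin 3 → ℤ) (v : ℤ × ℤ) :
    linForm ξ (symmAct x v) = -((x 0 * ξ - x 1) * linForm ξ v) + symmDeriv ξ x * v.1 := by
  simp only [symmAct, linForm, symmDeriv]; push_cast; ring

theorem symmDet_eq (ξ : ℝ) (x : Fin 3 → ℤ) :
    (symmDet x : ℝ) = x 0 * symmDeriv ξ x - (x 0 * ξ - x 1) ^ 2 := by
  simp only [symmDet, symmDeriv]; push_cast; ring

theorem abs_symmDeriv_le (ξ : ℝ) (x : Fin 3 → ℤ) :
    |symmDeriv ξ x| ≤ (1 + 2 * |ξ|) * lineDist ξ x := by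
  unfold symmDeriv
  refine (abs_sub _ _).trans ?_
  rw [abs_mul, abs_mul, abs_two]
  have h1 : 2 * |ξ| * |(x 0 : ℝ) * ξ - x 1| ≤ 2 * |ξ| * lineDist ξ x := by
    gcongr; exact abs_one_le_lineDist ξ x
  have h2 := abs_two_le_lineDist ξ x
  linarith

theorem one_le_abs_fst_add_abs_linForm (ξ : ℝ) {v : ℤ × ℤ} (hv : v ≠ 0) :
    1 ≤ |(v.1 : ℝ)| + |linForm ξ v| := by
  by_cases h : v.1 = 0
  · have h2 : v.2 ≠ 0 := fun h2 => hv (Prod.ext h h2)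
    have h3 : (1 : ℝ) ≤ |(v.2 : ℝ)| := by exact_mod_cast Int.one_le_abs h2
    simpa [linForm, h] using h3
  · have h3 : (1 : ℝ) ≤ |(v.1 : ℝ)| := by exact_mod_cast Int.one_le_abs h
    have := abs_nonneg (linForm ξ v)
    linarith

/-- A nondegenerate symmetric integer matrix maps nonzero integer vectors to nonzero integer
vectors. -/
theorem one_le_of_symmDet_ne_zero (ξ : ℝ) {x : Fin 3 → ℤ} (hx : symmDet x ≠ 0) {v : ℤ × ℤ}
    (hv : v ≠ 0) : 1 ≤ |(x 0 : ℝ)| * |linForm ξ v| +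
      (2 + 2 * |ξ|) * (lineDist ξ x * (|(v.1 : ℝ)| + |linForm ξ v|)) := by
  refine (one_le_abs_fst_add_abs_linForm ξ (symmAct_ne_zero hx hv)).trans ?_
  rw [symmAct_fst ξ, linForm_symmAct]
  refine (add_le_add (abs_add_le _ _) (abs_add_le _ _)).trans ?_
  rw [abs_neg, abs_neg, abs_mul, abs_mul, abs_mul, abs_mul]
  have hL := lineDist_nonneg ξ x
  have h1 : |(x 0 : ℝ) * ξ - x 1| * |(v.1 : ℝ)| ≤ lineDist ξ x * |(v.1 : ℝ)| := by
    gcongr; exact abs_one_le_lineDist ξ x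
  have h2 : |(x 0 : ℝ) * ξ - x 1| * |linForm ξ v| ≤ lineDist ξ x * |linForm ξ v| := by
    gcongr; exact abs_one_le_lineDist ξ x
  have h3 : |symmDeriv ξ x| * |(v.1 : ℝ)| ≤ (1 + 2 * |ξ|) * lineDist ξ x * |(v.1 : ℝ)| := by
    gcongr; exact abs_symmDeriv_le ξ x
  have h4 : 0 ≤ (1 + 2 * |ξ|) * (lineDist ξ x * |linForm ξ v|) := by positivity
  linarith

theorem symmAct_symmAct_fst (ξ : ℝ) (x z : Fin 3 → ℤ) (v : ℤ × ℤ) :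
    ((symmAct x (symmAct z v)).1 : ℝ) =
      (x 0 * (z 0 * ξ - z 1) - (x 0 * ξ - x 1) * z 0) * linForm ξ v +
        ((x 0 * ξ - x 1) * (z 0 * ξ - z 1) - x 0 * symmDeriv ξ z) * v.1 := by
  rw [symmAct_fst ξ, linForm_symmAct, symmAct_fst ξ]
  ring

theorem symmDet_mul_symmDet_mul_linForm (ξ : ℝ) (x z : Fin 3 → ℤ) (v : ℤ × ℤ) :
    (symmDet x * symmDet z : ℝ) * linForm ξ v =
      ((x 0 * ξ - x 1) * (z 0 * ξ - z 1) - x 0 * symmDeriv ξ z) *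
          linForm ξ (symmAct x (symmAct z v)) +
        ((x 0 * ξ - x 1) * symmDeriv ξ z - (z 0 * ξ - z 1) * symmDeriv ξ x) *
          (symmAct x (symmAct z v)).1 := by
  rw [linForm_symmAct ξ x, symmAct_fst ξ x, linForm_symmAct ξ z, symmAct_fst ξ z, symmDet_eq ξ x,
    symmDet_eq ξ z]
  ring

namespace IsExtremalSeq

variable {ξ A : ℝ} {y : ℕ → Fin 3 → ℤ}

theorem one_le_two_mul (h : IsExtremalSeq ξ y A) {k : ℕ}
    (hk : (2 + 2 * |ξ|) * A ≤ (y k 0 : ℝ) ^ 2) {v : ℤ × ℤ} (hv : v ≠ 0) :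
    1 ≤ 2 * y k 0 * |linForm ξ v| + (2 + 2 * |ξ|) * A * |(v.1 : ℝ)| / y k 0 := by
  have p := h.pos k
  have h1 := one_le_of_symmDet_ne_zero ξ (h.symmDet_ne_zero k) hv
  rw [h.abs_zero] at h1
  have h2 := h.lineDist_le k
  have hS : 0 ≤ 2 + 2 * |ξ| := by positivity
  have h3 : (2 + 2 * |ξ|) * (lineDist ξ (y k) * |(v.1 : ℝ)|) ≤
      (2 + 2 * |ξ|) * A * |(v.1 : ℝ)| / y k 0 := by
    calc _ ≤ (2 + 2 * |ξ|) * (A / y k 0 * |(v.1 : ℝ)|) := by gcongr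
      _ = _ := by ring
  have h4 : (2 + 2 * |ξ|) * (lineDist ξ (y k) * |linForm ξ v|) ≤ y k 0 * |linForm ξ v| := by
    calc _ ≤ (2 + 2 * |ξ|) * (A / y k 0 * |linForm ξ v|) := by gcongr
      _ = ((2 + 2 * |ξ|) * A) / y k 0 * |linForm ξ v| := by ring
      _ ≤ y k 0 * |linForm ξ v| := by
        gcongr
        rw [div_le_iff₀ p]
        linarith
  linarith

theorem abs_symmDet_le_const (h : IsExtremalSeq ξ y A) (k : ℕ) :
    |(symmDet (y k) : ℝ)| ≤ (2 + 2 * |ξ|) * A ^ 2 := by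
  have hA := h.const_pos
  rw [symmDet_eq ξ]
  refine (abs_sub _ _).trans ?_
  rw [abs_mul, h.abs_zero, abs_pow]
  have h1 : (y k 0 : ℝ) * |symmDeriv ξ (y k)| ≤ (1 + 2 * |ξ|) * A ^ 2 := by
    calc (y k 0 : ℝ) * |symmDeriv ξ (y k)| ≤ y k 0 * ((1 + 2 * |ξ|) * lineDist ξ (y k)) :=
          mul_le_mul_of_nonneg_left (abs_symmDeriv_le _ _) (h.pos k).le
      _ = (1 + 2 * |ξ|) * (y k 0 * lineDist ξ (y k)) := by ring
      _ ≤ (1 + 2 * |ξ|) * A := by gcongr; exact h.mul_lineDist_le k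
      _ ≤ (1 + 2 * |ξ|) * A ^ 2 := by gcongr; nlinarith [h.one_le_const]
  have h2 : |(y k 0 : ℝ) * ξ - y k 1| ^ 2 ≤ A ^ 2 := by
    gcongr; exact (abs_one_le_lineDist _ _).trans (h.lineDist_le_const k)
  linarith

/-- The product of two consecutive terms, viewed as symmetric matrices, maps an integer vector
`v` close to the direction `(1, ξ)` to a nonzero vector that is shorter by the factor
`R = y (k + 1) 0 / y k 0` and whose value under the linear form is at most of the order of `R`
times that of `v`. -/
theorem exists_descent (h : IsExtremalSeq ξ y A) {C : ℝ} (hC : C = (4 + 4 * |ξ|) * A ^ 2) {k : ℕ}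
    (hk : 2 * C ≤ (y k 0 : ℝ) ^ 2) {v : ℤ × ℤ} (hv : v ≠ 0) : ∃ w : ℤ × ℤ, w ≠ 0 ∧
      |(w.1 : ℝ)| ≤ C * (y (k + 1) 0 / y k 0 * |linForm ξ v| +
        |(v.1 : ℝ)| / (y (k + 1) 0 / y k 0)) ∧
      (|(w.1 : ℝ)| ≤ y k 0 / (16 * C) →
        |linForm ξ w| ≤ 4 * C ^ 2 * (y (k + 1) 0 / y k 0) * |linForm ξ v|) := by
  have hA := h.const_pos
  have hA1 := h.one_le_const
  have hAA : A ≤ A ^ 2 := by nlinarith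
  have hξ := abs_nonneg ξ
  have hξA : 0 ≤ |ξ| * A ^ 2 := by positivity
  have hξA' : |ξ| * A ≤ |ξ| * A ^ 2 := by gcongr
  have hA0 : 0 < A ^ 2 := by positivity
  obtain ⟨hC0, f1, f2, f3, f4, f5, f6⟩ : 0 < C ∧ 2 * A ≤ C ∧ A ^ 2 + (1 + 2 * |ξ|) * A ≤ C ∧
      (2 + 4 * |ξ|) * A ^ 2 ≤ C ∧ (2 + 2 * |ξ|) * A ≤ C ∧ (2 + 2 * |ξ|) * A ^ 2 ≤ C ∧
      4 * A ^ 2 ≤ C := by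
    rw [hC]
    refine ⟨?_, ?_, ?_, ?_, ?_, ?_, ?_⟩ <;> linarith
  clear hC
  have p0 := h.pos k
  have p1 := h.pos (k + 1)
  have o0 := h.one_le k
  set R : ℝ := y (k + 1) 0 / y k 0 with hR
  have hR0 : 0 < R := div_pos p1 p0
  have hRe : (y (k + 1) 0 : ℝ) = R * y k 0 := by rw [hR]; field_simp
  have hl0 := h.lineDist_le k
  have hl1 := h.lineDist_le (k + 1)
  have a0 := (abs_one_le_lineDist ξ (y k)).trans hl0
  have a1 := (abs_one_le_lineDist ξ (y (k + 1))).trans hl1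
  have t0 := (abs_symmDeriv_le ξ (y k)).trans
    (mul_le_mul_of_nonneg_left hl0 (by positivity : 0 ≤ 1 + 2 * |ξ|))
  have t1 := (abs_symmDeriv_le ξ (y (k + 1))).trans
    (mul_le_mul_of_nonneg_left hl1 (by positivity : 0 ≤ 1 + 2 * |ξ|))
  have d1 := symmDet_eq ξ (y (k + 1))
  set a : ℝ := y k 0 * ξ - y k 1 with ha
  set b : ℝ := y (k + 1) 0 * ξ - y (k + 1) 1 with hb
  set s : ℝ := symmDeriv ξ (y k) with hs
  set t : ℝ := symmDeriv ξ (y (k + 1)) with ht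
  set w := symmAct (y k) (symmAct (y (k + 1)) v) with hw
  have hw0 : w ≠ 0 :=
    symmAct_ne_zero (h.symmDet_ne_zero k) (symmAct_ne_zero (h.symmDet_ne_zero (k + 1)) hv)
  have ew : (w.1 : ℝ) = (y k 0 * b - a * y (k + 1) 0) * linForm ξ v + (a * b - y k 0 * t) * v.1 :=
    symmAct_symmAct_fst ξ (y k) (y (k + 1)) v
  have ev : (symmDet (y k) * symmDet (y (k + 1)) : ℝ) * linForm ξ v =
      (a * b - y k 0 * t) * linForm ξ w + (a * t - b * s) * w.1 :=
    symmDet_mul_symmDet_mul_linForm ξ (y k) (y (k + 1)) v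
  have hab : |a * b| ≤ A ^ 2 / (R * (y k 0 : ℝ) ^ 2) := by
    rw [abs_mul]
    calc |a| * |b| ≤ A / y k 0 * (A / y (k + 1) 0) :=
          mul_le_mul a0 a1 (abs_nonneg _) (by positivity)
      _ = _ := by rw [hRe]; field_simp
  have hsq1 : 1 ≤ (y k 0 : ℝ) ^ 2 := one_le_pow₀ o0
  refine ⟨w, hw0, ?_, fun hsmall => ?_⟩
  · rw [ew]
    refine (abs_add_le _ _).trans ?_
    rw [abs_mul, abs_mul, mul_add]
    have h1 : |y k 0 * b - a * y (k + 1) 0| ≤ C * R := by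
      refine (abs_sub _ _).trans ?_
      rw [abs_mul, abs_mul, h.abs_zero, h.abs_zero]
      have u1 : (y k 0 : ℝ) * |b| ≤ A * R := by
        calc (y k 0 : ℝ) * |b| ≤ y k 0 * (A / y (k + 1) 0) := by gcongr
          _ = A * (y k 0 / y (k + 1) 0) := by ring
          _ ≤ A * R := by
            have u3 : (y k 0 : ℝ) / y (k + 1) 0 ≤ 1 := (div_le_one p1).2 (h.lt_succ k).le
            have u4 : 1 ≤ R := (one_le_div p0).2 (h.lt_succ k).le
            gcongr
            exact u3.trans u4
      have u2 : |a| * y (k + 1) 0 ≤ A * R := by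
        calc |a| * y (k + 1) 0 ≤ A / y k 0 * y (k + 1) 0 := by gcongr
          _ = A * R := by rw [hR]; ring
      have u5 : 2 * A * R ≤ C * R := by
        gcongr
      linarith
    have h2 : |a * b - y k 0 * t| ≤ C / R := by
      refine (abs_sub _ _).trans ?_
      rw [abs_mul (y k 0 : ℝ), h.abs_zero]
      have u1 : |a * b| ≤ A ^ 2 / R := by
        refine hab.trans ?_
        gcongr
        exact le_mul_of_one_le_right hR0.le hsq1
      have u2 : (y k 0 : ℝ) * |t| ≤ (1 + 2 * |ξ|) * A / R := by
        calc (y k 0 : ℝ) * |t| ≤ y k 0 * ((1 + 2 * |ξ|) * (A / y (k + 1) 0)) := by gcongr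
          _ = _ := by rw [hRe]; field_simp
      have u3 : A ^ 2 / R + (1 + 2 * |ξ|) * A / R ≤ C / R := by
        rw [← add_div]
        gcongr
      linarith
    have h3 := mul_le_mul_of_nonneg_right h1 (abs_nonneg (linForm ξ v))
    have h4 := mul_le_mul_of_nonneg_right h2 (abs_nonneg (v.1 : ℝ))
    calc _ ≤ _ := add_le_add h3 h4
      _ = _ := by ring
  · set ℓ := |linForm ξ w| with hℓ
    -- the coefficient of the linear form of `w` has the exact order `1 / R`
    have h1 : 1 / (2 * R) ≤ |a * b - y k 0 * t| := by
      have hd : (1 : ℝ) ≤ |(symmDet (y (k + 1)) : ℝ)| := by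
        exact_mod_cast Int.one_le_abs (h.symmDet_ne_zero (k + 1))
      have u1 : |(symmDet (y (k + 1)) : ℝ)| ≤ y (k + 1) 0 * |t| + |b| ^ 2 := by
        rw [d1]
        refine (abs_sub _ _).trans ?_
        rw [abs_mul, h.abs_zero, abs_pow]
      have u2 : |b| ^ 2 ≤ A ^ 2 / (y k 0 : ℝ) ^ 2 := by
        rw [← div_pow]
        gcongr
        refine a1.trans ?_
        have := (h.lt_succ k).le
        gcongr
      have u3 : A ^ 2 / (y k 0 : ℝ) ^ 2 ≤ 1 / 4 := by
        rw [div_le_div_iff₀ (by positivity) (by norm_num)]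
        linarith
      have u4 : 3 / 4 ≤ R * (y k 0 * |t|) := by
        rw [hRe] at u1
        linarith
      have u5 : |a * b| ≤ 1 / 4 / R := by
        refine hab.trans ?_
        rw [mul_comm, ← div_div]
        gcongr
      have u6 := abs_sub_abs_le_abs_sub ((y k 0 : ℝ) * t) (a * b)
      rw [abs_sub_comm, abs_mul, h.abs_zero] at u6
      have u7 : 3 / 4 / R ≤ y k 0 * |t| := by
        rw [div_le_iff₀ hR0]; linarith
      have u8 : 1 / (2 * R) = 3 / 4 / R - 1 / 4 / R := by field_simp; norm_num
      linarith
    have h2 : |a * t - b * s| ≤ C / (y k 0 * y (k + 1) 0) := by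
      refine (abs_sub _ _).trans ?_
      rw [abs_mul, abs_mul]
      have u1 : |a| * |t| ≤ A / y k 0 * ((1 + 2 * |ξ|) * (A / y (k + 1) 0)) :=
        mul_le_mul a0 t1 (abs_nonneg _) (by positivity)
      have u2 : |b| * |s| ≤ A / y (k + 1) 0 * ((1 + 2 * |ξ|) * (A / y k 0)) :=
        mul_le_mul a1 t0 (abs_nonneg _) (by positivity)
      have u3 : A / y k 0 * ((1 + 2 * |ξ|) * (A / y (k + 1) 0)) +
          A / y (k + 1) 0 * ((1 + 2 * |ξ|) * (A / y k 0)) =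
          (2 + 4 * |ξ|) * A ^ 2 / (y k 0 * y (k + 1) 0) := by field_simp; ring
      have u4 : (2 + 4 * |ξ|) * A ^ 2 / (y k 0 * y (k + 1) 0) ≤ C / (y k 0 * y (k + 1) 0 : ℝ) := by
        gcongr
      linarith
    have h3 : 1 ≤ 4 * (y k 0 * ℓ) := by
      have u1 := h.one_le_two_mul (k := k) (v := w) (by linarith) hw0
      have u2 : (2 + 2 * |ξ|) * A * |(w.1 : ℝ)| / y k 0 ≤ 1 / 2 := by
        rw [div_le_div_iff₀ p0 two_pos]
        rw [le_div_iff₀ (by positivity)] at hsmall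
        have u4 := mul_le_mul_of_nonneg_right f4 (abs_nonneg (w.1 : ℝ))
        have u5 : 0 ≤ C * |(w.1 : ℝ)| := by positivity
        linarith
      linarith
    have h4 : C / (y k 0 * y (k + 1) 0) * |(w.1 : ℝ)| ≤ ℓ / (4 * R) := by
      calc C / (y k 0 * y (k + 1) 0) * |(w.1 : ℝ)|
          ≤ C / (y k 0 * y (k + 1) 0) * (y k 0 / (16 * C)) := by gcongr
        _ = 1 / (16 * y (k + 1) 0) := by field_simp
        _ ≤ 4 * (y k 0 * ℓ) / (16 * y (k + 1) 0) := by gcongr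
        _ = ℓ / (4 * R) := by rw [hRe]; field_simp; ring
    have h5 : ℓ / (4 * R) ≤ C ^ 2 * |linForm ξ v| := by
      have u1 := abs_sub_abs_le_abs_sub ((a * b - y k 0 * t) * linForm ξ w)
        (-((a * t - b * s) * w.1))
      rw [sub_neg_eq_add, ← ev, abs_neg, abs_mul, abs_mul, abs_mul, abs_mul, ← hℓ] at u1
      have u2 := mul_le_mul_of_nonneg_right h1 (abs_nonneg (linForm ξ w))
      have u3 := mul_le_mul_of_nonneg_right h2 (abs_nonneg (w.1 : ℝ))
      have u4 : |(symmDet (y k) : ℝ)| * |(symmDet (y (k + 1)) : ℝ)| ≤ C * C := by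
        have : ∀ j, |(symmDet (y j) : ℝ)| ≤ C := fun j =>
          (h.abs_symmDet_le_const j).trans f5
        exact mul_le_mul (this _) (this _) (abs_nonneg _) hC0.le
      have u5 := mul_le_mul_of_nonneg_right u4 (abs_nonneg (linForm ξ v))
      rw [← hℓ] at u2
      have u6 : 1 / (2 * R) * ℓ = ℓ / (4 * R) + ℓ / (4 * R) := by field_simp; ring
      linarith
    rw [div_le_iff₀ (by positivity)] at h5
    linarith

end IsExtremalSeq

namespace IsExtremalSeq

variable {ξ A : ℝ} {y : ℕ → Fin 3 → ℤ}

theorem exists_le_abs_linForm_of_abs_le (h : IsExtremalSeq ξ y A) (m : ℝ) : ∃ ε : ℝ, 0 < ε ∧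
    ∀ v : ℤ × ℤ, v ≠ 0 → |(v.1 : ℝ)| ≤ m → ε ≤ |linForm ξ v| := by
  have hA := h.const_pos
  set K : ℝ := (2 + 2 * |ξ|) * A with hK
  have hK0 : 0 < K := by positivity
  obtain ⟨k, hk⟩ := h.tendsto (max K (2 * K * m))
  replace hk := hk k le_rfl
  have p := h.pos k
  refine ⟨1 / (4 * y k 0), by positivity, fun v hv hvm => ?_⟩
  have h1 : K ≤ (y k 0 : ℝ) ^ 2 := by
    have := (le_max_left _ _).trans hk
    nlinarith [h.one_le k]
  have h2 := h.one_le_two_mul h1 hv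
  have h3 : K * |(v.1 : ℝ)| / y k 0 ≤ 1 / 2 := by
    rw [div_le_div_iff₀ p two_pos]
    have := (le_max_right _ _).trans hk
    have := mul_le_mul_of_nonneg_left hvm hK0.le
    linarith
  rw [div_le_iff₀ (by positivity)]
  linarith

/-- One step of the descent, for a bound `m` on the first coordinate of the vector: either the
value of the linear form is at least of the order of `1 / m`, or the vector can be replaced by a
vector with a bound `m'` of the order of at most `m ^ (1 / γ ^ 2)`, at the cost of a constant. -/
theorem exists_descent_of_abs_le (h : IsExtremalSeq ξ y A) : ∃ K m₀ : ℝ, 0 < K ∧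
    ∀ m : ℝ, m₀ ≤ m → ∀ v : ℤ × ℤ, v ≠ 0 → |(v.1 : ℝ)| ≤ m → 1 ≤ K * (m * |linForm ξ v|) ∨
      ∃ (w : ℤ × ℤ) (m' : ℝ), w ≠ 0 ∧ |(w.1 : ℝ)| ≤ m' ∧ 1 ≤ m' ∧ m' ≤ m - 1 ∧
        1 + log m' ≤ 3 / 4 * (1 + log m) ∧ m' * |linForm ξ w| ≤ K * (m * |linForm ξ v|) := by
  have hA := h.const_pos
  have hA1 := h.one_le_const
  have hA3 : 1 ≤ A ^ 3 := one_le_pow₀ hA1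
  obtain ⟨C, hC⟩ : ∃ C, C = (4 + 4 * |ξ|) * A ^ 2 := ⟨_, rfl⟩
  have hC1 : 1 ≤ C := by
    have h1 : 1 ≤ A ^ 2 := one_le_pow₀ hA1
    have h2 : 0 ≤ |ξ| * A ^ 2 := by positivity
    rw [hC]; linarith
  have hC0 : 0 < C := zero_lt_one.trans_le hC1
  set C₂ : ℝ := 2 * C * A ^ 3 with hC₂
  have hC₂1 : 1 ≤ C₂ := by
    have : 1 * 1 ≤ C * A ^ 3 := mul_le_mul hC1 hA3 zero_le_one hC0.le
    linarith
  have hC₂0 : 0 < C₂ := zero_lt_one.trans_le hC₂1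
  set C₃ : ℝ := C₂ * A ^ 4 with hC₃
  have hC₃0 : 0 < C₃ := by positivity
  -- all conditions on the size of the terms of the sequence
  set B : ℝ := 16 * C * C₂ * A ^ 3 + 2 * C with hB
  have hB0 : 0 ≤ 16 * C * C₂ * A ^ 3 := by positivity
  have hCC : 16 * C * C₂ * A ^ 3 ≥ 16 * C₂ * A ^ 3 := by
    have : 1 * (16 * C₂ * A ^ 3) ≤ C * (16 * C₂ * A ^ 3) := by gcongr
    linarith
  obtain ⟨N, hN⟩ := h.tendsto B
  refine ⟨max (A ^ 6) (4 * C ^ 2 * C₂), max (y N 0) (max 2 (exp (1 + 4 * log C₃))),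
    lt_max_of_lt_left (by positivity), fun m hm v hv hvm => ?_⟩
  have hm2 : 2 ≤ m := ((le_max_left _ _).trans (le_max_right _ _)).trans hm
  have hm0 : 0 < m := by linarith
  have hlogm : 1 + 4 * log C₃ ≤ log m := by
    rw [le_log_iff_exp_le hm0]
    exact ((le_max_right _ _).trans (le_max_right _ _)).trans hm
  have hmN : (y N 0 : ℝ) ≤ m := (le_max_left _ _).trans hm
  obtain ⟨k, hk1, hk2⟩ : ∃ k, (y k 0 : ℝ) ≤ m ∧ m < y (k + 1) 0 := by
    have hex : ∃ j, m < y j 0 := by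
      obtain ⟨j, hj⟩ := h.tendsto (m + 1)
      exact ⟨j, by have := hj j le_rfl; linarith⟩
    classical
    have hpos : Nat.find hex ≠ 0 := by
      intro h0
      have h1 := Nat.find_spec hex
      rw [h0] at h1
      have h2 : (y 0 0 : ℝ) ≤ y N 0 := by exact_mod_cast h.strictMono.monotone (Nat.zero_le N)
      linarith
    obtain ⟨k, hk⟩ := Nat.exists_eq_succ_of_ne_zero hpos
    refine ⟨k, not_lt.1 (Nat.find_min hex (by omega)), ?_⟩
    have := Nat.find_spec hex
    rwa [hk] at this
  have hNk : N ≤ k := by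
    by_contra hlt
    have h1 : (y (k + 1) 0 : ℝ) ≤ y N 0 := by
      exact_mod_cast h.strictMono.monotone (by omega : k + 1 ≤ N)
    linarith
  have hkB : B ≤ y k 0 := hN k hNk
  have p0 := h.pos k
  have p1 := h.pos (k + 1)
  have p2 := h.pos (k + 2)
  set R : ℝ := y (k + 1 + 1) 0 / y (k + 1) 0 with hR
  have hR0 : 0 < R := div_pos p2 p1
  have hR1 : R ≤ A ^ 3 * y k 0 := by
    rw [hR, div_le_iff₀ p1]
    have := h.succ_succ_le k
    linarith
  have hR2 : (y k 0 : ℝ) ≤ A ^ 3 * R := by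
    rw [hR, ← mul_div_assoc, le_div_iff₀ p1]
    have := h.mul_le_succ_succ k
    linarith
  have hRm : R ≤ A ^ 3 * m := hR1.trans (by gcongr)
  rcases le_or_gt (m / R) (R * |linForm ξ v|) with hcase | hcase
  · left
    rw [div_le_iff₀ hR0] at hcase
    have h1 : R ^ 2 ≤ A ^ 6 * m ^ 2 := by
      calc R ^ 2 ≤ (A ^ 3 * m) ^ 2 := by gcongr
        _ = _ := by ring
    have h2 : m * m ≤ m * (A ^ 6 * m ^ 2 * |linForm ξ v|) := by
      refine mul_le_mul_of_nonneg_left (hcase.trans ?_) hm0.le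
      calc R * |linForm ξ v| * R = R ^ 2 * |linForm ξ v| := by ring
        _ ≤ _ := by gcongr
    have h3 : 1 ≤ A ^ 6 * (m * |linForm ξ v|) := by
      refine le_of_mul_le_mul_left ?_ (by positivity : 0 < m * m)
      linarith
    exact h3.trans (by gcongr; exact le_max_left _ _)
  · right
    have hk1B : 2 * C ≤ (y (k + 1) 0 : ℝ) ^ 2 := by
      have h1 := (h.lt_succ k).le
      have h2 := h.one_le (k + 1)
      nlinarith
    obtain ⟨w, hw0, hw1, hw2⟩ := h.exists_descent hC hk1B hv
    rw [← hR] at hw1 hw2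
    have hk3 : C₂ * m / R ≤ C₃ * m / (A * y k 0) := by
      have h1 : A * y k 0 ≤ A ^ 4 * R := by
        calc A * y k 0 ≤ A * (A ^ 3 * R) := by gcongr
          _ = _ := by ring
      rw [div_le_div_iff₀ hR0 (by positivity)]
      calc C₂ * m * (A * y k 0) ≤ C₂ * m * (A ^ 4 * R) := by gcongr
        _ = _ := by rw [hC₃]; ring
    refine ⟨w, C₂ * m / R, hw0, ?_, ?_, ?_, ?_, ?_⟩
    · have h1 : |(v.1 : ℝ)| / R ≤ m / R := by gcongr
      have h2 : C₂ * m / R = A ^ 3 * (C * (m / R + m / R)) := by rw [hC₂]; ring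
      have h3 : |(w.1 : ℝ)| ≤ C * (m / R + m / R) :=
        hw1.trans (mul_le_mul_of_nonneg_left (add_le_add hcase.le h1) hC0.le)
      rw [h2]
      exact h3.trans (le_mul_of_one_le_left (by positivity) hA3)
    · rw [le_div_iff₀ hR0, one_mul]
      refine hRm.trans (mul_le_mul_of_nonneg_right ?_ hm0.le)
      have : 1 * A ^ 3 ≤ 2 * C * A ^ 3 := by gcongr; linarith
      linarith
    · have h1 : C₂ * m / R ≤ m / 2 := by
        rw [div_le_div_iff₀ hR0 two_pos]
        have h2 : 2 * C₂ ≤ R := by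
          have h3 : A ^ 3 * (2 * C₂) ≤ A ^ 3 * R := by
            have : 0 ≤ C₂ * A ^ 3 := by positivity
            linarith
          exact le_of_mul_le_mul_left h3 (by positivity)
        have := mul_le_mul_of_nonneg_right h2 hm0.le
        linarith
      linarith
    · -- here the bound `m / y k 0 ≤ A * m ^ (1 / γ ^ 2)` is used
      have hg := goldenRoot_pos hm0
      have hgy : goldenRoot m ≤ A * y k 0 :=
        (goldenRoot_mono hm0.le hk2.le).trans (h.goldenRoot_le k)
      have h1 : C₂ * m / R ≤ C₃ * goldenRoot (goldenRoot m) := by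
        refine hk3.trans ?_
        rw [div_le_iff₀ (by positivity)]
        calc C₃ * m = C₃ * (goldenRoot m * goldenRoot (goldenRoot m)) := by
              rw [goldenRoot_mul_goldenRoot_goldenRoot hm0]
          _ ≤ C₃ * (A * y k 0 * goldenRoot (goldenRoot m)) := by
              have := goldenRoot_pos hg
              gcongr
          _ = _ := by ring
      have h2 : log (C₂ * m / R) ≤ log C₃ + log (goldenRoot (goldenRoot m)) := by
        rw [← log_mul hC₃0.ne' (goldenRoot_pos hg).ne']
        exact log_le_log (by positivity) h1
      have h3 : log (goldenRoot (goldenRoot m)) = (1 - φ⁻¹) * log m := by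
        unfold goldenRoot
        rw [log_rpow (rpow_pos_of_pos hm0 _), log_rpow hm0]
        linear_combination log m * goldenRatio_inv_add_sq
      have h4 : 1 / 2 ≤ φ⁻¹ := by
        rw [one_div]
        exact inv_anti₀ goldenRatio_pos goldenRatio_lt_two.le
      have h5 : 0 ≤ log m := log_nonneg (by linarith)
      have h6 : (1 - φ⁻¹) * log m ≤ 1 / 2 * log m := by gcongr; linarith
      linarith
    · have h1 : |(w.1 : ℝ)| ≤ y (k + 1) 0 / (16 * C) := by
        refine hw1.trans ?_
        have h2 : |(v.1 : ℝ)| / R ≤ m / R := by gcongr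
        have h3 : C * (R * |linForm ξ v| + |(v.1 : ℝ)| / R) ≤ C₂ * m / R := by
          calc _ ≤ C * (m / R + m / R) := by gcongr
            _ ≤ A ^ 3 * (C * (m / R + m / R)) := le_mul_of_one_le_left (by positivity) hA3
            _ = _ := by rw [hC₂]; ring
        refine h3.trans ?_
        rw [div_le_div_iff₀ hR0 (by positivity)]
        have h4 : 16 * C * C₂ ≤ R := by
          refine le_of_mul_le_mul_left (?_ : A ^ 3 * (16 * C * C₂) ≤ A ^ 3 * R) (by positivity)
          linarith
        calc C₂ * m * (16 * C) = m * (16 * C * C₂) := by ring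
          _ ≤ y (k + 1) 0 * R := mul_le_mul hk2.le h4 (by positivity) p1.le
      calc C₂ * m / R * |linForm ξ w|
          ≤ C₂ * m / R * (4 * C ^ 2 * R * |linForm ξ v|) := by gcongr; exact hw2 h1
        _ = (4 * C ^ 2 * C₂) * (m * |linForm ξ v|) := by field_simp
        _ ≤ _ := by gcongr; exact le_max_right _ _

/-- Iterating the descent about `log log m` times loses a constant to that power, that is, a power
of `log m`. -/
theorem exists_le_mul_abs_linForm (h : IsExtremalSeq ξ y A) : ∃ (κ : ℝ) (t : ℕ), 0 < κ ∧
    ∀ m : ℝ, 1 ≤ m → ∀ v : ℤ × ℤ, v ≠ 0 → |(v.1 : ℝ)| ≤ m →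
      κ ≤ m * |linForm ξ v| * (1 + log m) ^ t := by
  obtain ⟨K, m₀, hK, hstep⟩ := h.exists_descent_of_abs_le
  obtain ⟨ε, hε, hbase⟩ := h.exists_le_abs_linForm_of_abs_le m₀
  obtain ⟨t, ht⟩ : ∃ t : ℕ, K * (3 / 4) ^ t ≤ 1 := by
    obtain ⟨t, ht⟩ := exists_pow_lt_of_lt_one (inv_pos.2 hK) (by norm_num : (3 / 4 : ℝ) < 1)
    refine ⟨t, ?_⟩
    have := mul_le_mul_of_nonneg_left ht.le hK.le
    rwa [mul_inv_cancel₀ hK.ne'] at this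
  have key : ∀ n : ℕ, ∀ m : ℝ, m ≤ n → 1 ≤ m → ∀ v : ℤ × ℤ, v ≠ 0 → |(v.1 : ℝ)| ≤ m →
      min ε K⁻¹ ≤ m * |linForm ξ v| * (1 + log m) ^ t := by
    intro n
    induction n with
    | zero =>
      intro m hmn hm
      exfalso
      norm_num at hmn
      linarith
    | succ n ih =>
      intro m hmn hm v hv hvm
      have hlog : 0 ≤ log m := log_nonneg hm
      have hpow : 1 ≤ (1 + log m) ^ t := one_le_pow₀ (by linarith)
      rcases le_or_gt m₀ m with hm₀ | hm₀
      · rcases hstep m hm₀ v hv hvm with h1 | ⟨w, m', hw, hwm, hm'1, hm'm, hlog', hle⟩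
        · refine (min_le_right _ _).trans ?_
          have h2 : K⁻¹ ≤ m * |linForm ξ v| := (inv_le_iff_one_le_mul₀' hK).2 h1
          exact h2.trans (le_mul_of_one_le_right (by positivity) hpow)
        · have h2 := ih m' (by push_cast at hmn; linarith) hm'1 w hw hwm
          have h3 : 0 ≤ log m' := log_nonneg hm'1
          calc min ε K⁻¹ ≤ m' * |linForm ξ w| * (1 + log m') ^ t := h2
            _ ≤ K * (m * |linForm ξ v|) * (3 / 4 * (1 + log m)) ^ t := by gcongr
            _ = (K * (3 / 4) ^ t) * (m * |linForm ξ v| * (1 + log m) ^ t) := by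
              rw [mul_pow]; ring
            _ ≤ 1 * (m * |linForm ξ v| * (1 + log m) ^ t) := by gcongr
            _ = _ := one_mul _
      · refine (min_le_left _ _).trans ((hbase v hv (hvm.trans hm₀.le)).trans ?_)
        calc |linForm ξ v| = 1 * |linForm ξ v| * 1 := by ring
          _ ≤ m * |linForm ξ v| * (1 + log m) ^ t := by gcongr
  refine ⟨min ε K⁻¹, t, lt_min hε (inv_pos.2 hK), fun m hm v hv hvm => ?_⟩
  exact key ⌈m⌉₊ m (Nat.le_ceil m) hm v hv hvm

theorem exists_le_abs_sub_rat (h : IsExtremalSeq ξ y A) : ∃ c t : ℝ, 0 < c ∧ 0 < t ∧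
    ∀ α : ℚ, c * naiveHeight (α : ℂ) ^ (-2 : ℝ) * (1 + log (naiveHeight (α : ℂ))) ^ (-t) ≤
      |ξ - (α : ℝ)| := by
  obtain ⟨κ, t, hκ, hlow⟩ := h.exists_le_mul_abs_linForm
  refine ⟨κ, t + 1, hκ, by positivity, fun α => ?_⟩
  obtain ⟨P, hirr, hroot, hH, hd⟩ := exists_irreducible_eq_naiveHeight
    (isAlgebraic_algebraMap (A := ℂ) α)
  rw [minpoly.eq_X_sub_C ℂ α, Polynomial.natDegree_X_sub_C] at hd
  have hH1 := one_le_supNorm hirr.ne_zero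
  have hH0 : 0 < P.supNorm := zero_lt_one.trans_le hH1
  have hq : P.coeff 1 ≠ 0 := by
    rw [← hd]
    exact Polynomial.leadingCoeff_ne_zero.2 hirr.ne_zero
  have hc2 : P.coeff 2 = 0 := Polynomial.coeff_eq_zero_of_natDegree_lt (by omega)
  have hc3 : P.coeff 3 = 0 := Polynomial.coeff_eq_zero_of_natDegree_lt (by omega)
  have hα : (P.coeff 0 : ℝ) + P.coeff 1 * α = 0 := by
    rw [aeval_eq_of_natDegree_le_three (by omega), hc2, hc3, eq_ratCast] at hroot
    have : ((((P.coeff 0 : ℝ) + P.coeff 1 * α : ℝ)) : ℂ) = 0 := by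
      push_cast
      linear_combination hroot
    exact_mod_cast this
  have h1 := hlow P.supNorm hH1 (P.coeff 1, -P.coeff 0)
    (fun h0 => hq (congrArg Prod.fst h0)) (abs_coeff_le_supNorm P 1)
  have h2 : |linForm ξ (P.coeff 1, -P.coeff 0)| ≤ P.supNorm * |ξ - α| := by
    have e : linForm ξ (P.coeff 1, -P.coeff 0) = P.coeff 1 * (ξ - α) := by
      simp only [linForm]
      push_cast
      linear_combination hα
    rw [e, abs_mul]
    gcongr
    exact abs_coeff_le_supNorm P 1
  rw [eq_ratCast] at hH
  rw [hH]
  clear hH hroot hd hirr hq hc2 hc3 hα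
  replace h1 := h1.trans (mul_le_mul_of_nonneg_right (mul_le_mul_of_nonneg_left h2 hH0.le)
    (pow_nonneg (add_nonneg zero_le_one (log_nonneg hH1)) t))
  clear h2
  generalize P.supNorm = H at *
  have hlog : 0 ≤ log H := log_nonneg hH1
  have hL1 : 1 ≤ 1 + log H := by linarith
  have hL0 : 0 < 1 + log H := by linarith
  have hpow : (1 + log H) ^ t ≤ (1 + log H) ^ ((t : ℝ) + 1) := by
    rw [← rpow_natCast]
    exact rpow_le_rpow_of_exponent_le hL1 (by linarith)
  rw [rpow_neg hH0.le, rpow_neg hL0.le, ← div_eq_mul_inv, ← div_eq_mul_inv, div_div,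
    div_le_iff₀ (by positivity), rpow_two]
  calc κ ≤ H * (H * |ξ - α|) * (1 + log H) ^ t := h1
    _ ≤ H * (H * |ξ - α|) * (1 + log H) ^ ((t : ℝ) + 1) :=
      mul_le_mul_of_nonneg_left hpow (by positivity)
    _ = _ := by ring

end IsExtremalSeq

/-! ### Quadratic approximation -/

/-- A root of a quadratic polynomial with small constant term, by the quadratic formula in the form
that avoids cancellation. -/
theorem exists_small_root {a b c : ℝ} (hb : b ≠ 0) (h : 4 * (|a| * |c|) ≤ b ^ 2) :
    ∃ t : ℝ, |t| ≤ 2 * |c| / |b| ∧ c + b * t + a * t ^ 2 = 0 := by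
  have key : ∀ b : ℝ, 0 < b → 4 * (|a| * |c|) ≤ b ^ 2 →
      ∃ t : ℝ, |t| ≤ 2 * |c| / |b| ∧ c + b * t + a * t ^ 2 = 0 := by
    intro b hb h
    have hD : 0 ≤ b ^ 2 - 4 * a * c := by
      have := le_abs_self (a * c)
      rw [abs_mul] at this
      linarith
    set s := √(b ^ 2 - 4 * a * c) with hs
    have hs0 : 0 ≤ s := Real.sqrt_nonneg _
    have hs2 : s ^ 2 = b ^ 2 - 4 * a * c := Real.sq_sqrt hD
    have hbs : 0 < b + s := by linarith
    refine ⟨-(2 * c) / (b + s), ?_, ?_⟩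
    · rw [abs_div, abs_neg, abs_mul, abs_two, abs_of_pos hb, abs_of_pos hbs]
      gcongr
      linarith
    · field_simp
      linear_combination c * hs2
  rcases hb.lt_or_gt with hb | hb
  · obtain ⟨t, ht, h0⟩ := key (-b) (by linarith) (by rwa [neg_sq])
    refine ⟨-t, by rwa [abs_neg, ← abs_neg b], by linear_combination h0⟩
  · exact key b hb h

/-- The height of an irrational root of a nonzero integer polynomial of degree at most two is at
most the largest absolute value of the coefficients. -/
theorem naiveHeight_le_of_root {α : ℝ} (hirr : Irrational α) {m : Fin 3 → ℤ} (hm : m ≠ 0)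
    (h : (m 0 : ℝ) + m 1 * α + m 2 * α ^ 2 = 0) {M : ℝ} (hM : ∀ i, |(m i : ℝ)| ≤ M) :
    1 ≤ naiveHeight (α : ℂ) ∧ naiveHeight (α : ℂ) ≤ M := by
  have hq : (minpoly ℚ α).natDegree = 2 := isQuadratic_of_root hirr hm h
  have hint : IsIntegral ℚ α := by
    by_contra hcon
    rw [minpoly.eq_zero hcon] at hq
    simp at hq
  have hmin : minpoly ℚ (α : ℂ) = minpoly ℚ α :=
    minpoly.algebraMap_eq (B := ℝ) (B' := ℂ) Complex.ofReal_injective α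
  obtain ⟨P, hP, hroot, hH, hd⟩ := exists_irreducible_eq_naiveHeight (α := (α : ℂ))
    (hint.isAlgebraic.algebraMap (S := ℝ) (A := ℂ))
  rw [hmin, hq] at hd
  have hprim : P.IsPrimitive := hP.isPrimitive (by omega)
  have hp2 : P.coeff 2 ≠ 0 := by
    rw [← hd]
    exact Polynomial.leadingCoeff_ne_zero.2 hP.ne_zero
  have hc3 : P.coeff 3 = 0 := Polynomial.coeff_eq_zero_of_natDegree_lt (by omega)
  have hrP : (P.coeff 0 : ℝ) + P.coeff 1 * α + P.coeff 2 * α ^ 2 = 0 := by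
    rw [aeval_eq_of_natDegree_le_three (by omega), hc3] at hroot
    have : ((((P.coeff 0 : ℝ) + P.coeff 1 * α + P.coeff 2 * α ^ 2 : ℝ)) : ℂ) = 0 := by
      push_cast
      push_cast at hroot
      linear_combination hroot
    exact_mod_cast this
  -- the two polynomials are proportional
  have hprop : ∀ i : Fin 3, m 2 * P.coeff i = P.coeff 2 * m i := by
    by_contra hne
    have hm' : (fun i : Fin 3 => m 2 * P.coeff i - P.coeff 2 * m i) ≠ 0 := by
      intro h0
      exact hne fun i => sub_eq_zero.1 (congrFun h0 i)
    apply hm'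
    have hlin : ((m 2 * P.coeff 0 - P.coeff 2 * m 0 : ℤ) : ℝ)
        + ((m 2 * P.coeff 1 - P.coeff 2 * m 1 : ℤ) : ℝ) * α = 0 := by
      push_cast
      linear_combination m 2 * hrP - P.coeff 2 * h
    have e1 : m 2 * P.coeff 1 - P.coeff 2 * m 1 = 0 := by
      by_contra e1
      refine ((hirr.intCast_mul e1).intCast_add (m 2 * P.coeff 0 - P.coeff 2 * m 0)) ⟨0, ?_⟩
      rw [hlin]
      simp
    have e0 : m 2 * P.coeff 0 - P.coeff 2 * m 0 = 0 := by
      rw [e1, Int.cast_zero, zero_mul, add_zero] at hlin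
      exact_mod_cast hlin
    ext i
    fin_cases i
    · exact e0
    · exact e1
    · simp only [Fin.reduceFinMk, Pi.zero_apply, Fin.isValue]
      ring
  have hdvd : P.coeff 2 ∣ m 2 := by
    have h1 : Polynomial.C (P.coeff 2) ∣ Polynomial.C (m 2) * P := by
      rw [Polynomial.C_dvd_iff_dvd_coeff]
      intro i
      rw [Polynomial.coeff_C_mul]
      rcases Nat.lt_or_ge i 3 with hi | hi
      · exact Dvd.intro _ (hprop ⟨i, hi⟩).symm
      · rw [Polynomial.coeff_eq_zero_of_natDegree_lt (p := P) (n := i) (by omega), mul_zero]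
        exact dvd_zero _
    rw [← Polynomial.dvd_content_iff_C_dvd, Polynomial.content_C_mul, hprim.content_eq_one,
      mul_one, dvd_normalize_iff] at h1
    exact h1
  obtain ⟨n, hn⟩ := hdvd
  have hmn : ∀ i : Fin 3, m i = n * P.coeff i := by
    intro i
    apply mul_left_cancel₀ hp2
    rw [← hprop i, hn]
    ring
  have hn0 : n ≠ 0 := by
    rintro rfl
    apply hm
    ext i
    rw [hmn i, zero_mul, Pi.zero_apply]
  have hn1 : (1 : ℝ) ≤ |(n : ℝ)| := by exact_mod_cast Int.one_le_abs hn0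
  rw [hH]
  refine ⟨one_le_supNorm hP.ne_zero, ?_⟩
  obtain ⟨i, hi⟩ := P.exists_eq_supNorm
  rw [hi, Int.norm_eq_abs]
  rcases Nat.lt_or_ge i 3 with hi3 | hi3
  · refine le_trans ?_ (hM ⟨i, hi3⟩)
    rw [hmn ⟨i, hi3⟩, Int.cast_mul, abs_mul]
    exact le_mul_of_one_le_left (abs_nonneg _) hn1
  · rw [Polynomial.coeff_eq_zero_of_natDegree_lt (p := P) (n := i) (by omega), Int.cast_zero, abs_zero]
    exact (abs_nonneg _).trans (hM 0)

/-- The denominator of a rational root of a nonzero integer polynomial of degree at most two is at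
most the larger of the two highest coefficients. -/
theorem den_le_of_root {r : ℚ} {m : Fin 3 → ℤ} (hm : m 1 ≠ 0 ∨ m 2 ≠ 0)
    (h : (m 0 : ℝ) + m 1 * r + m 2 * (r : ℝ) ^ 2 = 0) {M : ℝ} (h1 : |(m 1 : ℝ)| ≤ M)
    (h2 : |(m 2 : ℝ)| ≤ M) : (r.den : ℝ) ≤ M := by
  have hden : (r.den : ℝ) ≠ 0 := by exact_mod_cast r.den_nz
  have hr : (r : ℝ) * r.den = r.num := by exact_mod_cast Rat.mul_den_eq_num r
  have he : (m 0 * r.den ^ 2 + m 1 * r.num * r.den + m 2 * r.num ^ 2 : ℤ) = 0 := by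
    have : (m 0 * r.den ^ 2 + m 1 * r.num * r.den + m 2 * r.num ^ 2 : ℝ) = 0 := by
      rw [← hr]
      linear_combination (r.den : ℝ) ^ 2 * h
    exact_mod_cast this
  have hcop : IsCoprime (r.den : ℤ) r.num := by
    rw [Int.isCoprime_iff_gcd_eq_one, Int.gcd_comm]
    exact r.reduced
  have hle : ∀ k : ℤ, k ≠ 0 → (r.den : ℤ) ∣ k → |(k : ℝ)| ≤ M → (r.den : ℝ) ≤ M := by
    intro k hk hdvd hkM
    have := Int.le_of_dvd (abs_pos.2 hk) ((dvd_abs _ _).2 hdvd)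
    refine le_trans ?_ hkM
    exact_mod_cast this
  by_cases hm2 : m 2 = 0
  · refine hle (m 1) (hm.resolve_right (not_not.2 hm2)) ?_ h1
    refine hcop.dvd_of_dvd_mul_right ⟨-m 0, ?_⟩
    have hden' : (r.den : ℤ) ≠ 0 := by exact_mod_cast r.den_nz
    apply mul_left_cancel₀ hden'
    rw [hm2] at he
    linear_combination he
  · refine hle (m 2) hm2 ?_ h2
    refine (hcop.pow_right (n := 2)).dvd_of_dvd_mul_right ⟨-(m 0 * r.den + m 1 * r.num), ?_⟩
    linear_combination he

theorem goldenRoot_goldenRoot_rpow {X : ℝ} (hX : 0 < X) :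
    goldenRoot (goldenRoot X) ^ (2 * φ ^ 2) = X ^ 2 := by
  have hg := goldenRoot_pos hX
  have h1 : ∀ Y : ℝ, 0 < Y → goldenRoot Y ^ φ = Y := fun Y hY =>
    rpow_inv_rpow hY.le goldenRatio_ne_zero
  rw [show 2 * φ ^ 2 = φ * φ * 2 by ring, rpow_mul (goldenRoot_pos hg).le,
    rpow_mul (goldenRoot_pos hg).le, h1 _ hg, h1 _ hX, rpow_two]

namespace IsExtremalSeq

variable {ξ A : ℝ} {y : ℕ → Fin 3 → ℤ}

/-- The polynomial vanishing at two consecutive terms is small at `ξ`. -/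
theorem abs_cross_eval_le (h : IsExtremalSeq ξ y A) (k : ℕ) {m : Fin 3 → ℤ}
    (hm : m = y k ⨯₃ y (k + 1)) : |(m 0 : ℝ) + m 1 * ξ + m 2 * ξ ^ 2| ≤
      4 * A ^ 2 * (y (k + 1) 0 / y k 0) / (y (k + 1) 0 : ℝ) ^ 2 := by
  have hA := h.const_pos
  have p0 := h.pos k
  have p1 := h.pos (k + 1)
  have hm1 := h.abs_cross_le k (Or.inl rfl)
  have hm2 := h.abs_cross_le k (Or.inr rfl)
  rw [← hm] at hm1 hm2
  have h1 := abs_dotProduct_sub_le ξ m (y (k + 1))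
  have h2 : m ⬝ᵥ y (k + 1) = 0 := by rw [dotProduct_comm, hm, dot_cross_self]
  rw [h2, Int.cast_zero, zero_sub, abs_neg, abs_mul, h.abs_zero] at h1
  have h3 : (|(m 1 : ℝ)| + |(m 2 : ℝ)|) * lineDist ξ (y (k + 1)) ≤
      (4 * A * (y (k + 1) 0 / y k 0)) * (A / y (k + 1) 0) :=
    mul_le_mul (by linarith) (h.lineDist_le _) (lineDist_nonneg _ _) (by positivity)
  have h4 := h1.trans h3
  rw [← mul_div_assoc, le_div_iff₀ p1] at h4
  rw [le_div_iff₀ (by positivity)]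
  linarith

/-- The derivative at `ξ` of the polynomial vanishing at two consecutive terms is as large as the
coefficients, since the earlier term is nondegenerate. -/
theorem le_abs_cross_deriv (h : IsExtremalSeq ξ y A) (k : ℕ) {m : Fin 3 → ℤ}
    (hm : m = y k ⨯₃ y (k + 1)) (hk : 2 * A ≤ y k 0)
    (hR : 2 * ((2 + 2 * |ξ|) * A) ≤ y (k + 1) 0 / y k 0) :
    y (k + 1) 0 / y k 0 / 4 ≤ |(m 1 : ℝ) + 2 * ξ * m 2| := by
  have hA := h.const_pos
  have p0 := h.pos k
  have p1 := h.pos (k + 1)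
  obtain ⟨R, hRdef⟩ : ∃ R : ℝ, R = y (k + 1) 0 / y k 0 := ⟨_, rfl⟩
  have hRe : (y (k + 1) 0 : ℝ) = R * y k 0 := by rw [hRdef]; field_simp
  rw [← hRdef] at hR ⊢
  have hR0 : 0 ≤ R := by rw [hRdef]; positivity
  have e : (m 1 : ℝ) + 2 * ξ * m 2 =
      y (k + 1) 0 * symmDeriv ξ (y k) - y k 0 * symmDeriv ξ (y (k + 1)) := by
    rw [hm, cross_one, cross_two]
    simp only [symmDeriv]
    push_cast
    ring
  have h1 : (y k 0 : ℝ) * |symmDeriv ξ (y (k + 1))| ≤ (2 + 2 * |ξ|) * A := by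
    calc (y k 0 : ℝ) * |symmDeriv ξ (y (k + 1))|
        ≤ y (k + 1) 0 * ((1 + 2 * |ξ|) * lineDist ξ (y (k + 1))) :=
          mul_le_mul (h.lt_succ k).le (abs_symmDeriv_le _ _) (abs_nonneg _) p1.le
      _ = (1 + 2 * |ξ|) * (y (k + 1) 0 * lineDist ξ (y (k + 1))) := by ring
      _ ≤ (1 + 2 * |ξ|) * A := by gcongr; exact h.mul_lineDist_le _
      _ ≤ (2 + 2 * |ξ|) * A := by gcongr; linarith
  have h2 : 3 / 4 ≤ y k 0 * |symmDeriv ξ (y k)| := by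
    have hd : (1 : ℝ) ≤ |(symmDet (y k) : ℝ)| := by
      exact_mod_cast Int.one_le_abs (h.symmDet_ne_zero k)
    have u1 : |(symmDet (y k) : ℝ)| ≤ y k 0 * |symmDeriv ξ (y k)| +
        |(y k 0 : ℝ) * ξ - y k 1| ^ 2 := by
      rw [symmDet_eq ξ]
      refine (abs_sub _ _).trans ?_
      rw [abs_mul, h.abs_zero, abs_pow]
    have u2 : |(y k 0 : ℝ) * ξ - y k 1| ≤ 1 / 2 := by
      refine (abs_one_le_lineDist _ _).trans ((h.lineDist_le _).trans ?_)
      rw [div_le_div_iff₀ p0 two_pos]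
      linarith
    have u3 : |(y k 0 : ℝ) * ξ - y k 1| ^ 2 ≤ (1 / 2) ^ 2 := by gcongr
    linarith
  have h3 := abs_sub_abs_le_abs_sub ((y (k + 1) 0 : ℝ) * symmDeriv ξ (y k))
    (y k 0 * symmDeriv ξ (y (k + 1)))
  rw [← e, abs_mul, abs_mul, h.abs_zero, h.abs_zero, hRe] at h3
  have h4 := mul_le_mul_of_nonneg_left h2 hR0
  linarith

theorem abs_cross_le_of_pair (h : IsExtremalSeq ξ y A) (k : ℕ) (i : Fin 3) :
    |(((y k ⨯₃ y (k + 1)) i : ℤ) : ℝ)| ≤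
      (4 * A ^ 2 + 2 * A * (1 + |ξ| + ξ ^ 2)) * (y (k + 1) 0 / y k 0) := by
  have hA := h.const_pos
  have p0 := h.pos k
  have p1 := h.pos (k + 1)
  have hm1 := h.abs_cross_le k (Or.inl rfl)
  have hm2 := h.abs_cross_le k (Or.inr rfl)
  have hc := h.abs_cross_eval_le k rfl
  have hR0 : (0 : ℝ) ≤ y (k + 1) 0 / y k 0 := by positivity
  replace hc := hc.trans (div_le_self (by positivity) (one_le_pow₀ (h.one_le (k + 1))))
  generalize (y (k + 1) 0 / y k 0 : ℝ) = R at *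
  generalize y k ⨯₃ y (k + 1) = m at *
  have t1 : |(m 1 : ℝ)| * |ξ| ≤ 2 * A * R * |ξ| := by gcongr
  have t2 : |(m 2 : ℝ)| * ξ ^ 2 ≤ 2 * A * R * ξ ^ 2 := by gcongr
  have q1 : 0 ≤ A * R * |ξ| := by positivity
  have q2 : 0 ≤ A * R * ξ ^ 2 := by positivity
  have q3 : 0 ≤ A ^ 2 * R := by positivity
  have q4 : 0 ≤ A * R := by positivity
  fin_cases i
  · have e : (m 0 : ℝ) = (m 0 + m 1 * ξ + m 2 * ξ ^ 2) - (m 1 * ξ + m 2 * ξ ^ 2) := by ring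
    have h1 : |(m 0 : ℝ)| ≤ |(m 0 : ℝ) + m 1 * ξ + m 2 * ξ ^ 2| +
        (|(m 1 : ℝ)| * |ξ| + |(m 2 : ℝ)| * ξ ^ 2) := by
      nth_rewrite 1 [e]
      refine (abs_sub _ _).trans (add_le_add_right ((abs_add_le _ _).trans ?_) _)
      rw [abs_mul, abs_mul, abs_of_nonneg (sq_nonneg ξ)]
    simp only [Fin.zero_eta]
    linarith
  · simp only [Fin.mk_one]
    linarith
  · simp only [Fin.reduceFinMk]
    linarith

/-- The polynomial vanishing at two consecutive terms of the sequence has a root close to `ξ`: its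
value at `ξ` is small, while its derivative at `ξ` is as large as its coefficients, as the earlier
term is nondegenerate. The root is not a rational number `p / q`, because the later term,
viewed as a symmetric matrix, would map `(p, -q)` to a nonzero integer vector of norm less than
one. -/
theorem exists_quadratic_root (h : IsExtremalSeq ξ y A) : ∃ B C D : ℝ, 0 < C ∧ 0 < D ∧
    ∀ k, B ≤ y k 0 → ∃ (α : ℝ) (m : Fin 3 → ℤ), Irrational α ∧ m ≠ 0 ∧
      (m 0 : ℝ) + m 1 * α + m 2 * α ^ 2 = 0 ∧
      |ξ - α| ≤ C / (y (k + 2) 0 : ℝ) ^ 2 ∧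
      ∀ i, |(m i : ℝ)| ≤ D * (y (k + 2) 0 / y (k + 1) 0) := by
  have hA := h.const_pos
  have hA1 := h.one_le_const
  have hA2 : 0 < A ^ 2 := by positivity
  have hA3 : 0 < A ^ 3 := by positivity
  set K : ℝ := (2 + 2 * |ξ|) * A with hK
  have hK0 : 0 < K := by positivity
  set D : ℝ := 4 * A ^ 2 + 2 * A * (1 + |ξ| + ξ ^ 2) with hD
  have hD0 : 0 < D := by positivity
  set B : ℝ := 512 * A ^ 3 + 2 * K * A ^ 3 + 2 * A * K + K + 2 * A + 2 with hB
  refine ⟨B, 32 * A ^ 2, D, by positivity, hD0, fun k hk => ?_⟩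
  have hKA3 : 0 < K * A ^ 3 := by positivity
  have hAK : 0 < A * K := by positivity
  have p0 := h.pos k
  have p1 := h.pos (k + 1)
  have p2 := h.pos (k + 2)
  have hk1 : B ≤ y (k + 1) 0 := hk.trans (h.lt_succ k).le
  have hk2 : B ≤ y (k + 2) 0 := hk1.trans (h.lt_succ (k + 1)).le
  set R : ℝ := y (k + 2) 0 / y (k + 1) 0 with hR
  have hR0 : 0 < R := div_pos p2 p1
  have hRe : (y (k + 2) 0 : ℝ) = R * y (k + 1) 0 := by rw [hR]; field_simp
  have hRK : 2 * K ≤ R := by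
    have h1 : (y k 0 : ℝ) ≤ A ^ 3 * R := by
      rw [hR, ← mul_div_assoc, le_div_iff₀ p1]
      have := h.mul_le_succ_succ k
      linarith
    refine le_of_mul_le_mul_left (?_ : A ^ 3 * (2 * K) ≤ A ^ 3 * R) hA3
    linarith
  set m := y (k + 1) ⨯₃ y (k + 2) with hm
  have hm1 : |(m 1 : ℝ)| ≤ 2 * A * R := h.abs_cross_le (k + 1) (Or.inl rfl)
  have hm2 : |(m 2 : ℝ)| ≤ 2 * A * R := h.abs_cross_le (k + 1) (Or.inr rfl)
  set c : ℝ := m 0 + m 1 * ξ + m 2 * ξ ^ 2 with hc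
  set b : ℝ := m 1 + 2 * ξ * m 2 with hb
  have hcle : |c| ≤ 4 * A ^ 2 * R / (y (k + 2) 0 : ℝ) ^ 2 := h.abs_cross_eval_le (k + 1) hm
  have hble : R / 4 ≤ |b| := h.le_abs_cross_deriv (k + 1) hm (by linarith) hRK
  have hb0 : b ≠ 0 := abs_pos.1 (lt_of_lt_of_le (by positivity) hble)
  have hYY : 512 * A ^ 3 ≤ (y (k + 2) 0 : ℝ) ^ 2 := by
    have : 512 * A ^ 3 ≤ y (k + 2) 0 := by linarith
    nlinarith
  obtain ⟨t, ht, ht0⟩ := exists_small_root (a := m 2) (b := b) (c := c) hb0 (by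
    calc 4 * (|(m 2 : ℝ)| * |c|) ≤ 4 * (2 * A * R * (4 * A ^ 2 * R / (y (k + 2) 0 : ℝ) ^ 2)) := by
          gcongr
      _ = 512 * A ^ 3 / (y (k + 2) 0 : ℝ) ^ 2 * (R / 4) ^ 2 := by ring
      _ ≤ 1 * (R / 4) ^ 2 := by
          gcongr
          exact (div_le_one (by positivity)).2 hYY
      _ ≤ b ^ 2 := by
          rw [one_mul, ← sq_abs b]
          gcongr)
  have htle : |t| ≤ 32 * A ^ 2 / (y (k + 2) 0 : ℝ) ^ 2 := by
    calc |t| ≤ 2 * |c| / |b| := ht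
      _ ≤ 2 * (4 * A ^ 2 * R / (y (k + 2) 0 : ℝ) ^ 2) / (R / 4) := by gcongr
      _ = _ := by field_simp; norm_num
  have hroot : (m 0 : ℝ) + m 1 * (ξ + t) + m 2 * (ξ + t) ^ 2 = 0 := by
    rw [hc, hb] at ht0
    linear_combination ht0
  have hm12 : m 1 ≠ 0 ∨ m 2 ≠ 0 := by
    by_contra hcon
    push Not at hcon
    apply hb0
    rw [hb, hcon.1, hcon.2]
    simp
  have hdist : |ξ - (ξ + t)| ≤ 32 * A ^ 2 / (y (k + 2) 0 : ℝ) ^ 2 := by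
    rwa [sub_add_cancel_left, abs_neg]
  refine ⟨ξ + t, m, ?_, ?_, hroot, hdist, ?_⟩
  · rintro ⟨r, hr⟩
    rw [← hr] at hroot hdist
    have hq := den_le_of_root hm12 hroot hm1 hm2
    have hrden : (r : ℝ) * r.den = r.num := by exact_mod_cast Rat.mul_den_eq_num r
    have h1 := h.one_le_two_mul (k := k + 2) (v := ((r.den : ℤ), r.num)) (by
        have : K ≤ y (k + 2) 0 := by linarith
        nlinarith)
      (fun h0 => r.den_nz (Int.natCast_eq_zero.1 (congrArg Prod.fst h0)))
    have e : linForm ξ ((r.den : ℤ), r.num) = r.den * (ξ - r) := by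
      simp only [linForm, Int.cast_natCast]
      linear_combination hrden
    rw [e, abs_mul, Int.cast_natCast, Nat.abs_cast, ← hK] at h1
    have h2 : 2 * y (k + 2) 0 * (r.den * |ξ - r|) + K * r.den / y (k + 2) 0 ≤
        2 * y (k + 2) 0 * ((2 * A * R) * (32 * A ^ 2 / (y (k + 2) 0 : ℝ) ^ 2)) +
          K * (2 * A * R) / y (k + 2) 0 := by gcongr
    have h3 : 2 * y (k + 2) 0 * ((2 * A * R) * (32 * A ^ 2 / (y (k + 2) 0 : ℝ) ^ 2)) +
          K * (2 * A * R) / y (k + 2) 0 = (128 * A ^ 3 + 2 * A * K) / y (k + 1) 0 := by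
      rw [hRe]; field_simp; ring
    have h4 : (128 * A ^ 3 + 2 * A * K) / y (k + 1) 0 < 1 := by
      rw [div_lt_one p1]
      linarith
    linarith
  · rintro h0
    rcases hm12 with h1 | h1 <;> exact h1 (congrFun h0 _)
  · exact h.abs_cross_le_of_pair (k + 1)

theorem infinite_setOf_isQuadratic (h : IsExtremalSeq ξ y A) (hξ : ¬ IsQuadratic ξ) :
    ∃ c : ℝ, 0 < c ∧ {α : ℝ | IsQuadratic α ∧
      |ξ - α| ≤ c * naiveHeight (α : ℂ) ^ (-2 * φ ^ 2)}.Infinite := by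
  obtain ⟨B, C, D, hC, hD, hex⟩ := h.exists_quadratic_root
  have hA := h.const_pos
  have hφ : 0 ≤ 2 * φ ^ 2 := by positivity
  refine ⟨C * (D * A) ^ (2 * φ ^ 2), by positivity, fun hfin => ?_⟩
  -- finitely many numbers different from `ξ` are bounded away from `ξ`
  obtain ⟨ε, hε, hball⟩ := Metric.mem_nhds_iff.1
    (hfin.isClosed.isOpen_compl.mem_nhds (show ξ ∉ _ from fun hmem => hξ hmem.1))
  obtain ⟨k, hk⟩ := h.tendsto (max B (C / ε + 1))
  replace hk := hk k le_rfl
  obtain ⟨α, m, hirr, hm, hroot, hdist, hcoeff⟩ := hex k ((le_max_left _ _).trans hk)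
  have p1 := h.pos (k + 1)
  have p2 := h.pos (k + 2)
  have hg := goldenRoot_pos p2
  have hgg := goldenRoot_pos hg
  obtain ⟨hH1, hH⟩ := naiveHeight_le_of_root hirr hm hroot hcoeff
  have hclose : |ξ - α| ≤
      C * (D * A) ^ (2 * φ ^ 2) * naiveHeight (α : ℂ) ^ (-2 * φ ^ 2) := by
    clear hroot hball
    generalize naiveHeight (α : ℂ) = H at hH1 hH ⊢
    have hH0 : 0 < H := zero_lt_one.trans_le hH1
    have hHY : H ^ (2 * φ ^ 2) ≤ (D * A) ^ (2 * φ ^ 2) * (y (k + 2) 0 : ℝ) ^ 2 := by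
      have h1 : (y (k + 2) 0 : ℝ) / y (k + 1) 0 ≤ A * goldenRoot (goldenRoot (y (k + 2) 0)) := by
        rw [div_le_iff₀ p1]
        nth_rewrite 1 [← goldenRoot_mul_goldenRoot_goldenRoot p2]
        have := mul_le_mul_of_nonneg_right (h.goldenRoot_le (k + 1)) hgg.le
        rw [show k + 1 + 1 = k + 2 from rfl] at this
        linarith
      rw [← goldenRoot_goldenRoot_rpow p2, ← mul_rpow (by positivity) hgg.le]
      refine rpow_le_rpow hH0.le (hH.trans ?_) hφ
      rw [mul_assoc]
      gcongr
    refine hdist.trans ?_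
    rw [neg_mul, rpow_neg hH0.le, ← div_eq_mul_inv, div_le_div_iff₀ (by positivity) (by positivity),
      mul_assoc]
    gcongr
  suffices hmem : α ∈ Metric.ball ξ ε from
    hball hmem ⟨isQuadratic_of_root hirr hm hroot, hclose⟩
  rw [Metric.mem_ball, Real.dist_eq, abs_sub_comm]
  refine hdist.trans_lt ?_
  have h1 : C / ε + 1 ≤ y (k + 2) 0 :=
    ((le_max_right _ _).trans hk).trans ((h.lt_succ k).trans (h.lt_succ (k + 1))).le
  have h2 : C / ε < (y (k + 2) 0 : ℝ) ^ 2 := by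
    have := h.one_le (k + 2)
    nlinarith
  rw [div_lt_iff₀ (by positivity)]
  rwa [div_lt_iff₀ hε, mul_comm] at h2

end IsExtremalSeq

end

theorem mainTheorem3 (ξ : ℝ) (hξ : IsExtremal ξ) :
    ∃ c₁ c₂ c₃ c₄ c₅ : ℝ, 0 < c₁ ∧ 0 < c₂ ∧ 0 < c₃ ∧ 0 < c₄ ∧ 0 < c₅ ∧
      (∀ α : ℚ, c₁ * naiveHeight (α : ℂ) ^ (-2 : ℝ) *
          (1 + Real.log (naiveHeight (α : ℂ))) ^ (-c₂) ≤ |ξ - (α : ℝ)|) ∧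
      (∀ α : ℂ, IsAlgebraic ℚ α → (minpoly ℚ α).natDegree ≤ 2 →
          c₃ * naiveHeight α ^ (-2 * Real.goldenRatio ^ 2) ≤ ‖(ξ : ℂ) - α‖) ∧
      {α : ℝ | IsQuadratic α ∧
          |ξ - α| ≤ c₄ * naiveHeight (α : ℂ) ^ (-2 * Real.goldenRatio ^ 2)}.Infinite ∧
      (∀ α : ℂ, IsIntegral ℤ α → (minpoly ℚ α).natDegree ≤ 3 →
          c₅ * naiveHeight α ^ (-(3 / 2) * Real.goldenRatio ^ 2) ≤ ‖(ξ : ℂ) - α‖) := by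
  obtain ⟨y, A, h⟩ := hξ.exists_isExtremalSeq
  obtain ⟨c₁, c₂, hc₁, hc₂, h₁⟩ := h.exists_le_abs_sub_rat
  obtain ⟨c₃, hc₃, h₃⟩ := h.exists_le_norm_sub_of_natDegree_le_two
  obtain ⟨c₄, hc₄, h₄⟩ := h.infinite_setOf_isQuadratic hξ.2.1
  obtain ⟨c₅, hc₅, h₅⟩ := h.exists_le_norm_sub_of_isIntegral
  exact ⟨c₁, c₂, c₃, c₄, c₅, hc₁, hc₂, hc₃, hc₄, hc₅, h₁, h₃, h₄, h₅⟩
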